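/- **Setting.** Let $d\ge 1$ and let $\Omega\subset\mathbb R^d$ be a polygonal/polyhedral domain with a (conforming, finite) simplicial mesh $\mathcal T_h$: each element $K$ is a simplex, the elements cover $\overline\Omega$, two elements meet in the hull of their common vertices, and $\partial\Omega$ is a union of facets of elements. Let $h_K$ be the length of the longest edge of $K$ and $a_K$ its minimum height (smallest distance from a vertex to the hyperplane of the opposite facet). Assume $\min_K a_K>0$; the mesh need not be regular. Let $a,\mathbf b,c\in W^{1,\infty}(\Omega)$, $f\in W^{1,2}(\Omega)$ ($\mathbf b$ vector-valued, the others scalar), with $a\ge a_0>0$ and $c-\tfrac12\nabla\cdot\mathbf b\ge 0$ a.e. in $\Omega$. For $r\ge 0$ let $$V_h=\{v\in H^1_0(\Omega)\cap C(\overline\Omega): v|_K\in P_r(K)\ \ \forall K\in\mathcal T_h\},$$ with a basis $(\psi_i)$. The FE solution is the $u_h\in V_h$ with $\int_\Omega (a\nabla u_h\cdot\nabla\psi+(\mathbf b\cdot\nabla u_h)\psi+cu_h\psi)\,dx=\int_\Omega f\psi\,dx$ for all $\psi\in V_h$. Let $\dot X$ be a velocity field, continuous on $\overline\Omega$ and continuously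 differentiable in $\Omega$, with $\|\dot X\|_{L^\infty(\Omega)},\|\nabla\dot X\|_{L^\infty(\Omega)}<\infty$, that vanishes at the mesh vertices on $\partial\Omega$. For $0\le t<\delta$ ($\delta>0$) let $\mathcal T_h(t)$ be the mesh with the same connectivity and vertices $x_i(t)=x_i+t\,\dot X(x_i)$, and for $K\in\mathcal T_h$ let $F_{K(t)}$ be the affine map that sends the vertices of $K$ to their positions at time $t$. Suppose the FE solution $\tilde u_h(\cdot,t)$ on $\mathcal T_h(t)$ is such that $\tilde u_h(F_{K(t)}(x),t)=\sum_i u_i(t)\psi_i(x)$ for $x\in K$, $K\in\mathcal T_h$, with coefficients $u_i$ differentiable (from the right) at $t=0$. Let $\dot u_h=\sum_i\dot u_i(0)\psi_i$ be its material derivative. **Theorem.** Then $$a_0\|\nabla\dot u_h\|_{L^2}\le \|f\|_{L^2}\Bigl(1+\frac{C_\Omega}{a_0}\|\nabla a\|_{L^\infty}+\frac{C_\Omega^2}{a_0}\|\nabla\mathbf b\|_{L^\infty}+\frac{2C_\Omega^2}{a_0}\|c\|_{L^\infty}\Bigr)\|\dot X\|_{L^\infty}+\|f\|_{L^2}\Bigl(\frac{3dC_\Omega}{a_0}\|a\|_{L^\infty}+\frac{2dC_\Omega^2}{a_0}\|\mathbf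 b\|_{L^\infty}\Bigr)\|\nabla\dot X\|_{L^\infty}\max_K\frac{h_K}{a_K},$$ where all norms are over $\Omega$ (built on the Euclidean norm for vectors and the spectral norm for matrices), and $C_\Omega$ is the Poincaré constant of $\Omega$: the smallest $C\ge0$ with $\|v\|_{L^2(\Omega)}\le C\|\nabla v\|_{L^2(\Omega)}$ for all $v\in H^1_0(\Omega)$. -/

import Mathlib

open MeasureTheory Set Filter Topology
open scoped ContDiff ENNReal

namespace MeshSensitivity

/-! ### Weak derivatives and Sobolev functions on an open set -/

section Sobolev

variable {d : ℕ} {F : Type*} [NormedAddCommGroup F] [NormedSpace ℝ F]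

/-- Test functions: smooth, with compact support contained in `Ω`. -/
def IsTestFunction (Ω : Set (EuclideanSpace ℝ (Fin d))) (φ : EuclideanSpace ℝ (Fin d) → ℝ) : Prop :=
  ContDiff ℝ ∞ φ ∧ HasCompactSupport φ ∧ tsupport φ ⊆ Ω

/-- `Dg` is a weak (distributional) derivative of `g` on `Ω`: both are locally integrable and
`∫_Ω (∂_w φ) g = - ∫_Ω φ (Dg w)` for all test functions `φ` and all directions `w`. -/
def HasWeakFDeriv (Ω : Set (EuclideanSpace ℝ (Fin d))) (g : EuclideanSpace ℝ (Fin d) → F)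
    (Dg : EuclideanSpace ℝ (Fin d) → EuclideanSpace ℝ (Fin d) →L[ℝ] F) : Prop :=
  LocallyIntegrableOn g Ω ∧ LocallyIntegrableOn Dg Ω ∧
    ∀ φ, IsTestFunction Ω φ → ∀ w : EuclideanSpace ℝ (Fin d),
      ∫ x in Ω, fderiv ℝ φ x w • g x = -∫ x in Ω, φ x • Dg x w

open scoped Classical in
/-- The weak derivative of `g` on `Ω` (unique up to null sets; it is `0` by convention if `g` has
none). -/
noncomputable def weakFDeriv (Ω : Set (EuclideanSpace ℝ (Fin d)))
    (g : EuclideanSpace ℝ (Fin d) → F) :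
    EuclideanSpace ℝ (Fin d) → EuclideanSpace ℝ (Fin d) →L[ℝ] F :=
  if h : ∃ Dg, HasWeakFDeriv Ω g Dg then h.choose else 0

/-- The weak gradient of a scalar function: the vector representing the weak derivative. -/
noncomputable def weakGrad (Ω : Set (EuclideanSpace ℝ (Fin d)))
    (v : EuclideanSpace ℝ (Fin d) → ℝ) (x : EuclideanSpace ℝ (Fin d)) :
    EuclideanSpace ℝ (Fin d) :=
  (InnerProductSpace.toDual ℝ (EuclideanSpace ℝ (Fin d))).symm (weakFDeriv Ω v x)

/-- The weak divergence of a vector field: the trace of the weak derivative. -/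
noncomputable def weakDiv (Ω : Set (EuclideanSpace ℝ (Fin d)))
    (b : EuclideanSpace ℝ (Fin d) → EuclideanSpace ℝ (Fin d)) (x : EuclideanSpace ℝ (Fin d)) : ℝ :=
  LinearMap.trace ℝ (EuclideanSpace ℝ (Fin d)) (weakFDeriv Ω b x : _ →ₗ[ℝ] _)

/-- The Sobolev class `W^{1,p}(Ω)`. -/
def MemW1 (Ω : Set (EuclideanSpace ℝ (Fin d))) (p : ℝ≥0∞)
    (g : EuclideanSpace ℝ (Fin d) → F) : Prop :=
  MemLp g p (volume.restrict Ω) ∧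
    ∃ Dg, HasWeakFDeriv Ω g Dg ∧ MemLp Dg p (volume.restrict Ω)

/-- The class `H_0^1(Ω)`: the closure of the test functions in `H^1(Ω) = W^{1,2}(Ω)`. -/
def MemH10 (Ω : Set (EuclideanSpace ℝ (Fin d))) (v : EuclideanSpace ℝ (Fin d) → ℝ) : Prop :=
  MemLp v 2 (volume.restrict Ω) ∧
    ∃ Dv, HasWeakFDeriv Ω v Dv ∧ MemLp Dv 2 (volume.restrict Ω) ∧
      ∃ φ : ℕ → EuclideanSpace ℝ (Fin d) → ℝ, (∀ n, IsTestFunction Ω (φ n)) ∧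
        Tendsto (fun n => eLpNorm (φ n - v) 2 (volume.restrict Ω)) atTop (𝓝 0) ∧
        Tendsto (fun n => eLpNorm (fderiv ℝ (φ n) - Dv) 2 (volume.restrict Ω)) atTop (𝓝 0)

/-- The Poincaré constant of `Ω`: the smallest `C ≥ 0` with
`‖v‖_{L²(Ω)} ≤ C ‖∇v‖_{L²(Ω)}` for all `v ∈ H_0^1(Ω)`. -/
noncomputable def poincareConst (Ω : Set (EuclideanSpace ℝ (Fin d))) : ℝ :=
  sInf {C : ℝ | 0 ≤ C ∧ ∀ v : EuclideanSpace ℝ (Fin d) → ℝ, MemH10 Ω v →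
    lpNorm v 2 (volume.restrict Ω) ≤ C * lpNorm (weakGrad Ω v) 2 (volume.restrict Ω)}

theorem IsTestFunction.add {Ω : Set (EuclideanSpace ℝ (Fin d))}
    {φ ψ : EuclideanSpace ℝ (Fin d) → ℝ} (hφ : IsTestFunction Ω φ) (hψ : IsTestFunction Ω ψ) :
    IsTestFunction Ω (φ + ψ) :=
  ⟨hφ.1.add hψ.1, hφ.2.1.add hψ.2.1,
    (tsupport_add φ ψ).trans (union_subset hφ.2.2 hψ.2.2)⟩

theorem IsTestFunction.smul {Ω : Set (EuclideanSpace ℝ (Fin d))}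
    {φ : EuclideanSpace ℝ (Fin d) → ℝ} (r : ℝ) (hφ : IsTestFunction Ω φ) :
    IsTestFunction Ω (r • φ) :=
  ⟨contDiff_const.smul hφ.1, hφ.2.1.smul_left (f := fun _ => r),
    (tsupport_smul_subset_right (fun _ => r) φ).trans hφ.2.2⟩

theorem locallyIntegrableOn_zero_aux {G : Type*} [NormedAddCommGroup G]
    (Ω : Set (EuclideanSpace ℝ (Fin d))) :
    LocallyIntegrableOn (0 : EuclideanSpace ℝ (Fin d) → G) Ω :=
  locallyIntegrableOn_zero

theorem eLpNorm_zero_aux {G : Type*} [NormedAddCommGroup G] {p : ℝ≥0∞}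
    {μ : Measure (EuclideanSpace ℝ (Fin d))} :
    eLpNorm (0 : EuclideanSpace ℝ (Fin d) → G) p μ = 0 := eLpNorm_zero

theorem HasWeakFDeriv.zero (Ω : Set (EuclideanSpace ℝ (Fin d))) :
    HasWeakFDeriv Ω (0 : EuclideanSpace ℝ (Fin d) → F) 0 := by
  refine ⟨locallyIntegrableOn_zero_aux Ω, locallyIntegrableOn_zero_aux Ω, fun φ _ w => ?_⟩
  simp

/-- A locally integrable function times a continuous function with compact support in `Ω`. -/
theorem integrable_smul_of_tsupport_subset {Ω : Set (EuclideanSpace ℝ (Fin d))}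
    {g : EuclideanSpace ℝ (Fin d) → F} (hg : LocallyIntegrableOn g Ω)
    {η : EuclideanSpace ℝ (Fin d) → ℝ} (hη : Continuous η) (hc : HasCompactSupport η)
    (hs : tsupport η ⊆ Ω) : Integrable (fun x => η x • g x) (volume.restrict Ω) := by
  have h1 : IntegrableOn (fun x => η x • g x) (tsupport η) :=
    (hg.integrableOn_compact_subset hs hc).continuousOn_smul hη.continuousOn hc
  have h2 : Integrable (fun x => η x • g x) volume := by
    refine (integrableOn_iff_integrable_of_support_subset ?_).1 h1
    intro x hx
    refine subset_tsupport η ?_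
    intro h0
    exact hx (by simp [h0])
  exact h2.integrableOn

theorem HasWeakFDeriv.integrable_left {Ω : Set (EuclideanSpace ℝ (Fin d))}
    {g : EuclideanSpace ℝ (Fin d) → F}
    {Dg : EuclideanSpace ℝ (Fin d) → EuclideanSpace ℝ (Fin d) →L[ℝ] F}
    (hg : HasWeakFDeriv Ω g Dg) {φ : EuclideanSpace ℝ (Fin d) → ℝ} (hφ : IsTestFunction Ω φ)
    (w : EuclideanSpace ℝ (Fin d)) :
    Integrable (fun x => fderiv ℝ φ x w • g x) (volume.restrict Ω) := by
  have hsub : tsupport (fun x => fderiv ℝ φ x w) ⊆ tsupport φ :=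
    closure_minimal (fun x hx => support_fderiv_subset (𝕜 := ℝ) (f := φ)
      (fun h => hx (by simp [h]))) (isClosed_tsupport φ)
  refine integrable_smul_of_tsupport_subset hg.1 ?_ ?_ (hsub.trans hφ.2.2)
  · exact (hφ.1.continuous_fderiv (by simp)).clm_apply continuous_const
  · exact hφ.2.1.of_isClosed_subset (isClosed_tsupport _) hsub

theorem HasWeakFDeriv.integrable_right {Ω : Set (EuclideanSpace ℝ (Fin d))}
    {g : EuclideanSpace ℝ (Fin d) → F}
    {Dg : EuclideanSpace ℝ (Fin d) → EuclideanSpace ℝ (Fin d) →L[ℝ] F}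
    (hg : HasWeakFDeriv Ω g Dg) {φ : EuclideanSpace ℝ (Fin d) → ℝ} (hφ : IsTestFunction Ω φ)
    (w : EuclideanSpace ℝ (Fin d)) :
    Integrable (fun x => φ x • Dg x w) (volume.restrict Ω) :=
  (integrable_smul_of_tsupport_subset hg.2.1 hφ.1.continuous hφ.2.1 hφ.2.2).apply_continuousLinearMap w

theorem HasWeakFDeriv.add {Ω : Set (EuclideanSpace ℝ (Fin d))}
    {g₁ g₂ : EuclideanSpace ℝ (Fin d) → F}
    {D₁ D₂ : EuclideanSpace ℝ (Fin d) → EuclideanSpace ℝ (Fin d) →L[ℝ] F}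
    (h₁ : HasWeakFDeriv Ω g₁ D₁) (h₂ : HasWeakFDeriv Ω g₂ D₂) :
    HasWeakFDeriv Ω (g₁ + g₂) (D₁ + D₂) := by
  refine ⟨?_, ?_, fun φ hφ w => ?_⟩
  · simpa using h₁.1.sub h₂.1.neg
  · simpa using h₁.2.1.sub h₂.2.1.neg
  simp only [Pi.add_apply, smul_add, _root_.add_apply]
  rw [integral_add (h₁.integrable_left hφ w) (h₂.integrable_left hφ w),
    integral_add (h₁.integrable_right hφ w) (h₂.integrable_right hφ w), h₁.2.2 φ hφ w,
    h₂.2.2 φ hφ w, neg_add]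

theorem HasWeakFDeriv.smul {Ω : Set (EuclideanSpace ℝ (Fin d))}
    {g : EuclideanSpace ℝ (Fin d) → F}
    {Dg : EuclideanSpace ℝ (Fin d) → EuclideanSpace ℝ (Fin d) →L[ℝ] F} (r : ℝ)
    (h : HasWeakFDeriv Ω g Dg) : HasWeakFDeriv Ω (r • g) (r • Dg) := by
  refine ⟨h.1.smul r, h.2.1.smul r, fun φ hφ w => ?_⟩
  simp only [Pi.smul_apply, _root_.smul_apply, smul_comm _ r]
  rw [integral_smul, integral_smul, h.2.2 φ hφ w, smul_neg]

theorem memLp_zero_aux {G : Type*} [NormedAddCommGroup G] {p : ℝ≥0∞}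
    {μ : Measure (EuclideanSpace ℝ (Fin d))} :
    MemLp (0 : EuclideanSpace ℝ (Fin d) → G) p μ := MemLp.zero

theorem memLp_add_aux {G : Type*} [NormedAddCommGroup G] {p : ℝ≥0∞}
    {μ : Measure (EuclideanSpace ℝ (Fin d))} {g h : EuclideanSpace ℝ (Fin d) → G}
    (hg : MemLp g p μ) (hh : MemLp h p μ) : MemLp (g + h) p μ := hg.add hh

theorem tendsto_eLpNorm_add_aux {G : Type*} [NormedAddCommGroup G] {p : ℝ≥0∞} (hp : 1 ≤ p)
    {μ : Measure (EuclideanSpace ℝ (Fin d))} {g h : ℕ → EuclideanSpace ℝ (Fin d) → G}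
    {g' h' : EuclideanSpace ℝ (Fin d) → G} (hg : ∀ n, AEStronglyMeasurable (g n) μ)
    (hh : ∀ n, AEStronglyMeasurable (h n) μ) (hg' : AEStronglyMeasurable g' μ)
    (hh' : AEStronglyMeasurable h' μ) (tg : Tendsto (fun n => eLpNorm (g n - g') p μ) atTop (𝓝 0))
    (th : Tendsto (fun n => eLpNorm (h n - h') p μ) atTop (𝓝 0)) :
    Tendsto (fun n => eLpNorm (g n + h n - (g' + h')) p μ) atTop (𝓝 0) := by
  have h0 := tg.add th
  rw [add_zero] at h0
  refine tendsto_of_tendsto_of_tendsto_of_le_of_le tendsto_const_nhds h0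
    (fun _ => zero_le) fun n => ?_
  rw [add_sub_add_comm]
  exact eLpNorm_add_le ((hg n).sub hg') ((hh n).sub hh') hp

theorem MemH10.zero (Ω : Set (EuclideanSpace ℝ (Fin d))) : MemH10 Ω 0 := by
  refine ⟨memLp_zero_aux, 0, HasWeakFDeriv.zero Ω, memLp_zero_aux, fun _ => 0, fun _ => ?_, ?_, ?_⟩
  · exact ⟨contDiff_const, HasCompactSupport.zero, by simp [tsupport]⟩
  · simp
  · simp [eLpNorm_zero_aux]

theorem MemH10.add {Ω : Set (EuclideanSpace ℝ (Fin d))} {u v : EuclideanSpace ℝ (Fin d) → ℝ}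
    (hu : MemH10 Ω u) (hv : MemH10 Ω v) : MemH10 Ω (u + v) := by
  obtain ⟨hu2, Du, hDu, hDu2, φ, hφ, hφu, hφD⟩ := hu
  obtain ⟨hv2, Dv, hDv, hDv2, ψ, hψ, hψv, hψD⟩ := hv
  refine ⟨memLp_add_aux hu2 hv2, Du + Dv, hDu.add hDv, memLp_add_aux hDu2 hDv2, fun n => φ n + ψ n,
    fun n => (hφ n).add (hψ n), ?_, ?_⟩
  · exact tendsto_eLpNorm_add_aux (by norm_num) (fun n => (hφ n).1.continuous.aestronglyMeasurable)
      (fun n => (hψ n).1.continuous.aestronglyMeasurable) hu2.1 hv2.1 hφu hψv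
  · have hf : ∀ n, fderiv ℝ (φ n + ψ n) = fderiv ℝ (φ n) + fderiv ℝ (ψ n) := by
      intro n
      ext1 x
      exact fderiv_add ((hφ n).1.differentiable (by simp) x) ((hψ n).1.differentiable (by simp) x)
    simp only [hf]
    exact tendsto_eLpNorm_add_aux (by norm_num)
      (fun n => ((hφ n).1.continuous_fderiv (by simp)).aestronglyMeasurable)
      (fun n => ((hψ n).1.continuous_fderiv (by simp)).aestronglyMeasurable) hDu2.1 hDv2.1 hφD hψD

theorem MemH10.smul {Ω : Set (EuclideanSpace ℝ (Fin d))} {u : EuclideanSpace ℝ (Fin d) → ℝ}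
    (r : ℝ) (hu : MemH10 Ω u) : MemH10 Ω (r • u) := by
  obtain ⟨hu2, Du, hDu, hDu2, φ, hφ, hφu, hφD⟩ := hu
  refine ⟨hu2.const_smul r, r • Du, hDu.smul r, hDu2.const_smul r, fun n => r • φ n,
    fun n => (hφ n).smul r, ?_, ?_⟩
  · simp only [← smul_sub, eLpNorm_const_smul]
    simpa using ENNReal.Tendsto.const_mul hφu (Or.inr (by simp : ‖r‖ₑ ≠ ⊤))
  · have hf : ∀ n, fderiv ℝ (r • φ n) = r • fderiv ℝ (φ n) := by
      intro n
      ext1 x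
      exact fderiv_const_smul ((hφ n).1.differentiable (by simp) x) r
    simp only [hf, ← smul_sub, eLpNorm_const_smul]
    simpa using ENNReal.Tendsto.const_mul hφD (Or.inr (by simp : ‖r‖ₑ ≠ ⊤))

end Sobolev

/-! ### Simplicial meshes, given by the vertex sets of their elements -/

section Mesh

variable {d : ℕ}

/-- The (closed) element with vertex set `K`. -/
def element (K : Finset (EuclideanSpace ℝ (Fin d))) : Set (EuclideanSpace ℝ (Fin d)) :=
  convexHull ℝ (K : Set (EuclideanSpace ℝ (Fin d)))

/-- The distance from the vertex `p` of `K` to (the hyperplane of) the opposite facet. -/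
noncomputable def height (K : Finset (EuclideanSpace ℝ (Fin d))) (p : EuclideanSpace ℝ (Fin d)) :
    ℝ :=
  Metric.infDist p (affineSpan ℝ ((K : Set (EuclideanSpace ℝ (Fin d))) \ {p}))

/-- The minimum height `a_K` of the element `K`. -/
noncomputable def minHeight (K : Finset (EuclideanSpace ℝ (Fin d))) : ℝ :=
  ⨅ p : K, height K p

/-- The diameter `h_K` of the element `K`: the length of the longest edge. -/
noncomputable def diameter (K : Finset (EuclideanSpace ℝ (Fin d))) : ℝ :=
  Metric.diam (K : Set (EuclideanSpace ℝ (Fin d)))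

/-- The largest aspect ratio `max_K h_K / a_K` of the mesh. -/
noncomputable def maxAspect (T : Finset (Finset (EuclideanSpace ℝ (Fin d)))) : ℝ :=
  ⨆ K : T, diameter K.1 / minHeight K.1

/-- `T` is a simplicial mesh of the domain `Ω`: each element has `d + 1` vertices, the elements
cover the closure of `Ω`, two elements meet exactly in the hull of their common vertices, and the
boundary of `Ω` is a union of facets of elements. (Nondegeneracy of the elements is expressed
separately, by `0 < minHeight K`.) -/
structure IsSimplicialMesh (Ω : Set (EuclideanSpace ℝ (Fin d)))
    (T : Finset (Finset (EuclideanSpace ℝ (Fin d)))) : Prop where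
  card_eq : ∀ K ∈ T, K.card = d + 1
  cover : ⋃ K ∈ T, element K = closure Ω
  conforming : ∀ K ∈ T, ∀ L ∈ T, element K ∩ element L =
    convexHull ℝ ((K : Set (EuclideanSpace ℝ (Fin d))) ∩ L)
  boundary : ∃ B : Set (Set (EuclideanSpace ℝ (Fin d))),
    (∀ S ∈ B, ∃ K ∈ T, ∃ p ∈ K, S = (K : Set (EuclideanSpace ℝ (Fin d))) \ {p}) ∧
      frontier Ω = ⋃ S ∈ B, convexHull ℝ S

/-- The position at time `t` of the vertex that starts at `p` with nodal velocity `X p`. -/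
noncomputable def moveVertex (X : EuclideanSpace ℝ (Fin d) → EuclideanSpace ℝ (Fin d)) (t : ℝ)
    (p : EuclideanSpace ℝ (Fin d)) : EuclideanSpace ℝ (Fin d) :=
  p + t • X p

open scoped Classical in
/-- The mesh at time `t`: the vertices are moved, the connectivity is kept. -/
noncomputable def deformedMesh (T : Finset (Finset (EuclideanSpace ℝ (Fin d))))
    (X : EuclideanSpace ℝ (Fin d) → EuclideanSpace ℝ (Fin d)) (t : ℝ) :
    Finset (Finset (EuclideanSpace ℝ (Fin d))) :=
  T.image fun K => K.image (moveVertex X t)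

/-- `w` is the function `v` on the mesh `T` carried over to the mesh at time `t`: on each element
`K` one has `w (F x) = v x`, where `F` is the affine map that sends the vertices of `K` to their
positions at time `t`. -/
def IsTransported (T : Finset (Finset (EuclideanSpace ℝ (Fin d))))
    (X : EuclideanSpace ℝ (Fin d) → EuclideanSpace ℝ (Fin d)) (t : ℝ)
    (v w : EuclideanSpace ℝ (Fin d) → ℝ) : Prop :=
  ∀ K ∈ T, ∀ F : EuclideanSpace ℝ (Fin d) →ᵃ[ℝ] EuclideanSpace ℝ (Fin d),
    (∀ p ∈ K, F p = moveVertex X t p) → ∀ x ∈ element K, w (F x) = v x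

/-- `v` agrees on `S` with a polynomial of total degree at most `r`. -/
def IsPolyOn (r : ℕ) (S : Set (EuclideanSpace ℝ (Fin d))) (v : EuclideanSpace ℝ (Fin d) → ℝ) :
    Prop :=
  ∃ P : MvPolynomial (Fin d) ℝ, P.totalDegree ≤ r ∧ ∀ x ∈ S, v x = MvPolynomial.eval (⇑x) P

/-- The finite element space of degree `r`: functions in `H_0^1(Ω) ∩ C(closure Ω)` that are
polynomials of degree at most `r` on each element. A function on `closure Ω` is represented by its
extension by `0`. -/
noncomputable def feSpace (Ω : Set (EuclideanSpace ℝ (Fin d)))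
    (T : Finset (Finset (EuclideanSpace ℝ (Fin d)))) (r : ℕ) :
    Submodule ℝ (EuclideanSpace ℝ (Fin d) → ℝ) where
  carrier := {v | MemH10 Ω v ∧ ContinuousOn v (closure Ω) ∧ (∀ x ∉ closure Ω, v x = 0) ∧
    ∀ K ∈ T, IsPolyOn r (element K) v}
  zero_mem' := ⟨MemH10.zero Ω, continuousOn_const, fun _ _ => rfl,
    fun _ _ => ⟨0, by simp, fun _ _ => by simp⟩⟩
  add_mem' := by
    rintro u v ⟨hu, huc, hu0, hup⟩ ⟨hv, hvc, hv0, hvp⟩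
    refine ⟨hu.add hv, huc.add hvc, fun x hx => by simp [hu0 x hx, hv0 x hx], fun K hK => ?_⟩
    obtain ⟨P, hP, hPu⟩ := hup K hK
    obtain ⟨Q, hQ, hQv⟩ := hvp K hK
    exact ⟨P + Q, (MvPolynomial.totalDegree_add P Q).trans (max_le hP hQ),
      fun x hx => by simp [hPu x hx, hQv x hx]⟩
  smul_mem' := by
    rintro s v ⟨hv, hvc, hv0, hvp⟩
    refine ⟨hv.smul s, hvc.const_smul s, fun x hx => by simp [hv0 x hx], fun K hK => ?_⟩
    obtain ⟨Q, hQ, hQv⟩ := hvp K hK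
    exact ⟨s • Q, (MvPolynomial.totalDegree_smul_le s Q).trans hQ,
      fun x hx => by simp [hQv x hx, MvPolynomial.smul_eval]⟩

/-- `u` is the finite element solution on the mesh `T` of
`-∇·(a ∇u) + b·∇u + c u = f` in `Ω`, `u = 0` on the boundary. -/
def IsFESolution (Ω : Set (EuclideanSpace ℝ (Fin d)))
    (T : Finset (Finset (EuclideanSpace ℝ (Fin d)))) (r : ℕ)
    (a : EuclideanSpace ℝ (Fin d) → ℝ)
    (b : EuclideanSpace ℝ (Fin d) → EuclideanSpace ℝ (Fin d))
    (c f u : EuclideanSpace ℝ (Fin d) → ℝ) : Prop :=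
  u ∈ feSpace Ω T r ∧ ∀ ψ ∈ feSpace Ω T r,
    ∫ x in Ω, (a x * inner ℝ (weakGrad Ω u x) (weakGrad Ω ψ x)
        + inner ℝ (b x) (weakGrad Ω u x) * ψ x + c x * u x * ψ x)
      = ∫ x in Ω, f x * ψ x

end Mesh

end MeshSensitivity

/-! Let `Y` be the continuous piecewise affine interpolant of the nodal velocities, extended by zero
outside `Ω`. On an element `K` the nodal values of `X` differ by at most `‖∇X‖ h_K`, and a
barycentric coordinate has slope at most `1 / a_K`. Hence the gradient of `Y` and its divergence are
both bounded by `m = d ‖∇X‖ max h_K / a_K`, while `‖Y‖ ≤ ‖X‖` by convexity. For `t m < 1` the map `x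
↦ x + t Y x` is a bi-Lipschitz bijection that preserves `Ω` and carries each element to its position
at time `t`; write `Ψ` for its inverse. The solution at time `t` is then `u_t ∘ Ψ` with `u_t = ∑
u_i(t) ψ_i`, and `v ∘ Ψ` is an admissible test function at time `t` whenever `v` is one at time `0`.

Insert `v ∘ Ψ` into the equation at time `t` and compare with the forms on the initial mesh.
Diffusion and transport are pulled back by the change of variables. To first order in `t`, the
diffusion term changes by the increment of `a` along the flow, one Jacobian factor and two gradient
factors, hence by `‖∇a‖ ‖Y‖ + 3 m ‖a‖`; the transport term has one Jacobian and one gradient factor,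
hence `‖∇b‖ ‖Y‖ + 2 m ‖b‖`. Reaction and load are compared directly on `Ω`, by the increment bound
`‖v ∘ Ψ - v‖ ≤ t ‖Y‖_∞ (1 + o(1)) ‖∇v‖`, so that no derivative of `c` or `f` enters. Subtracting the
equation at time `0`, dividing by `t` and letting `t → 0` bounds the bilinear form at `(u̇, v)`.
With `v = u̇`, coercivity bounds `a₀ ‖∇u̇‖²` from above, and Poincaré together with `‖∇u_0‖ ≤ C_Ω
‖f‖ / a₀` gives the theorem.

The analysis rests on four facts: composition with a bi-Lipschitz map that preserves `Ω` preserves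
`H_0^1(Ω)` (`HasH10Deriv.comp`); the `L²` increment bound (`HasH10Deriv.lpNorm_displacement_le`);
functions with bounded weak derivative are Lipschitz along segments inside `Ω`
(`HasWeakFDeriv.exists_lipschitz_on_segments`); and the change of variables along the flow
(`IsFlowInverse.integral_eq`). The geometry is collected in
`IsSimplicialMesh.exists_isMeshVelocity`, and the limit is taken in
`IsMeshVelocity.energyForm_material_le`. -/

namespace MeshSensitivity

/-! ### Inequalities and limits in `L²` -/

section LpTools

variable {α : Type*} {mα : MeasurableSpace α} {μ : Measure α}
  {E F : Type*} [NormedAddCommGroup E] [NormedAddCommGroup F]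

/-- Cauchy–Schwarz. It is phrased with norms so that the factors may take values in different
spaces, such as a derivative and a scalar function; the product also serves as dominating function
later. -/
theorem integral_norm_mul_norm_le_lpNorm {f : α → E} {g : α → F} (hf : MemLp f 2 μ)
    (hg : MemLp g 2 μ) :
    Integrable (fun x => ‖f x‖ * ‖g x‖) μ ∧
      ∫ x, ‖f x‖ * ‖g x‖ ∂μ ≤ lpNorm f 2 μ * lpNorm g 2 μ := by
  refine ⟨MemLp.integrable_mul (p := 2) (q := 2) hf.norm hg.norm, ?_⟩
  have h := integral_mul_le_Lp_mul_Lq_of_nonneg (μ := μ) (p := 2) (q := 2)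
    (by constructor <;> norm_num) (f := fun x => ‖f x‖) (g := fun x => ‖g x‖)
    (ae_of_all _ fun _ => norm_nonneg _) (ae_of_all _ fun _ => norm_nonneg _)
    (by simpa using hf.norm) (by simpa using hg.norm)
  refine h.trans_eq ?_
  rw [lpNorm_eq_integral_norm_rpow_toReal (by simp) (by simp) hf.1,
    lpNorm_eq_integral_norm_rpow_toReal (by simp) (by simp) hg.1]
  simp

theorem lpNorm_two_sq {f : α → E} (hf : MemLp f 2 μ) :
    lpNorm f 2 μ ^ 2 = ∫ x, ‖f x‖ ^ 2 ∂μ := by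
  rw [lpNorm_eq_integral_norm_rpow_toReal (by simp) (by simp) hf.1]
  have h0 : 0 ≤ ∫ x, ‖f x‖ ^ 2 ∂μ := integral_nonneg fun _ => by positivity
  simp only [ENNReal.toReal_ofNat, Real.rpow_ofNat]
  rw [← Real.rpow_natCast, ← Real.rpow_mul h0]
  norm_num

theorem lpNorm_congr_ae' {f g : α → E} {p : ℝ≥0∞} (h : f =ᵐ[μ] g) :
    lpNorm f p μ = lpNorm g p μ := by
  by_cases hf : AEStronglyMeasurable f μ
  · rw [← toReal_eLpNorm hf, ← toReal_eLpNorm (hf.congr h), eLpNorm_congr_ae h]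
  · rw [lpNorm_of_not_aestronglyMeasurable hf, lpNorm_of_not_aestronglyMeasurable fun hg =>
      hf (hg.congr h.symm)]

theorem lpNorm_congr_norm {f : α → E} {g : α → F} {p : ℝ≥0∞} (hf : AEStronglyMeasurable f μ)
    (hg : AEStronglyMeasurable g μ) (h : ∀ᵐ x ∂μ, ‖f x‖ = ‖g x‖) :
    lpNorm f p μ = lpNorm g p μ := by
  rw [← toReal_eLpNorm hf, ← toReal_eLpNorm hg, eLpNorm_congr_norm_ae h]

theorem tendsto_lpNorm_zero {f : ℕ → α → E} {p : ℝ≥0∞}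
    (h : Tendsto (fun n => eLpNorm (f n) p μ) atTop (𝓝 0)) :
    Tendsto (fun n => lpNorm (f n) p μ) atTop (𝓝 0) := by
  have h1 : Tendsto (fun n => (eLpNorm (f n) p μ).toReal) atTop (𝓝 0) := by
    simpa [Function.comp_def] using (ENNReal.tendsto_toReal ENNReal.zero_ne_top).comp h
  refine squeeze_zero (fun _ => lpNorm_nonneg) (fun n => ?_) h1
  unfold lpNorm
  split_ifs
  · exact le_rfl
  · positivity

theorem tendsto_lpNorm_of_tendsto_eLpNorm_sub {f : ℕ → α → E} {g : α → E} {p : ℝ≥0∞} (hp : 1 ≤ p)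
    (hf : ∀ n, MemLp (f n) p μ) (hg : MemLp g p μ)
    (h : Tendsto (fun n => eLpNorm (f n - g) p μ) atTop (𝓝 0)) :
    Tendsto (fun n => lpNorm (f n) p μ) atTop (𝓝 (lpNorm g p μ)) := by
  have h0 := tendsto_lpNorm_zero h
  rw [tendsto_iff_dist_tendsto_zero]
  refine squeeze_zero (fun _ => dist_nonneg) (fun n => ?_) h0
  rw [Real.dist_eq, abs_le]
  constructor
  · have := lpNorm_le_lpNorm_add_lpNorm_sub (f := g) (hf n) hp
    linarith
  · have := lpNorm_le_lpNorm_add_lpNorm_sub' (f := f n) hg hp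
    linarith

/-- The `L²` pairing is continuous. -/
theorem tendsto_integral_mul_of_tendsto_eLpNorm {f g : ℕ → α → ℝ} {f' g' : α → ℝ}
    (hf : ∀ n, MemLp (f n) 2 μ) (hg : ∀ n, MemLp (g n) 2 μ) (hf' : MemLp f' 2 μ)
    (hg' : MemLp g' 2 μ) (tf : Tendsto (fun n => eLpNorm (f n - f') 2 μ) atTop (𝓝 0))
    (tg : Tendsto (fun n => eLpNorm (g n - g') 2 μ) atTop (𝓝 0)) :
    Tendsto (fun n => ∫ x, f n x * g n x ∂μ) atTop (𝓝 (∫ x, f' x * g' x ∂μ)) := by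
  have key : ∀ n, |∫ x, f n x * g n x ∂μ - ∫ x, f' x * g' x ∂μ| ≤
      lpNorm (f n - f') 2 μ * lpNorm (g n) 2 μ + lpNorm f' 2 μ * lpNorm (g n - g') 2 μ := by
    intro n
    have i1 := integral_norm_mul_norm_le_lpNorm ((hf n).sub hf') (hg n)
    have i2 := integral_norm_mul_norm_le_lpNorm hf' ((hg n).sub hg')
    have j1 : Integrable (fun x => f n x * g n x) μ := MemLp.integrable_mul (hf n) (hg n)
    have j2 : Integrable (fun x => f' x * g' x) μ := MemLp.integrable_mul hf' hg'
    rw [← integral_sub j1 j2, ← Real.norm_eq_abs]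
    refine (norm_integral_le_integral_norm _).trans ?_
    refine le_trans ?_ (add_le_add i1.2 i2.2)
    rw [← integral_add i1.1 i2.1]
    refine integral_mono (j1.sub j2).norm (i1.1.add i2.1) fun x => ?_
    have : f n x * g n x - f' x * g' x = (f n x - f' x) * g n x + f' x * (g n x - g' x) := by ring
    simp only [this]
    refine (norm_add_le _ _).trans ?_
    simp [norm_mul]
  rw [tendsto_iff_dist_tendsto_zero]
  refine squeeze_zero (fun _ => dist_nonneg) key ?_
  have t1 := (tendsto_lpNorm_zero tf).mul
    (tendsto_lpNorm_of_tendsto_eLpNorm_sub (by norm_num) hg hg' tg)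
  have t2 := (tendsto_lpNorm_zero tg).const_mul (lpNorm f' 2 μ)
  simpa using t1.add t2

/-- Vitali's theorem: on a finite measure space a uniformly bounded sequence is uniformly
integrable, since its truncation above `C + 1` vanishes almost everywhere. -/
theorem tendsto_eLpNorm_of_bounded [IsFiniteMeasure μ] {f : ℕ → α → E} {C : ℝ}
    (hm : ∀ n, AEStronglyMeasurable (f n) μ) (hb : ∀ n, ∀ᵐ x ∂μ, ‖f n x‖ ≤ C)
    (hlim : ∀ᵐ x ∂μ, Tendsto (fun n => f n x) atTop (𝓝 0)) :
    Tendsto (fun n => eLpNorm (f n) 2 μ) atTop (𝓝 0) := by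
  have h := tendsto_Lp_finite_of_tendsto_ae (p := 2) (μ := μ) (by norm_num) (by simp)
    (g := fun _ => 0) hm MemLp.zero' ?_ hlim
  · have e : ∀ n, (f n - fun _ => 0) = f n := fun n => by ext; simp
    simpa only [e] using h
  · refine unifIntegrable_of (by norm_num) (by simp) hm fun ε hε => ⟨(C + 1).toNNReal, fun n => ?_⟩
    have : {x | (C + 1).toNNReal ≤ ‖f n x‖₊}.indicator (f n) =ᵐ[μ] 0 := by
      filter_upwards [hb n] with x hx
      rw [indicator_of_notMem]
      · rfl
      · simp only [mem_ofPred_eq, not_le]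
        rw [← NNReal.coe_lt_coe]
        exact lt_of_lt_of_le (show ‖f n x‖ < C + 1 by linarith) (Real.le_coe_toNNReal _)
    rw [eLpNorm_congr_ae this]
    simp

end LpTools

/-! ### Weak derivatives in `H_0^1` -/

section Sobolev

variable {d : ℕ} {F : Type*} [NormedAddCommGroup F] [NormedSpace ℝ F]

local notation "𝔼[" d "]" => EuclideanSpace ℝ (Fin d)

variable {Ω : Set 𝔼[d]}

/-- `D` is the derivative of `v ∈ H_0^1(Ω)`: both are limits in `L²(Ω)` along the same sequence of
test functions. -/
structure HasH10Deriv (Ω : Set (EuclideanSpace ℝ (Fin d))) (v : EuclideanSpace ℝ (Fin d) → ℝ)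
    (D : EuclideanSpace ℝ (Fin d) → EuclideanSpace ℝ (Fin d) →L[ℝ] ℝ) : Prop where
  memLp : MemLp v 2 (volume.restrict Ω)
  memLp_deriv : MemLp D 2 (volume.restrict Ω)
  approx : ∃ φ : ℕ → EuclideanSpace ℝ (Fin d) → ℝ, (∀ n, IsTestFunction Ω (φ n)) ∧
    Tendsto (fun n => eLpNorm (φ n - v) 2 (volume.restrict Ω)) atTop (𝓝 0) ∧
    Tendsto (fun n => eLpNorm (fderiv ℝ (φ n) - D) 2 (volume.restrict Ω)) atTop (𝓝 0)

theorem IsTestFunction.memLp {φ : 𝔼[d] → ℝ} (hφ : IsTestFunction Ω φ) (p : ℝ≥0∞) :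
    MemLp φ p (volume.restrict Ω) :=
  (hφ.1.continuous.memLp_of_hasCompactSupport hφ.2.1).restrict Ω

theorem IsTestFunction.continuous_fderiv {φ : 𝔼[d] → ℝ} (hφ : IsTestFunction Ω φ) :
    Continuous (fderiv ℝ φ) := hφ.1.continuous_fderiv (by simp)

theorem IsTestFunction.memLp_fderiv {φ : 𝔼[d] → ℝ} (hφ : IsTestFunction Ω φ) (p : ℝ≥0∞) :
    MemLp (fderiv ℝ φ) p (volume.restrict Ω) :=
  (hφ.continuous_fderiv.memLp_of_hasCompactSupport (hφ.2.1.fderiv ℝ)).restrict Ω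

theorem eLpNorm_clm_apply_sub_le (D D' : 𝔼[d] → 𝔼[d] →L[ℝ] F) (w : 𝔼[d]) (μ : Measure 𝔼[d]) :
    eLpNorm ((fun x => D x w) - fun x => D' x w) 2 μ ≤ ‖w‖ₑ * eLpNorm (D - D') 2 μ := by
  have := eLpNorm_le_mul_eLpNorm_of_ae_le_mul (μ := μ) (c := ‖w‖)
    (f := (fun x => D x w) - fun x => D' x w) (g := D - D') (ae_of_all _ fun x => ?_) 2
  · simpa [ofReal_norm] using this
  · have := (D x - D' x).le_opNorm w
    simpa [mul_comm] using this

theorem tendsto_eLpNorm_clm_apply_sub {D : ℕ → 𝔼[d] → 𝔼[d] →L[ℝ] F} {D' : 𝔼[d] → 𝔼[d] →L[ℝ] F}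
    {μ : Measure 𝔼[d]} (w : 𝔼[d]) (h : Tendsto (fun n => eLpNorm (D n - D') 2 μ) atTop (𝓝 0)) :
    Tendsto (fun n => eLpNorm ((fun x => D n x w) - fun x => D' x w) 2 μ) atTop (𝓝 0) := by
  have := ENNReal.Tendsto.const_mul (a := ‖w‖ₑ) h (Or.inr (by simp))
  rw [mul_zero] at this
  exact tendsto_of_tendsto_of_tendsto_of_le_of_le tendsto_const_nhds this (fun _ => zero_le)
    fun n => eLpNorm_clm_apply_sub_le _ _ _ _

theorem _root_.MeasureTheory.MemLp.clm_apply_const {D : 𝔼[d] → 𝔼[d] →L[ℝ] F} {p : ℝ≥0∞} {μ : Measure 𝔼[d]} (hD : MemLp D p μ)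
    (w : 𝔼[d]) : MemLp (fun x => D x w) p μ := hD.continuousLinearMap_comp
    (ContinuousLinearMap.apply ℝ F w)

theorem setIntegral_eq_integral_of_tsupport {g : 𝔼[d] → F} (h : Function.support g ⊆ Ω) :
    ∫ x in Ω, g x = ∫ x, g x :=
  setIntegral_eq_integral_of_forall_compl_eq_zero fun x hx => by
    by_contra h0
    exact hx (h h0)

theorem IsTestFunction.integral_fderiv_mul {φ η : 𝔼[d] → ℝ} (hφ : IsTestFunction Ω φ)
    (hη : IsTestFunction Ω η) (w : 𝔼[d]) :
    ∫ x in Ω, fderiv ℝ η x w * φ x = -∫ x in Ω, η x * fderiv ℝ φ x w := by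
  rw [setIntegral_eq_integral_of_tsupport, setIntegral_eq_integral_of_tsupport]
  · have hcη : Continuous fun x => fderiv ℝ η x w := hη.continuous_fderiv.clm_apply continuous_const
    have hcφ : Continuous fun x => fderiv ℝ φ x w := hφ.continuous_fderiv.clm_apply continuous_const
    rw [integral_mul_fderiv_eq_neg_fderiv_mul_of_integrable, neg_neg]
    · exact (hcη.mul hφ.1.continuous).integrable_of_hasCompactSupport hφ.2.1.mul_left
    · exact (hη.1.continuous.mul hcφ).integrable_of_hasCompactSupport hη.2.1.mul_right
    · exact (hη.1.continuous.mul hφ.1.continuous).integrable_of_hasCompactSupport hη.2.1.mul_right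
    · exact fun x _ => hη.1.differentiable (by simp) x
    · exact fun x _ => hφ.1.differentiable (by simp) x
  · intro x hx
    exact hη.2.2 (subset_tsupport _ fun h => hx (by simp [h]))
  · intro x hx
    exact hφ.2.2 (subset_tsupport _ fun h => hx (by simp [h]))

/-- Classical integration by parts for the approximating test functions passes to the limit in the
`L²` pairing. Thus `L²` approximation alone suffices for membership in `H_0^1`. -/
theorem HasH10Deriv.hasWeakFDeriv {v : 𝔼[d] → ℝ} {D : 𝔼[d] → 𝔼[d] →L[ℝ] ℝ}
    (h : HasH10Deriv Ω v D) : HasWeakFDeriv Ω v D := by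
  obtain ⟨φ, hφ, tv, tD⟩ := h.approx
  refine ⟨locallyIntegrableOn_of_locallyIntegrable_restrict (h.memLp.locallyIntegrable (by norm_num)),
    locallyIntegrableOn_of_locallyIntegrable_restrict (h.memLp_deriv.locallyIntegrable (by norm_num)),
    fun η hη w => ?_⟩
  have hη' : MemLp (fun x => fderiv ℝ η x w) 2 (volume.restrict Ω) :=
    (hη.memLp_fderiv 2).clm_apply_const w
  have t1 := tendsto_integral_mul_of_tendsto_eLpNorm (μ := volume.restrict Ω)
    (fun _ : ℕ => hη') (fun n => (hφ n).memLp 2) hη' h.memLp (by simp) tv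
  have t2 := (tendsto_integral_mul_of_tendsto_eLpNorm (μ := volume.restrict Ω)
    (fun _ : ℕ => hη.memLp 2) (fun n => ((hφ n).memLp_fderiv 2).clm_apply_const w) (hη.memLp 2)
    (h.memLp_deriv.clm_apply_const w) (by simp) (tendsto_eLpNorm_clm_apply_sub w tD)).neg
  simp only [fun n => (hφ n).integral_fderiv_mul hη w] at t1
  exact tendsto_nhds_unique t1 t2

theorem HasH10Deriv.memH10 {v : 𝔼[d] → ℝ} {D : 𝔼[d] → 𝔼[d] →L[ℝ] ℝ} (h : HasH10Deriv Ω v D) :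
    MemH10 Ω v := ⟨h.memLp, D, h.hasWeakFDeriv, h.memLp_deriv, h.approx⟩

/-- The fundamental lemma of the calculus of variations applies to each direction separately;
finitely many basis directions keep the exceptional set null. -/
theorem HasWeakFDeriv.ae_eq [CompleteSpace F] (hΩ : IsOpen Ω) {g : 𝔼[d] → F} {D₁ D₂ : 𝔼[d] → 𝔼[d] →L[ℝ] F}
    (h₁ : HasWeakFDeriv Ω g D₁) (h₂ : HasWeakFDeriv Ω g D₂) : D₁ =ᵐ[volume.restrict Ω] D₂ := by
  have hw : ∀ w : 𝔼[d], ∀ᵐ x, x ∈ Ω → (D₁ x w - D₂ x w) = 0 := by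
    intro w
    refine hΩ.ae_eq_zero_of_integral_contDiff_smul_eq_zero ?_ ?_
    · have := h₁.2.1.sub h₂.2.1
      rw [locallyIntegrableOn_iff hΩ.isLocallyClosed] at this ⊢
      intro k hk hkc
      exact (this k hk hkc).apply_continuousLinearMap w
    · intro φ h1 h2 h3
      have hφ : IsTestFunction Ω φ := ⟨h1, h2, h3⟩
      have e := (h₁.2.2 φ hφ w).symm.trans (h₂.2.2 φ hφ w)
      rw [← setIntegral_eq_integral_of_tsupport (Ω := Ω)]
      · simp only [smul_sub]
        rw [integral_sub (h₁.integrable_right hφ w) (h₂.integrable_right hφ w)]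
        rw [neg_inj] at e
        rw [e, sub_self]
      · intro x hx
        exact h3 (subset_tsupport _ fun h => hx (by simp [h]))
  have hall : ∀ᵐ x, ∀ i : Fin d, x ∈ Ω →
      D₁ x (EuclideanSpace.basisFun (Fin d) ℝ i) - D₂ x (EuclideanSpace.basisFun (Fin d) ℝ i) = 0 :=
    ae_all_iff.2 fun i => hw _
  rw [EventuallyEq, ae_restrict_iff' hΩ.measurableSet]
  filter_upwards [hall] with x hx hxΩ
  have : (D₁ x : 𝔼[d] →ₗ[ℝ] F) = D₂ x :=
    (EuclideanSpace.basisFun (Fin d) ℝ).toBasis.ext fun i => by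
      simpa [sub_eq_zero] using hx i hxΩ
  exact ContinuousLinearMap.coe_injective this

theorem HasWeakFDeriv.weakFDeriv {g : 𝔼[d] → F} {D : 𝔼[d] → 𝔼[d] →L[ℝ] F}
    (h : HasWeakFDeriv Ω g D) : HasWeakFDeriv Ω g (weakFDeriv Ω g) := by
  have hex : ∃ Dg, HasWeakFDeriv Ω g Dg := ⟨D, h⟩
  rw [MeshSensitivity.weakFDeriv, dif_pos hex]
  exact hex.choose_spec

theorem HasWeakFDeriv.weakFDeriv_ae_eq [CompleteSpace F] (hΩ : IsOpen Ω) {g : 𝔼[d] → F}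
    {D : 𝔼[d] → 𝔼[d] →L[ℝ] F} (h : HasWeakFDeriv Ω g D) :
    MeshSensitivity.weakFDeriv Ω g =ᵐ[volume.restrict Ω] D := h.weakFDeriv.ae_eq hΩ h

theorem HasH10Deriv.congr_deriv {v : 𝔼[d] → ℝ} {D D' : 𝔼[d] → 𝔼[d] →L[ℝ] ℝ} (h : HasH10Deriv Ω v D)
    (e : D =ᵐ[volume.restrict Ω] D') : HasH10Deriv Ω v D' := by
  obtain ⟨φ, hφ, tv, tD⟩ := h.approx
  refine ⟨h.memLp, (memLp_congr_ae e).1 h.memLp_deriv, φ, hφ, tv, tD.congr fun n => ?_⟩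
  refine eLpNorm_congr_ae ?_
  filter_upwards [e] with x hx
  simp [hx]

theorem MemH10.hasH10Deriv (hΩ : IsOpen Ω) {v : 𝔼[d] → ℝ} (hv : MemH10 Ω v) :
    HasH10Deriv Ω v (weakFDeriv Ω v) := by
  obtain ⟨h2, D, hD, hD2, happ⟩ := hv
  exact HasH10Deriv.congr_deriv ⟨h2, hD2, happ⟩ (hD.weakFDeriv_ae_eq hΩ).symm

/-- The graph of the derivative on `H_0^1(Ω)` is closed. -/
theorem HasH10Deriv.of_tendsto {v : ℕ → 𝔼[d] → ℝ} {D : ℕ → 𝔼[d] → 𝔼[d] →L[ℝ] ℝ} {v' : 𝔼[d] → ℝ}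
    {D' : 𝔼[d] → 𝔼[d] →L[ℝ] ℝ} (h : ∀ n, HasH10Deriv Ω (v n) (D n))
    (hv' : MemLp v' 2 (volume.restrict Ω)) (hD' : MemLp D' 2 (volume.restrict Ω))
    (tv : Tendsto (fun n => eLpNorm (v n - v') 2 (volume.restrict Ω)) atTop (𝓝 0))
    (tD : Tendsto (fun n => eLpNorm (D n - D') 2 (volume.restrict Ω)) atTop (𝓝 0)) :
    HasH10Deriv Ω v' D' := by
  -- Diagonal choice: one test function within `1 / (n + 1)` of both `v n` and `D n`.
  have hex : ∀ n : ℕ, ∃ φ, IsTestFunction Ω φ ∧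
      eLpNorm (φ - v n) 2 (volume.restrict Ω) < ((n : ℝ≥0∞) + 1)⁻¹ ∧
      eLpNorm (fderiv ℝ φ - D n) 2 (volume.restrict Ω) < ((n : ℝ≥0∞) + 1)⁻¹ := by
    intro n
    obtain ⟨φ, hφ, tv, tD⟩ := (h n).approx
    have hpos : (0 : ℝ≥0∞) < ((n : ℝ≥0∞) + 1)⁻¹ := by simp
    obtain ⟨k, hk1, hk2⟩ := ((tv.eventually_lt_const hpos).and (tD.eventually_lt_const hpos)).exists
    exact ⟨φ k, hφ k, hk1, hk2⟩
  choose φ hφ h1 h2 using hex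
  have hlim : Tendsto (fun n : ℕ => ((n : ℝ≥0∞) + 1)⁻¹) atTop (𝓝 0) := by
    have := ENNReal.tendsto_inv_nat_nhds_zero.comp (tendsto_add_atTop_nat 1)
    simpa [Function.comp_def] using this
  refine ⟨hv', hD', φ, hφ, ?_, ?_⟩
  · have t0 := hlim.add tv
    rw [add_zero] at t0
    refine tendsto_of_tendsto_of_tendsto_of_le_of_le tendsto_const_nhds t0 (fun _ => zero_le)
      fun n => ?_
    have e : φ n - v' = (φ n - v n) + (v n - v') := by abel
    simp only [e]
    refine (eLpNorm_add_le (((hφ n).memLp 2).sub (h n).memLp).1 ((h n).memLp.sub hv').1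
      (by norm_num)).trans ?_
    gcongr
    exact (h1 n).le
  · have t0 := hlim.add tD
    rw [add_zero] at t0
    refine tendsto_of_tendsto_of_tendsto_of_le_of_le tendsto_const_nhds t0 (fun _ => zero_le)
      fun n => ?_
    have e : fderiv ℝ (φ n) - D' = (fderiv ℝ (φ n) - D n) + (D n - D') := by abel
    simp only [e]
    refine (eLpNorm_add_le (((hφ n).memLp_fderiv 2).sub (h n).memLp_deriv).1
      ((h n).memLp_deriv.sub hD').1 (by norm_num)).trans ?_
    gcongr
    exact (h2 n).le

theorem HasH10Deriv.zero : HasH10Deriv Ω (0 : 𝔼[d] → ℝ) 0 := by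
  refine ⟨memLp_zero_aux, memLp_zero_aux, fun _ => 0, fun _ => ?_, ?_, ?_⟩
  · exact ⟨contDiff_const, HasCompactSupport.zero, by simp [tsupport]⟩
  · simp
  · simp [eLpNorm_zero_aux]

theorem HasH10Deriv.add {u v : 𝔼[d] → ℝ} {Du Dv : 𝔼[d] → 𝔼[d] →L[ℝ] ℝ} (hu : HasH10Deriv Ω u Du)
    (hv : HasH10Deriv Ω v Dv) : HasH10Deriv Ω (u + v) (Du + Dv) := by
  obtain ⟨φ, hφ, hφu, hφD⟩ := hu.approx
  obtain ⟨ψ, hψ, hψv, hψD⟩ := hv.approx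
  refine ⟨memLp_add_aux hu.memLp hv.memLp, memLp_add_aux hu.memLp_deriv hv.memLp_deriv, fun n => φ n + ψ n,
    fun n => (hφ n).add (hψ n), ?_, ?_⟩
  · exact tendsto_eLpNorm_add_aux (by norm_num) (fun n => ((hφ n).memLp 2).1)
      (fun n => ((hψ n).memLp 2).1) hu.memLp.1 hv.memLp.1 hφu hψv
  · have hf : ∀ n, fderiv ℝ (φ n + ψ n) = fderiv ℝ (φ n) + fderiv ℝ (ψ n) := by
      intro n
      ext1 x
      exact fderiv_add ((hφ n).1.differentiable (by simp) x) ((hψ n).1.differentiable (by simp) x)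
    simp only [hf]
    exact tendsto_eLpNorm_add_aux (by norm_num) (fun n => ((hφ n).memLp_fderiv 2).1)
      (fun n => ((hψ n).memLp_fderiv 2).1) hu.memLp_deriv.1 hv.memLp_deriv.1 hφD hψD

theorem HasH10Deriv.smul {u : 𝔼[d] → ℝ} {Du : 𝔼[d] → 𝔼[d] →L[ℝ] ℝ} (r : ℝ)
    (hu : HasH10Deriv Ω u Du) : HasH10Deriv Ω (r • u) (r • Du) := by
  obtain ⟨φ, hφ, hφu, hφD⟩ := hu.approx
  refine ⟨hu.memLp.const_smul r, hu.memLp_deriv.const_smul r, fun n => r • φ n,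
    fun n => (hφ n).smul r, ?_, ?_⟩
  · simp only [← smul_sub, eLpNorm_const_smul]
    simpa using ENNReal.Tendsto.const_mul hφu (Or.inr (by simp : ‖r‖ₑ ≠ ⊤))
  · have hf : ∀ n, fderiv ℝ (r • φ n) = r • fderiv ℝ (φ n) := by
      intro n
      ext1 x
      exact fderiv_const_smul ((hφ n).1.differentiable (by simp) x) r
    simp only [hf, ← smul_sub, eLpNorm_const_smul]
    simpa using ENNReal.Tendsto.const_mul hφD (Or.inr (by simp : ‖r‖ₑ ≠ ⊤))

theorem HasH10Deriv.sum {ι : Type*} (s : Finset ι) {u : ι → 𝔼[d] → ℝ} {Du : ι → 𝔼[d] → 𝔼[d] →L[ℝ] ℝ}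
    (h : ∀ i ∈ s, HasH10Deriv Ω (u i) (Du i)) :
    HasH10Deriv Ω (∑ i ∈ s, u i) (∑ i ∈ s, Du i) := by
  classical
  induction s using Finset.induction_on with
  | empty => simpa using HasH10Deriv.zero
  | insert i s hi ih =>
    rw [Finset.sum_insert hi, Finset.sum_insert hi]
    exact (h i (Finset.mem_insert_self i s)).add
      (ih fun j hj => h j (Finset.mem_insert_of_mem hj))

end Sobolev

/-! ### Mollification and compactly supported Lipschitz functions -/

section Mollify

variable {d : ℕ} {F : Type*} [NormedAddCommGroup F] [NormedSpace ℝ F]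

local notation "𝔼[" d "]" => EuclideanSpace ℝ (Fin d)

variable {Ω : Set 𝔼[d]}

/-- A sequence of smooth bumps at the origin with radii shrinking to zero, bounded by `δ`. -/
theorem exists_contDiffBump_seq {δ : ℝ} (hδ : 0 < δ) :
    ∃ β : ℕ → ContDiffBump (0 : 𝔼[d]), Tendsto (fun n => (β n).rOut) atTop (𝓝 0) ∧
      (∀ n, (β n).rOut ≤ 2 * (β n).rIn) ∧ ∀ n, (β n).rOut ≤ δ := by
  refine ⟨fun n => ⟨δ / (2 * (n + 1)), δ / (n + 1), by positivity, ?_⟩, ?_, fun n => ?_, fun n => ?_⟩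
  · have : (0 : ℝ) < n + 1 := by positivity
    rw [div_lt_div_iff₀ (by positivity) this]
    nlinarith
  · have := (tendsto_one_div_add_atTop_nhds_zero_nat (𝕜 := ℝ)).const_mul δ
    simpa [div_eq_mul_inv] using this
  · have : (0 : ℝ) < n + 1 := by positivity
    apply le_of_eq
    show δ / (n + 1) = 2 * (δ / (2 * (n + 1)))
    field_simp
  · exact div_le_self hδ.le (by simp)

/-- The mollification of `g` with the bump `β`. -/
noncomputable def mollify (β : ContDiffBump (0 : EuclideanSpace ℝ (Fin d)))
    (g : EuclideanSpace ℝ (Fin d) → F) : EuclideanSpace ℝ (Fin d) → F :=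
  convolution (β.normed volume) g (ContinuousLinearMap.lsmul ℝ ℝ) volume

theorem mollify_apply (β : ContDiffBump (0 : 𝔼[d])) (g : 𝔼[d] → F) (x : 𝔼[d]) :
    mollify β g x = ∫ z, β.normed volume z • g (x - z) := rfl

theorem contDiff_mollify [CompleteSpace F] (β : ContDiffBump (0 : 𝔼[d])) {g : 𝔼[d] → F}
    (hg : LocallyIntegrable g volume) : ContDiff ℝ ∞ (mollify β g) :=
  β.hasCompactSupport_normed.contDiff_convolution_left _ β.contDiff_normed hg

theorem norm_mollify_le (β : ContDiffBump (0 : 𝔼[d])) {g : 𝔼[d] → F} {C : ℝ} {x : 𝔼[d]}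
    (hg : ∀ᵐ z, ‖z‖ < β.rOut → ‖g (x - z)‖ ≤ C) : ‖mollify β g x‖ ≤ C := by
  rw [mollify_apply]
  have hi : Integrable (fun z => β.normed volume z * C) volume := β.integrable_normed.mul_const C
  refine (norm_integral_le_of_norm_le hi ?_).trans_eq ?_
  · filter_upwards [hg] with z hz
    rw [norm_smul, Real.norm_of_nonneg (β.nonneg_normed z)]
    by_cases h : ‖z‖ < β.rOut
    · exact mul_le_mul_of_nonneg_left (hz h) (β.nonneg_normed z)
    · have : β.normed volume z = 0 := by
        rw [← Function.notMem_support, β.support_normed_eq]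
        simpa using h
      simp [this]
  · rw [integral_mul_const, β.integral_normed, one_mul]

theorem ae_comp_sub_left {p : 𝔼[d] → Prop} (h : ∀ᵐ y, p y) (x : 𝔼[d]) : ∀ᵐ z, p (x - z) :=
  (volume.measurePreserving_sub_left x).quasiMeasurePreserving.ae h

/-- Differentiation under the integral with the derivative falling on `v`: Rademacher's theorem
supplies it almost everywhere, and the Lipschitz constant supplies the dominating function. -/
theorem hasFDerivAt_mollify_of_lipschitz {C : NNReal} (β : ContDiffBump (0 : 𝔼[d])) {v : 𝔼[d] → ℝ}
    (hv : LipschitzWith C v) (x : 𝔼[d]) :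
    HasFDerivAt (mollify β v) (mollify β (fderiv ℝ v) x) x := by
  have hβ := β.continuous_normed (μ := volume)
  have := (hasFDerivAt_integral_of_dominated_loc_of_lip (𝕜 := ℝ) (μ := (volume : Measure 𝔼[d]))
    (F := fun y z => β.normed volume z • v (y - z)) (x₀ := x) (s := univ)
    (F' := fun z => β.normed volume z • fderiv ℝ v (x - z))
    (bound := fun z => β.normed volume z * C) univ_mem ?_ ?_ ?_ ?_ ?_ ?_).2
  · exact this
  · refine Eventually.of_forall fun y => Continuous.aestronglyMeasurable ?_
    exact hβ.smul (hv.continuous.comp (continuous_const.sub continuous_id))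
  · refine Continuous.integrable_of_hasCompactSupport ?_ ?_
    · exact hβ.smul (hv.continuous.comp (continuous_const.sub continuous_id))
    · exact β.hasCompactSupport_normed.smul_right
  · refine hβ.aestronglyMeasurable.smul ?_
    have : Measurable fun z => fderiv ℝ v (x - z) :=
      (measurable_fderiv ℝ v).comp (measurable_const.sub measurable_id)
    exact this.aestronglyMeasurable
  · refine ae_of_all _ fun z => ?_
    rw [lipschitzOnWith_univ]
    refine LipschitzWith.of_dist_le_mul fun y y' => ?_
    rw [dist_eq_norm, ← smul_sub, norm_smul, Real.norm_of_nonneg (β.nonneg_normed z)]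
    rw [Real.coe_nnabs, abs_of_nonneg (mul_nonneg (β.nonneg_normed z) C.coe_nonneg), mul_assoc]
    refine mul_le_mul_of_nonneg_left ?_ (β.nonneg_normed z)
    have := hv.dist_le_mul (y - z) (y' - z)
    rwa [dist_sub_right, dist_eq_norm] at this
  · exact β.integrable_normed.mul_const _
  · filter_upwards [ae_comp_sub_left hv.ae_differentiableAt x] with z hz
    have h1 : HasFDerivAt (fun y => v (y - z)) (fderiv ℝ v (x - z)) x :=
      hz.hasFDerivAt.comp x ((hasFDerivAt_id x).sub_const z)
    exact h1.const_smul (β.normed volume z)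

theorem tsupport_mollify_subset (β : ContDiffBump (0 : 𝔼[d])) (g : 𝔼[d] → F) :
    tsupport (mollify β g) ⊆ Metric.cthickening β.rOut (tsupport g) := by
  refine closure_minimal ?_ Metric.isClosed_cthickening
  intro x hx
  obtain ⟨y, hy, z, hz, rfl⟩ := support_convolution_subset (μ := volume)
    (ContinuousLinearMap.lsmul ℝ ℝ) hx
  rw [β.support_normed_eq] at hy
  refine Metric.mem_cthickening_of_dist_le _ z _ _ (subset_tsupport _ hz) ?_
  simp only [Metric.mem_ball, dist_zero_right] at hy
  simpa using hy.le

theorem tendsto_mollify_ae [CompleteSpace F] {β : ℕ → ContDiffBump (0 : 𝔼[d])} {g : 𝔼[d] → F}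
    (hg : LocallyIntegrable g volume) (h0 : Tendsto (fun n => (β n).rOut) atTop (𝓝 0))
    (h2 : ∀ n, (β n).rOut ≤ 2 * (β n).rIn) :
    ∀ᵐ x, Tendsto (fun n => mollify (β n) g x) atTop (𝓝 (g x)) :=
  ContDiffBump.ae_convolution_tendsto_right_of_locallyIntegrable h0 (Eventually.of_forall h2) hg

/-- Mollifications at a scale below the distance from the support to the complement of `Ω` are test
functions. They and their gradients are uniformly bounded and converge almost everywhere, hence in
`L²` of the bounded set `Ω`. -/
theorem hasH10Deriv_of_lipschitzWith (hΩ : IsOpen Ω) (hΩb : Bornology.IsBounded Ω) {C : NNReal}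
    {v : 𝔼[d] → ℝ} (hv : LipschitzWith C v) (hc : HasCompactSupport v) (hs : tsupport v ⊆ Ω) :
    HasH10Deriv Ω v (fderiv ℝ v) := by
  have : IsFiniteMeasure (volume.restrict Ω) := ⟨by simpa using hΩb.measure_lt_top⟩
  have hDb : ∀ x, ‖fderiv ℝ v x‖ ≤ C := fun x => norm_fderiv_le_of_lipschitz ℝ hv
  have hDm : Measurable (fderiv ℝ v) := measurable_fderiv ℝ v
  obtain ⟨B, hB⟩ := hv.continuous.bounded_above_of_compact_support hc
  obtain ⟨δ, hδ, hδΩ⟩ := hc.exists_cthickening_subset_open hΩ hs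
  obtain ⟨β, hβ0, hβ2, hβδ⟩ := exists_contDiffBump_seq (d := d) hδ
  have hvl : LocallyIntegrable v volume := hv.continuous.locallyIntegrable
  have hDl : LocallyIntegrable (fderiv ℝ v) volume := by
    refine (locallyIntegrable_const (C : ℝ)).mono hDm.aestronglyMeasurable (ae_of_all _ fun x => ?_)
    simpa using hDb x
  have hD : ∀ n, fderiv ℝ (mollify (β n) v) = mollify (β n) (fderiv ℝ v) := fun n => by
    ext1 x
    exact (hasFDerivAt_mollify_of_lipschitz (β n) hv x).fderiv
  have hts : ∀ n, tsupport (mollify (β n) v) ⊆ Metric.cthickening δ (tsupport v) := fun n =>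
    (tsupport_mollify_subset _ _).trans (Metric.cthickening_mono (hβδ n) _)
  have htest : ∀ n, IsTestFunction Ω (mollify (β n) v) := fun n =>
    ⟨contDiff_mollify _ hvl, hc.cthickening.of_isClosed_subset (isClosed_tsupport _) (hts n),
      (hts n).trans hδΩ⟩
  have hv2 : MemLp v 2 (volume.restrict Ω) :=
    (hv.continuous.memLp_of_hasCompactSupport hc).restrict Ω
  have hD2 : MemLp (fderiv ℝ v) 2 (volume.restrict Ω) :=
    MemLp.of_bound hDm.aestronglyMeasurable C (ae_of_all _ hDb)
  refine ⟨hv2, hD2, fun n => mollify (β n) v, htest, ?_, ?_⟩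
  · refine tendsto_eLpNorm_of_bounded (C := B + B) (fun n => (((htest n).memLp 2).sub hv2).1)
      (fun n => ae_of_all _ fun x => ?_) (ae_restrict_of_ae ?_)
    · exact (norm_sub_le _ _).trans (add_le_add (norm_mollify_le _ (ae_of_all _ fun z _ => hB _)) (hB _))
    · filter_upwards [tendsto_mollify_ae hvl hβ0 hβ2] with x hx
      simpa using hx.sub_const (v x)
  · refine tendsto_eLpNorm_of_bounded (C := C + C) (fun n => (((htest n).memLp_fderiv 2).sub hD2).1)
      (fun n => ae_of_all _ fun x => ?_) (ae_restrict_of_ae ?_)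
    · rw [hD]
      exact (norm_sub_le _ _).trans (add_le_add (norm_mollify_le _ (ae_of_all _ fun z _ => hDb _))
        (hDb _))
    · filter_upwards [tendsto_mollify_ae hDl hβ0 hβ2] with x hx
      simp only [hD]
      simpa using hx.sub_const (fderiv ℝ v x)

end Mollify

/-! ### Composition with bi-Lipschitz maps that preserve `Ω` -/

section Composition

variable {d : ℕ}

local notation "𝔼[" d "]" => EuclideanSpace ℝ (Fin d)

variable {Ω : Set 𝔼[d]} {Ψ : 𝔼[d] → 𝔼[d]} {K : NNReal}

/-- Lebesgue measure is a multiple of the `d`-dimensional Hausdorff measure, for which the scaling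
of preimages follows from the metric definition. No Jacobian is needed. -/
theorem volume_preimage_le_of_antilipschitz (h : AntilipschitzWith K Ψ) (s : Set 𝔼[d]) :
    volume (Ψ ⁻¹' s) ≤ (K : ℝ≥0∞) ^ d * volume s := by
  have e : (volume : Measure 𝔼[d]) = Measure.addHaarScalarFactor (volume : Measure 𝔼[d])
      (Measure.hausdorffMeasure d : Measure 𝔼[d]) •
      (Measure.hausdorffMeasure d : Measure 𝔼[d]) := by
    have : (Measure.hausdorffMeasure d : Measure 𝔼[d]).IsAddHaarMeasure := by
      have := MeasureTheory.isAddHaarMeasure_hausdorffMeasure (E := 𝔼[d])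
      simpa using this
    exact Measure.isAddLeftInvariant_eq_smul _ _
  have := h.hausdorffMeasure_preimage_le (d := d) (by positivity) s
  rw [e]
  simp only [Measure.smul_apply, ENNReal.rpow_natCast] at this ⊢
  rw [ENNReal.smul_def, ENNReal.smul_def, smul_eq_mul, smul_eq_mul, mul_left_comm]
  gcongr

theorem map_restrict_le_of_antilipschitz (h : AntilipschitzWith K Ψ) (hm : Measurable Ψ)
    (hΩ : Ψ ⁻¹' Ω = Ω) :
    (volume.restrict Ω).map Ψ ≤ ((K : ℝ≥0∞) ^ d) • volume.restrict Ω := by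
  refine Measure.le_iff.2 fun s hs => ?_
  rw [Measure.map_apply hm hs, Measure.restrict_apply (hm hs), Measure.smul_apply,
    Measure.restrict_apply hs, smul_eq_mul]
  refine le_trans (le_of_eq ?_) (volume_preimage_le_of_antilipschitz h _)
  rw [preimage_inter, hΩ]

theorem quasiMeasurePreserving_restrict_of_antilipschitz (h : AntilipschitzWith K Ψ)
    (hm : Measurable Ψ) (hΩ : Ψ ⁻¹' Ω = Ω) :
    Measure.QuasiMeasurePreserving Ψ (volume.restrict Ω) (volume.restrict Ω) :=
  ⟨hm, (map_restrict_le_of_antilipschitz h hm hΩ).absolutelyContinuous.trans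
    Measure.smul_absolutelyContinuous⟩

theorem coe_pow_rpow_ne_top (K : NNReal) (d : ℕ) : ((K : ℝ≥0∞) ^ d) ^ (1 / 2 : ℝ) ≠ ⊤ :=
  ENNReal.rpow_ne_top_of_nonneg (by norm_num) (ENNReal.pow_ne_top ENNReal.coe_ne_top)

variable {F : Type*} [NormedAddCommGroup F]

theorem eLpNorm_comp_le_of_antilipschitz (h : AntilipschitzWith K Ψ) (hm : Measurable Ψ)
    (hΩ : Ψ ⁻¹' Ω = Ω) {g : 𝔼[d] → F} (hg : AEStronglyMeasurable g (volume.restrict Ω)) :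
    eLpNorm (fun x => g (Ψ x)) 2 (volume.restrict Ω) ≤
      ((K : ℝ≥0∞) ^ d) ^ (1 / 2 : ℝ) * eLpNorm g 2 (volume.restrict Ω) := by
  have hle := map_restrict_le_of_antilipschitz h hm hΩ
  have hg' : AEStronglyMeasurable g ((volume.restrict Ω).map Ψ) :=
    hg.mono_ac (quasiMeasurePreserving_restrict_of_antilipschitz h hm hΩ).2
  have e := eLpNorm_map_measure (p := 2) hg' hm.aemeasurable
  rw [show (fun x => g (Ψ x)) = g ∘ Ψ from rfl, ← e]
  refine (eLpNorm_mono_measure _ hle).trans ?_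
  rw [eLpNorm_smul_measure_of_ne_top (by simp)]
  simp

theorem memLp_comp_of_antilipschitz (h : AntilipschitzWith K Ψ) (hm : Measurable Ψ)
    (hΩ : Ψ ⁻¹' Ω = Ω) {g : 𝔼[d] → F} (hg : MemLp g 2 (volume.restrict Ω)) :
    MemLp (fun x => g (Ψ x)) 2 (volume.restrict Ω) :=
  ⟨hg.1.comp_quasiMeasurePreserving (quasiMeasurePreserving_restrict_of_antilipschitz h hm hΩ),
    (eLpNorm_comp_le_of_antilipschitz h hm hΩ hg.1).trans_lt
      (ENNReal.mul_lt_top (coe_pow_rpow_ne_top K d).lt_top hg.2)⟩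

/-- A test function composed with `Ψ` is Lipschitz with compact support in `Ω`, so it lies in
`H_0^1` with the almost everywhere chain rule. Both composition operators, on functions and on
derivatives, are bounded in `L²`, and the graph of the derivative is closed. -/
theorem HasH10Deriv.comp (hΩo : IsOpen Ω) (hΩb : Bornology.IsBounded Ω)
    (h : AntilipschitzWith K Ψ) {C : NNReal} (hC : LipschitzWith C Ψ) (hΩ : Ψ ⁻¹' Ω = Ω)
    {v : 𝔼[d] → ℝ} {D : 𝔼[d] → 𝔼[d] →L[ℝ] ℝ} (hv : HasH10Deriv Ω v D) :
    HasH10Deriv Ω (fun x => v (Ψ x)) (fun x => (D (Ψ x)).comp (fderiv ℝ Ψ x)) := by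
  obtain ⟨φ, hφ, tv, tD⟩ := hv.approx
  have hm := hC.continuous.measurable
  have hDΨ : AEStronglyMeasurable (fderiv ℝ Ψ) (volume.restrict Ω) :=
    (measurable_fderiv ℝ Ψ).aestronglyMeasurable
  have hΨC : ∀ x, ‖fderiv ℝ Ψ x‖ ≤ C := fun x => norm_fderiv_le_of_lipschitz ℝ hC
  have hcompm : ∀ G : 𝔼[d] → 𝔼[d] →L[ℝ] ℝ, AEStronglyMeasurable G (volume.restrict Ω) →
      AEStronglyMeasurable (fun x => (G (Ψ x)).comp (fderiv ℝ Ψ x)) (volume.restrict Ω) := by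
    intro G hG
    have hG' := hG.comp_quasiMeasurePreserving
      (quasiMeasurePreserving_restrict_of_antilipschitz h hm hΩ)
    have hc : Continuous fun p : (𝔼[d] →L[ℝ] ℝ) × (𝔼[d] →L[ℝ] 𝔼[d]) => p.1.comp p.2 :=
      continuous_fst.clm_comp continuous_snd
    exact hc.comp_aestronglyMeasurable (hG'.prodMk hDΨ)
  have hbound : ∀ G : 𝔼[d] → 𝔼[d] →L[ℝ] ℝ, AEStronglyMeasurable G (volume.restrict Ω) →
      eLpNorm (fun x => (G (Ψ x)).comp (fderiv ℝ Ψ x)) 2 (volume.restrict Ω) ≤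
        ENNReal.ofReal C * (((K : ℝ≥0∞) ^ d) ^ (1 / 2 : ℝ) * eLpNorm G 2 (volume.restrict Ω)) := by
    intro G hG
    refine le_trans ?_ (mul_le_mul_right (eLpNorm_comp_le_of_antilipschitz h hm hΩ hG) _)
    refine eLpNorm_le_mul_eLpNorm_of_ae_le_mul (ae_of_all _ fun x => ?_) 2
    refine (ContinuousLinearMap.opNorm_comp_le _ _).trans ?_
    rw [mul_comm]
    exact mul_le_mul_of_nonneg_right (hΨC x) (norm_nonneg _)
  refine HasH10Deriv.of_tendsto (v := fun n x => φ n (Ψ x))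
    (D := fun n x => (fderiv ℝ (φ n) (Ψ x)).comp (fderiv ℝ Ψ x)) (fun n => ?_)
    (memLp_comp_of_antilipschitz h hm hΩ hv.memLp)
    ⟨hcompm D hv.memLp_deriv.1, (hbound D hv.memLp_deriv.1).trans_lt ?_⟩ ?_ ?_
  · obtain ⟨L, hL⟩ := (hφ n).1.lipschitzWith_of_hasCompactSupport (hφ n).2.1 (by simp)
    have hts : tsupport (fun x => φ n (Ψ x)) ⊆ Ψ ⁻¹' tsupport (φ n) :=
      closure_minimal (fun x hx => subset_tsupport (φ n) hx)
        ((isClosed_tsupport _).preimage hC.continuous)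
    have hcpt : IsCompact (Ψ ⁻¹' tsupport (φ n)) :=
      (h.isClosedEmbedding hC.uniformContinuous).isCompact_preimage (hφ n).2.1
    refine (hasH10Deriv_of_lipschitzWith hΩo hΩb (hL.comp hC)
      (hcpt.of_isClosed_subset (isClosed_tsupport _) hts)
      (hts.trans ((preimage_mono (hφ n).2.2).trans hΩ.subset))).congr_deriv (ae_restrict_of_ae ?_)
    filter_upwards [hC.ae_differentiableAt (μ := volume)] with x hx
    exact (((hφ n).1.differentiable (by simp) (Ψ x)).hasFDerivAt.comp x hx.hasFDerivAt).fderiv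
  · exact ENNReal.mul_lt_top (by simp) (ENNReal.mul_lt_top (coe_pow_rpow_ne_top K d).lt_top hv.memLp_deriv.2)
  · have t := ENNReal.Tendsto.const_mul (a := ((K : ℝ≥0∞) ^ d) ^ (1 / 2 : ℝ)) tv
      (Or.inr (coe_pow_rpow_ne_top K d))
    rw [mul_zero] at t
    refine tendsto_of_tendsto_of_tendsto_of_le_of_le tendsto_const_nhds t (fun _ => zero_le)
      fun n => ?_
    exact eLpNorm_comp_le_of_antilipschitz h hm hΩ (g := φ n - v)
      (((hφ n).memLp 2).1.sub hv.memLp.1)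
  · have t := ENNReal.Tendsto.const_mul (a := ENNReal.ofReal C)
      (ENNReal.Tendsto.const_mul (a := ((K : ℝ≥0∞) ^ d) ^ (1 / 2 : ℝ)) tD
        (Or.inr (coe_pow_rpow_ne_top K d))) (Or.inr ENNReal.ofReal_ne_top)
    rw [mul_zero, mul_zero] at t
    refine tendsto_of_tendsto_of_tendsto_of_le_of_le tendsto_const_nhds t (fun _ => zero_le)
      fun n => ?_
    refine le_trans (le_of_eq ?_) (hbound (fderiv ℝ (φ n) - D) (((hφ n).memLp_fderiv 2).1.sub hv.memLp_deriv.1))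
    rfl

end Composition

/-! ### The Poincaré inequality -/

section Poincare

variable {d : ℕ}

local notation "𝔼[" d "]" => EuclideanSpace ℝ (Fin d)

variable {Ω : Set 𝔼[d]}

theorem IsTestFunction.mul_left {φ η : 𝔼[d] → ℝ} (hφ : IsTestFunction Ω φ) (hη : ContDiff ℝ ∞ η) :
    IsTestFunction Ω (fun x => η x * φ x) :=
  ⟨hη.mul hφ.1, hφ.2.1.mul_left, (tsupport_mul_subset_right).trans hφ.2.2⟩

/-- Integrating `∂ᵢ(xᵢ φ) φ` by parts yields `∫ φ² = -2 ∫ xᵢ φ ∂ᵢφ`, where `|xᵢ| ≤ R`. The constant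
is immaterial; only the existence of some Poincaré constant matters. -/
theorem IsTestFunction.lpNorm_le {R : ℝ} (hR : 0 ≤ R) (hΩm : MeasurableSet Ω)
    (hΩ : Ω ⊆ Metric.closedBall 0 R) (i : Fin d)
    {φ : 𝔼[d] → ℝ} (hφ : IsTestFunction Ω φ) :
    lpNorm φ 2 (volume.restrict Ω) ≤ 2 * R * lpNorm (fderiv ℝ φ) 2 (volume.restrict Ω) := by
  set μ := volume.restrict Ω
  set e : 𝔼[d] := EuclideanSpace.single i 1
  set D : 𝔼[d] → ℝ := fun x => fderiv ℝ φ x e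
  have hcoord : ContDiff ℝ ∞ (fun x : 𝔼[d] => x i) := (EuclideanSpace.proj i (𝕜 := ℝ)).contDiff
  have hη := hφ.mul_left hcoord
  have hD : ∀ x, fderiv ℝ (fun x : 𝔼[d] => x i * φ x) x e = x i * D x + φ x := by
    intro x
    have h1 : HasFDerivAt (fun x : 𝔼[d] => x i) (EuclideanSpace.proj i (𝕜 := ℝ)) x :=
      (EuclideanSpace.proj i (𝕜 := ℝ)).hasFDerivAt
    have h2 := (hφ.1.differentiable (by simp) x).hasFDerivAt
    rw [(h1.fun_mul h2).fderiv]
    simp [e, D]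
  have hDc : Continuous D := hφ.continuous_fderiv.clm_apply continuous_const
  have hφm := hφ.memLp 2
  have hDm : MemLp D 2 μ := (hφ.memLp_fderiv 2).clm_apply_const e
  have hxD : Integrable (fun x => x i * D x * φ x) μ := by
    refine (Continuous.integrable_of_hasCompactSupport ?_ hφ.2.1.mul_left).restrict
    exact (hcoord.continuous.mul hDc).mul hφ.1.continuous
  have hφφ : Integrable (fun x => φ x * φ x) μ := MemLp.integrable_mul hφm hφm
  have key := hφ.integral_fderiv_mul hη e
  simp only [hD, add_mul] at key
  rw [integral_add hxD hφφ] at key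
  have key2 : ∫ x, φ x * φ x ∂μ = -2 * ∫ x, x i * D x * φ x ∂μ := by
    have : ∫ x in Ω, x i * φ x * fderiv ℝ φ x e = ∫ x, x i * D x * φ x ∂μ :=
      integral_congr_ae (ae_of_all _ fun x => by simp only [D]; ring)
    rw [this] at key
    linarith
  have hsq : lpNorm φ 2 μ ^ 2 = ∫ x, φ x * φ x ∂μ := by
    rw [lpNorm_two_sq hφm]
    exact integral_congr_ae (ae_of_all _ fun x => by simp [sq])
  have hp := integral_norm_mul_norm_le_lpNorm (hφ.memLp_fderiv 2) hφm
  have hle : lpNorm φ 2 μ ^ 2 ≤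
      2 * R * (lpNorm (fderiv ℝ φ) 2 μ * lpNorm φ 2 μ) := by
    rw [hsq, key2]
    have h1 : ‖∫ x, x i * D x * φ x ∂μ‖ ≤ ∫ x, R * (‖fderiv ℝ φ x‖ * ‖φ x‖) ∂μ := by
      refine norm_integral_le_of_norm_le (hp.1.const_mul R) ?_
      filter_upwards [ae_restrict_mem hΩm] with x hx
      have hx1 : ‖x i‖ ≤ R := (PiLp.norm_apply_le x i).trans (by simpa using hΩ hx)
      have hx2 : ‖D x‖ ≤ ‖fderiv ℝ φ x‖ := by
        have := (fderiv ℝ φ x).le_opNorm e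
        simpa [e, D] using this
      rw [norm_mul, norm_mul, ← mul_assoc]
      gcongr
    rw [integral_const_mul] at h1
    have h2 := neg_le_abs (∫ x, x i * D x * φ x ∂μ)
    rw [Real.norm_eq_abs] at h1
    have h3 := mul_le_mul_of_nonneg_left hp.2 hR
    linarith
  rcases (lpNorm_nonneg (f := φ) (p := 2) (μ := μ)).eq_or_lt with h0 | h0
  · rw [← h0]
    exact mul_nonneg (by positivity) lpNorm_nonneg
  · refine le_of_mul_le_mul_right ?_ h0
    nlinarith

theorem HasH10Deriv.lpNorm_le {R : ℝ} (hR : 0 ≤ R) (hΩm : MeasurableSet Ω)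
    (hΩ : Ω ⊆ Metric.closedBall 0 R) (i : Fin d)
    {v : 𝔼[d] → ℝ} {D : 𝔼[d] → 𝔼[d] →L[ℝ] ℝ} (hv : HasH10Deriv Ω v D) :
    lpNorm v 2 (volume.restrict Ω) ≤ 2 * R * lpNorm D 2 (volume.restrict Ω) := by
  obtain ⟨φ, hφ, tv, tD⟩ := hv.approx
  exact le_of_tendsto_of_tendsto'
    (tendsto_lpNorm_of_tendsto_eLpNorm_sub (by norm_num) (fun n => (hφ n).memLp 2) hv.memLp tv)
    ((tendsto_lpNorm_of_tendsto_eLpNorm_sub (by norm_num) (fun n => (hφ n).memLp_fderiv 2)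
      hv.memLp_deriv tD).const_mul _) fun n => (hφ n).lpNorm_le hR hΩm hΩ i

theorem norm_weakGrad (v : 𝔼[d] → ℝ) (x : 𝔼[d]) : ‖weakGrad Ω v x‖ = ‖weakFDeriv Ω v x‖ :=
  LinearIsometryEquiv.norm_map _ _

theorem lpNorm_weakGrad {v : 𝔼[d] → ℝ} {p : ℝ≥0∞}
    (h : AEStronglyMeasurable (weakFDeriv Ω v) (volume.restrict Ω)) :
    lpNorm (weakGrad Ω v) p (volume.restrict Ω) = lpNorm (weakFDeriv Ω v) p (volume.restrict Ω) :=
  lpNorm_congr_norm ((InnerProductSpace.toDual ℝ 𝔼[d]).symm.continuous.comp_aestronglyMeasurable h) h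
    (ae_of_all _ fun x => norm_weakGrad v x)

theorem HasH10Deriv.lpNorm_weakGrad (hΩ : IsOpen Ω) {v : 𝔼[d] → ℝ} {D : 𝔼[d] → 𝔼[d] →L[ℝ] ℝ}
    (hv : HasH10Deriv Ω v D) :
    lpNorm (weakGrad Ω v) 2 (volume.restrict Ω) = lpNorm D 2 (volume.restrict Ω) := by
  have h := hv.hasWeakFDeriv.weakFDeriv_ae_eq hΩ
  rw [MeshSensitivity.lpNorm_weakGrad (hv.memLp_deriv.1.congr h.symm), lpNorm_congr_ae' h]

theorem poincareConst_nonneg : 0 ≤ poincareConst Ω := Real.sInf_nonneg fun _ h => h.1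

/-- The infimum is itself admissible. Nonemptiness of the set is essential because `sInf ∅ = 0`; it
comes from the crude bound `2 * R`, which needs a coordinate direction and hence `1 ≤ d`. -/
theorem HasH10Deriv.lpNorm_le_poincareConst (hd : 1 ≤ d) (hΩ : IsOpen Ω)
    (hΩb : Bornology.IsBounded Ω) {v : 𝔼[d] → ℝ} {D : 𝔼[d] → 𝔼[d] →L[ℝ] ℝ}
    (hv : HasH10Deriv Ω v D) :
    lpNorm v 2 (volume.restrict Ω) ≤ poincareConst Ω * lpNorm D 2 (volume.restrict Ω) := by
  obtain ⟨R, hR0, hR⟩ := hΩb.subset_closedBall_lt 0 0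
  have hne : {C : ℝ | 0 ≤ C ∧ ∀ v : 𝔼[d] → ℝ, MemH10 Ω v →
      lpNorm v 2 (volume.restrict Ω) ≤ C * lpNorm (weakGrad Ω v) 2 (volume.restrict Ω)}.Nonempty := by
    refine ⟨2 * R, by positivity, fun v hv => ?_⟩
    have h := hv.hasH10Deriv hΩ
    rw [h.lpNorm_weakGrad hΩ]
    exact h.lpNorm_le hR0.le hΩ.measurableSet hR ⟨0, hd⟩
  have hall : ∀ C ∈ {C : ℝ | 0 ≤ C ∧ ∀ v : 𝔼[d] → ℝ, MemH10 Ω v →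
      lpNorm v 2 (volume.restrict Ω) ≤ C * lpNorm (weakGrad Ω v) 2 (volume.restrict Ω)},
      lpNorm v 2 (volume.restrict Ω) ≤ C * lpNorm D 2 (volume.restrict Ω) := fun C hC => by
    have := hC.2 v hv.memH10
    rwa [hv.lpNorm_weakGrad hΩ] at this
  rcases (lpNorm_nonneg (f := D) (p := 2) (μ := volume.restrict Ω)).eq_or_lt with h0 | h0
  · obtain ⟨C, hC⟩ := hne
    have := hall C hC
    rwa [← h0, mul_zero] at this ⊢
  · rw [← div_le_iff₀ h0]
    refine le_csInf hne fun C hC => ?_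
    rw [div_le_iff₀ h0]
    exact hall C hC

end Poincare

/-! ### Integration by parts for the transport term -/

section Divergence

variable {d : ℕ}

local notation "𝔼[" d "]" => EuclideanSpace ℝ (Fin d)

variable {Ω : Set 𝔼[d]}

theorem continuous_trace : Continuous fun A : 𝔼[d] →L[ℝ] 𝔼[d] =>
    LinearMap.trace ℝ 𝔼[d] (A : 𝔼[d] →ₗ[ℝ] 𝔼[d]) :=
  ((LinearMap.trace ℝ 𝔼[d]).comp (ContinuousLinearMap.coeLM ℝ)).continuous_of_finiteDimensional

theorem trace_eq_sum_coord (A : 𝔼[d] →L[ℝ] 𝔼[d]) :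
    LinearMap.trace ℝ 𝔼[d] (A : 𝔼[d] →ₗ[ℝ] 𝔼[d]) = ∑ i, A (EuclideanSpace.single i 1) i := by
  rw [LinearMap.trace_eq_sum_inner _ (EuclideanSpace.basisFun (Fin d) ℝ)]
  refine Finset.sum_congr rfl fun i _ => ?_
  simp [EuclideanSpace.inner_single_left]

theorem memLp_top_trace {Db : 𝔼[d] → 𝔼[d] →L[ℝ] 𝔼[d]} (h : MemLp Db ⊤ (volume.restrict Ω)) :
    MemLp (fun x => LinearMap.trace ℝ 𝔼[d] (Db x : 𝔼[d] →ₗ[ℝ] 𝔼[d])) ⊤ (volume.restrict Ω) :=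
  h.continuousLinearMap_comp (⟨(LinearMap.trace ℝ 𝔼[d]).comp (ContinuousLinearMap.coeLM ℝ),
    continuous_trace⟩ : (𝔼[d] →L[ℝ] 𝔼[d]) →L[ℝ] ℝ)

theorem tendsto_eLpNorm_of_ae_le_mul {α E F : Type*} [NormedAddCommGroup E] [NormedAddCommGroup F]
    {mα : MeasurableSpace α} {μ : Measure α} {f : ℕ → α → E} {g : ℕ → α → F} {C : ℝ}
    (h : ∀ n, ∀ᵐ x ∂μ, ‖f n x‖ ≤ C * ‖g n x‖)
    (tg : Tendsto (fun n => eLpNorm (g n) 2 μ) atTop (𝓝 0)) :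
    Tendsto (fun n => eLpNorm (f n) 2 μ) atTop (𝓝 0) := by
  have t := ENNReal.Tendsto.const_mul (a := ENNReal.ofReal C) tg (Or.inr ENNReal.ofReal_ne_top)
  rw [mul_zero] at t
  exact tendsto_of_tendsto_of_tendsto_of_le_of_le tendsto_const_nhds t (fun _ => zero_le)
    fun n => eLpNorm_le_mul_eLpNorm_of_ae_le_mul (h n) 2

theorem memLp_two_of_ae_le_mul {α E F : Type*} [NormedAddCommGroup E] [NormedAddCommGroup F]
    {mα : MeasurableSpace α} {μ : Measure α} {f : α → E} {g : α → F} {C : ℝ}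
    (hf : AEStronglyMeasurable f μ) (hg : MemLp g 2 μ) (h : ∀ᵐ x ∂μ, ‖f x‖ ≤ C * ‖g x‖) :
    MemLp f 2 μ := hg.of_le_mul hf h

theorem aestronglyMeasurable_clm_apply {α E F : Type*} [NormedAddCommGroup E] [NormedAddCommGroup F]
    [NormedSpace ℝ E] [NormedSpace ℝ F]
    {mα : MeasurableSpace α} {μ : Measure α} {D : α → E →L[ℝ] F} {b : α → E}
    (hD : AEStronglyMeasurable D μ) (hb : AEStronglyMeasurable b μ) :
    AEStronglyMeasurable (fun x => D x (b x)) μ :=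
  (isBoundedBilinearMap_apply (𝕜 := ℝ) (E := E) (F := F)).continuous.comp_aestronglyMeasurable
    (hD.prodMk hb)

/-- The weak derivative of `b` is tested with `φ²`: the `i`-th component of the identity in
direction `eᵢ`, summed over `i`, produces the trace on one side and `2 φ ∇φ · b` on the other. -/
theorem IsTestFunction.integral_fderiv_apply_mul_self {b : 𝔼[d] → 𝔼[d]} {Db : 𝔼[d] → 𝔼[d] →L[ℝ] 𝔼[d]}
    (hb : HasWeakFDeriv Ω b Db) {φ : 𝔼[d] → ℝ} (hφ : IsTestFunction Ω φ) :
    ∫ x in Ω, fderiv ℝ φ x (b x) * φ x =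
      -(1 / 2) * ∫ x in Ω, LinearMap.trace ℝ 𝔼[d] (Db x : 𝔼[d] →ₗ[ℝ] 𝔼[d]) * φ x * φ x := by
  have hη := hφ.mul_left hφ.1
  have hD : ∀ x w, fderiv ℝ (fun x => φ x * φ x) x w = 2 * φ x * fderiv ℝ φ x w := fun x w => by
    have h2 := (hφ.1.differentiable (by simp) x).hasFDerivAt
    rw [(h2.fun_mul h2).fderiv]
    simp
    ring
  have hi : ∀ i : Fin d,
      Integrable (fun x => fderiv ℝ (fun x => φ x * φ x) x (EuclideanSpace.single i 1) * b x i)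
        (volume.restrict Ω) ∧
      Integrable (fun x => φ x * φ x * Db x (EuclideanSpace.single i 1) i) (volume.restrict Ω) ∧
      ∫ x in Ω, fderiv ℝ (fun x => φ x * φ x) x (EuclideanSpace.single i 1) * b x i =
        -∫ x in Ω, φ x * φ x * Db x (EuclideanSpace.single i 1) i := by
    intro i
    have e1 := hb.integrable_left hη (EuclideanSpace.single i 1)
    have e2 := hb.integrable_right hη (EuclideanSpace.single i 1)
    have e3 := congrArg (EuclideanSpace.proj i (𝕜 := ℝ)) (hb.2.2 _ hη (EuclideanSpace.single i 1))
    rw [map_neg, ← ContinuousLinearMap.integral_comp_comm _ e1,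
      ← ContinuousLinearMap.integral_comp_comm _ e2] at e3
    refine ⟨?_, ?_, ?_⟩
    · simpa using (EuclideanSpace.proj i (𝕜 := ℝ)).integrable_comp e1
    · simpa using (EuclideanSpace.proj i (𝕜 := ℝ)).integrable_comp e2
    · simpa using e3
  have hs := Finset.sum_congr (rfl : (Finset.univ : Finset (Fin d)) = _) fun i _ => (hi i).2.2
  rw [Finset.sum_neg_distrib, ← integral_finsetSum _ fun i _ => (hi i).1,
    ← integral_finsetSum _ fun i _ => (hi i).2.1] at hs
  have l1 : ∀ x, ∑ i, fderiv ℝ (fun x => φ x * φ x) x (EuclideanSpace.single i 1) * b x i =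
      2 * (fderiv ℝ φ x (b x) * φ x) := by
    intro x
    have hbx : b x = ∑ i, b x i • EuclideanSpace.single i (1 : ℝ) := by
      have := ((EuclideanSpace.basisFun (Fin d) ℝ).sum_repr (b x)).symm
      simpa using this
    simp only [hD]
    conv_rhs => rw [hbx, map_sum, Finset.sum_mul, Finset.mul_sum]
    refine Finset.sum_congr rfl fun i _ => ?_
    rw [map_smul, smul_eq_mul]
    ring
  have l2 : ∀ x, ∑ i, φ x * φ x * Db x (EuclideanSpace.single i 1) i =
      LinearMap.trace ℝ 𝔼[d] (Db x : 𝔼[d] →ₗ[ℝ] 𝔼[d]) * φ x * φ x := by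
    intro x
    rw [trace_eq_sum_coord, ← Finset.mul_sum]
    ring
  simp only [l1, l2, integral_const_mul] at hs
  linarith

/-- Integration by parts for the transport term. -/
theorem HasH10Deriv.integral_apply_mul_self {b : 𝔼[d] → 𝔼[d]} {Db : 𝔼[d] → 𝔼[d] →L[ℝ] 𝔼[d]}
    (hb : HasWeakFDeriv Ω b Db) (hb1 : MemLp b ⊤ (volume.restrict Ω))
    (hDb : MemLp Db ⊤ (volume.restrict Ω))
    {v : 𝔼[d] → ℝ} {D : 𝔼[d] → 𝔼[d] →L[ℝ] ℝ} (hv : HasH10Deriv Ω v D) :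
    ∫ x in Ω, D x (b x) * v x =
      -(1 / 2) * ∫ x in Ω, LinearMap.trace ℝ 𝔼[d] (Db x : 𝔼[d] →ₗ[ℝ] 𝔼[d]) * v x * v x := by
  obtain ⟨φ, hφ, tv, tD⟩ := hv.approx
  have htr := memLp_top_trace hDb
  have hbb := ae_le_lpNorm_exponent_top hb1
  have htrb := ae_le_lpNorm_exponent_top htr
  have hbD : ∀ G : 𝔼[d] → 𝔼[d] →L[ℝ] ℝ, ∀ᵐ x ∂(volume.restrict Ω),
      ‖G x (b x)‖ ≤ lpNorm b ⊤ (volume.restrict Ω) * ‖G x‖ := fun G => by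
    filter_upwards [hbb] with x hx
    rw [mul_comm]
    exact (G x).le_opNorm_of_le hx
  have hbT : ∀ g : 𝔼[d] → ℝ, ∀ᵐ x ∂(volume.restrict Ω),
      ‖LinearMap.trace ℝ 𝔼[d] (Db x : 𝔼[d] →ₗ[ℝ] 𝔼[d]) * g x‖ ≤
        lpNorm (fun x => LinearMap.trace ℝ 𝔼[d] (Db x : 𝔼[d] →ₗ[ℝ] 𝔼[d])) ⊤ (volume.restrict Ω)
          * ‖g x‖ := fun g => by
    filter_upwards [htrb] with x hx
    rw [norm_mul]
    gcongr
  have t1 := tendsto_integral_mul_of_tendsto_eLpNorm (μ := volume.restrict Ω)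
    (f := fun n x => fderiv ℝ (φ n) x (b x)) (f' := fun x => D x (b x))
    (fun n => memLp_two_of_ae_le_mul (aestronglyMeasurable_clm_apply ((hφ n).memLp_fderiv 2).1 hb1.1)
      ((hφ n).memLp_fderiv 2) (hbD _))
    (fun n => (hφ n).memLp 2)
    (memLp_two_of_ae_le_mul (aestronglyMeasurable_clm_apply hv.memLp_deriv.1 hb1.1)
      hv.memLp_deriv (hbD _)) hv.memLp
    (tendsto_eLpNorm_of_ae_le_mul (fun n => hbD (fderiv ℝ (φ n) - D)) tD) tv
  have t2 := tendsto_integral_mul_of_tendsto_eLpNorm (μ := volume.restrict Ω)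
    (f := fun n x => LinearMap.trace ℝ 𝔼[d] (Db x : 𝔼[d] →ₗ[ℝ] 𝔼[d]) * φ n x)
    (f' := fun x => LinearMap.trace ℝ 𝔼[d] (Db x : 𝔼[d] →ₗ[ℝ] 𝔼[d]) * v x)
    (fun n => memLp_two_of_ae_le_mul (htr.1.mul ((hφ n).memLp 2).1) ((hφ n).memLp 2) (hbT _))
    (fun n => (hφ n).memLp 2)
    (memLp_two_of_ae_le_mul (htr.1.mul hv.memLp.1) hv.memLp (hbT _)) hv.memLp
    (tendsto_eLpNorm_of_ae_le_mul (fun n => by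
      filter_upwards [hbT (φ n - v)] with x hx
      simpa [mul_sub] using hx) tv) tv
  refine tendsto_nhds_unique t1 ((t2.const_mul (-(1 / 2))).congr fun n => ?_)
  exact ((hφ n).integral_fderiv_apply_mul_self hb).symm

end Divergence

/-! ### `L²` increments under near-identity maps -/

section Displacement

variable {d : ℕ}

local notation "𝔼[" d "]" => EuclideanSpace ℝ (Fin d)

variable {Ω : Set 𝔼[d]} {Z : 𝔼[d] → 𝔼[d]} {K : NNReal}

theorem antilipschitzWith_id_add (hK : K < 1) (hZ : LipschitzWith K Z) :
    AntilipschitzWith (1 - K)⁻¹ fun x => x + Z x := by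
  refine AntilipschitzWith.of_le_mul_dist fun x y => ?_
  have h1 := hZ.dist_le_mul x y
  have hK' : (0 : ℝ) < 1 - K := by
    have : (K : ℝ) < 1 := by exact_mod_cast hK
    linarith
  rw [NNReal.coe_inv, NNReal.coe_sub hK.le, NNReal.coe_one, inv_mul_eq_div, le_div_iff₀ hK']
  have h2 : dist x y ≤ dist (x + Z x) (y + Z y) + dist (Z x) (Z y) := by
    have e : x - y = (x + Z x - (y + Z y)) - (Z x - Z y) := by abel
    rw [dist_eq_norm, dist_eq_norm, dist_eq_norm, e]
    exact norm_sub_le _ _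
  linarith

/-- Points outside `Ω` are fixed. If a point of `Ω` were sent outside, it would share its image with
that fixed image point, against injectivity. -/
theorem preimage_id_add (hK : K < 1) (hZ : LipschitzWith K Z) (h0 : ∀ x ∉ Ω, Z x = 0) :
    (fun x => x + Z x) ⁻¹' Ω = Ω := by
  ext x
  by_cases hx : x ∈ Ω
  · refine iff_of_true ?_ hx
    by_contra h
    have h' : x + Z x ∉ Ω := h
    have := (antilipschitzWith_id_add hK hZ).injective
      (show x + Z x + Z (x + Z x) = x + Z x by rw [h0 _ h', add_zero])
    rw [this] at h'
    exact h' hx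
  · simp [h0 x hx, hx]

/-- The fundamental theorem of calculus along the segment, followed by the comparison of `L¹` and
`L²` on a probability space. -/
theorem enorm_sub_sq_le_lintegral {φ : 𝔼[d] → ℝ} (hφ : ContDiff ℝ 1 φ) (x z : 𝔼[d]) :
    ‖φ (x + z) - φ x‖ₑ ^ 2 ≤
      ‖z‖ₑ ^ 2 * ∫⁻ s in Icc (0 : ℝ) 1, ‖fderiv ℝ φ (x + s • z)‖ₑ ^ 2 := by
  have hc : Continuous fun s : ℝ => fderiv ℝ φ (x + s • z) :=
    (hφ.continuous_fderiv (by simp)).comp (by fun_prop)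
  have hd : ∀ s : ℝ, HasDerivAt (fun s : ℝ => φ (x + s • z)) (fderiv ℝ φ (x + s • z) z) s := by
    intro s
    have h1 : HasDerivAt (fun s : ℝ => x + s • z) z s := by
      simpa using ((hasDerivAt_id s).smul_const z).const_add x
    exact ((hφ.differentiable (by simp) _).hasFDerivAt).comp_hasDerivAt s h1
  have hcz : Continuous fun s : ℝ => fderiv ℝ φ (x + s • z) z := hc.clm_apply continuous_const
  have hftc := intervalIntegral.integral_eq_sub_of_hasDerivAt (a := 0) (b := 1)
    (fun s _ => hd s) (hcz.intervalIntegrable _ _)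
  simp only [one_smul, zero_smul, add_zero] at hftc
  rw [intervalIntegral.integral_of_le zero_le_one, ← integral_Icc_eq_integral_Ioc] at hftc
  set ν := (volume : Measure ℝ).restrict (Icc 0 1)
  have hν : IsProbabilityMeasure ν := ⟨by simp [ν]⟩
  have h1 : ‖φ (x + z) - φ x‖ₑ ≤ eLpNorm (fun s : ℝ => fderiv ℝ φ (x + s • z) z) 1 ν := by
    rw [← hftc, eLpNorm_one_eq_lintegral_enorm]
    exact enorm_integral_le_lintegral_enorm _
  have h2 : eLpNorm (fun s : ℝ => fderiv ℝ φ (x + s • z) z) 1 ν ≤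
      eLpNorm (fun s : ℝ => fderiv ℝ φ (x + s • z) z) 2 ν :=
    eLpNorm_le_eLpNorm_of_exponent_le (by norm_num) hcz.aestronglyMeasurable
  have h3 : eLpNorm (fun s : ℝ => fderiv ℝ φ (x + s • z) z) 2 ν ^ 2 =
      ∫⁻ s, ‖fderiv ℝ φ (x + s • z) z‖ₑ ^ 2 ∂ν := by
    have := eLpNorm_nnreal_pow_eq_lintegral (p := 2) (μ := ν)
      (f := fun s : ℝ => fderiv ℝ φ (x + s • z) z) (by simp)
    simpa using this
  calc ‖φ (x + z) - φ x‖ₑ ^ 2 ≤ ∫⁻ s, ‖fderiv ℝ φ (x + s • z) z‖ₑ ^ 2 ∂ν := by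
        rw [← h3]
        gcongr
        exact h1.trans h2
    _ ≤ ∫⁻ s, ‖z‖ₑ ^ 2 * ‖fderiv ℝ φ (x + s • z)‖ₑ ^ 2 ∂ν := by
        refine lintegral_mono fun s => ?_
        rw [← mul_pow, mul_comm]
        gcongr
        exact ContinuousLinearMap.le_opENorm _ _
    _ = ‖z‖ₑ ^ 2 * ∫⁻ s, ‖fderiv ℝ φ (x + s • z)‖ₑ ^ 2 ∂ν :=
        lintegral_const_mul _ (hc.enorm.measurable.pow_const 2)

theorem eLpNorm_two_sq {α E : Type*} [NormedAddCommGroup E] {mα : MeasurableSpace α} {μ : Measure α}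
    (f : α → E) : eLpNorm f 2 μ ^ 2 = ∫⁻ x, ‖f x‖ₑ ^ 2 ∂μ := by
  have := eLpNorm_nnreal_pow_eq_lintegral (p := 2) (μ := μ) (f := f) (by simp)
  simpa using this

/-- The segment bound is integrated over `Ω` and Tonelli exchanges the integrals. For each `s ∈ [0,
1]` the map `x ↦ x + s Z x` satisfies the same hypotheses, so the inner integral is bounded
uniformly in `s`. -/
theorem IsTestFunction.eLpNorm_displacement_le (hK : K < 1) (hZ : LipschitzWith K Z)
    (h0 : ∀ x ∉ Ω, Z x = 0) {M : NNReal} (hM : ∀ x, ‖Z x‖₊ ≤ M) {φ : 𝔼[d] → ℝ}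
    (hφ : IsTestFunction Ω φ) :
    eLpNorm (fun x => φ (x + Z x) - φ x) 2 (volume.restrict Ω) ≤
      M * (((((1 - K)⁻¹ : NNReal) : ℝ≥0∞) ^ d) ^ (1 / 2 : ℝ) *
        eLpNorm (fderiv ℝ φ) 2 (volume.restrict Ω)) := by
  set κ := ((((1 - K)⁻¹ : NNReal) : ℝ≥0∞) ^ d) ^ (1 / 2 : ℝ)
  have hDc := hφ.continuous_fderiv
  have hZc := hZ.continuous
  have hs : ∀ s ∈ Icc (0 : ℝ) 1, ∫⁻ x in Ω, ‖fderiv ℝ φ (x + s • Z x)‖ₑ ^ 2 ≤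
      (κ * eLpNorm (fderiv ℝ φ) 2 (volume.restrict Ω)) ^ 2 := by
    intro s hs
    have hsZ : LipschitzWith K (fun x => s • Z x) := by
      refine LipschitzWith.of_dist_le_mul fun x y => ?_
      rw [dist_smul₀, Real.norm_of_nonneg hs.1]
      exact (mul_le_of_le_one_left dist_nonneg hs.2).trans (hZ.dist_le_mul x y)
    have hs0 : ∀ x ∉ Ω, s • Z x = 0 := fun x hx => by rw [h0 x hx, smul_zero]
    have := eLpNorm_comp_le_of_antilipschitz (antilipschitzWith_id_add hK hsZ)
      (by fun_prop) (preimage_id_add hK hsZ hs0) (hφ.memLp_fderiv 2).1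
    rw [← eLpNorm_two_sq]
    gcongr
  have hsq : eLpNorm (fun x => φ (x + Z x) - φ x) 2 (volume.restrict Ω) ^ 2 ≤
      (M * (κ * eLpNorm (fderiv ℝ φ) 2 (volume.restrict Ω))) ^ 2 := by
    rw [eLpNorm_two_sq]
    calc ∫⁻ x in Ω, ‖φ (x + Z x) - φ x‖ₑ ^ 2
        ≤ ∫⁻ x in Ω, (M : ℝ≥0∞) ^ 2 *
          ∫⁻ s in Icc (0 : ℝ) 1, ‖fderiv ℝ φ (x + s • Z x)‖ₑ ^ 2 := by
          refine lintegral_mono fun x => ?_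
          refine (enorm_sub_sq_le_lintegral (hφ.1.of_le (by simp)) x (Z x)).trans ?_
          gcongr
          exact ENNReal.coe_le_coe.2 (hM x)
      _ = (M : ℝ≥0∞) ^ 2 * ∫⁻ x in Ω,
          ∫⁻ s in Icc (0 : ℝ) 1, ‖fderiv ℝ φ (x + s • Z x)‖ₑ ^ 2 :=
          lintegral_const_mul' _ _ (by simp)
      _ = (M : ℝ≥0∞) ^ 2 * ∫⁻ s in Icc (0 : ℝ) 1,
          ∫⁻ x in Ω, ‖fderiv ℝ φ (x + s • Z x)‖ₑ ^ 2 := by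
          rw [lintegral_lintegral_swap]
          refine Continuous.aemeasurable ?_
          have hc : Continuous fun p : 𝔼[d] × ℝ => fderiv ℝ φ (p.1 + p.2 • Z p.1) :=
            hDc.comp (by fun_prop)
          exact (ENNReal.continuous_pow 2).comp hc.enorm
      _ ≤ (M : ℝ≥0∞) ^ 2 * ∫⁻ s in Icc (0 : ℝ) 1,
          (κ * eLpNorm (fderiv ℝ φ) 2 (volume.restrict Ω)) ^ 2 := by
          exact mul_le_mul_right (setLIntegral_mono' measurableSet_Icc hs) _
      _ = (M * (κ * eLpNorm (fderiv ℝ φ) 2 (volume.restrict Ω))) ^ 2 := by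
          rw [setLIntegral_const]
          simp [mul_pow]
  exact (ENNReal.pow_le_pow_left_iff two_ne_zero).1 hsq

/-- An `L²` bound for the increments of an `H_0^1` function under a small Lipschitz displacement. -/
theorem HasH10Deriv.lpNorm_displacement_le (hK : K < 1) (hZ : LipschitzWith K Z)
    (h0 : ∀ x ∉ Ω, Z x = 0) {M : NNReal} (hM : ∀ x, ‖Z x‖₊ ≤ M) {v : 𝔼[d] → ℝ}
    {D : 𝔼[d] → 𝔼[d] →L[ℝ] ℝ} (hv : HasH10Deriv Ω v D) :
    lpNorm (fun x => v (x + Z x) - v x) 2 (volume.restrict Ω) ≤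
      M * (((1 - K : ℝ)⁻¹ ^ d) ^ (1 / 2 : ℝ) * lpNorm D 2 (volume.restrict Ω)) := by
  obtain ⟨φ, hφ, tv, tD⟩ := hv.approx
  have hanti := antilipschitzWith_id_add hK hZ
  have hpre := preimage_id_add hK hZ h0
  have hm : Measurable fun x => x + Z x := by
    have := hZ.continuous
    fun_prop
  set κ := ((((1 - K)⁻¹ : NNReal) : ℝ≥0∞) ^ d) ^ (1 / 2 : ℝ)
  have hκ : κ.toReal = ((1 - K : ℝ)⁻¹ ^ d) ^ (1 / 2 : ℝ) := by
    simp only [κ]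
    rw [← ENNReal.toReal_rpow, ENNReal.toReal_pow, ENNReal.coe_toReal, NNReal.coe_inv,
      NNReal.coe_sub hK.le, NNReal.coe_one]
  have hcomp : ∀ n, eLpNorm (fun x => φ n (x + Z x) - v (x + Z x)) 2 (volume.restrict Ω) ≤
      κ * eLpNorm (φ n - v) 2 (volume.restrict Ω) := fun n =>
    eLpNorm_comp_le_of_antilipschitz hanti hm hpre (g := φ n - v)
      (((hφ n).memLp 2).1.sub hv.memLp.1)
  have hφm : ∀ n, MemLp (fun x => φ n (x + Z x) - φ n x) 2 (volume.restrict Ω) := fun n =>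
    (memLp_comp_of_antilipschitz hanti hm hpre ((hφ n).memLp 2)).sub ((hφ n).memLp 2)
  have hvm : MemLp (fun x => v (x + Z x) - v x) 2 (volume.restrict Ω) :=
    (memLp_comp_of_antilipschitz hanti hm hpre hv.memLp).sub hv.memLp
  have t1 : Tendsto (fun n => eLpNorm ((fun x => φ n (x + Z x) - φ n x) -
      fun x => v (x + Z x) - v x) 2 (volume.restrict Ω)) atTop (𝓝 0) := by
    have t := (ENNReal.Tendsto.const_mul (a := κ) tv
      (Or.inr (coe_pow_rpow_ne_top _ d))).add tv
    rw [mul_zero, add_zero] at t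
    refine tendsto_of_tendsto_of_tendsto_of_le_of_le tendsto_const_nhds t (fun _ => zero_le)
      fun n => ?_
    have e : ((fun x => φ n (x + Z x) - φ n x) - fun x => v (x + Z x) - v x) =
        (fun x => φ n (x + Z x) - v (x + Z x)) - (φ n - v) := by
      ext x
      simp only [Pi.sub_apply]
      ring
    dsimp only
    rw [e]
    refine (eLpNorm_sub_le ?_ (((hφ n).memLp 2).1.sub hv.memLp.1) (by norm_num)).trans ?_
    · exact ((memLp_comp_of_antilipschitz hanti hm hpre ((hφ n).memLp 2)).sub
        (memLp_comp_of_antilipschitz hanti hm hpre hv.memLp)).1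
    · gcongr
      exact hcomp n
  refine le_of_tendsto_of_tendsto'
    (tendsto_lpNorm_of_tendsto_eLpNorm_sub (by norm_num) hφm hvm t1)
    (((tendsto_lpNorm_of_tendsto_eLpNorm_sub (by norm_num) (fun n => (hφ n).memLp_fderiv 2)
      hv.memLp_deriv tD).const_mul _).const_mul _) fun n => ?_
  have := (hφ n).eLpNorm_displacement_le hK hZ h0 hM
  rw [← toReal_eLpNorm (hφm n).1, ← toReal_eLpNorm ((hφ n).memLp_fderiv 2).1, ← hκ]
  have h2 := ENNReal.toReal_mono (ENNReal.mul_ne_top ENNReal.coe_ne_top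
    (ENNReal.mul_ne_top (coe_pow_rpow_ne_top _ d) ((hφ n).memLp_fderiv 2).eLpNorm_ne_top)) this
  rwa [ENNReal.toReal_mul, ENNReal.toReal_mul, ENNReal.coe_toReal] at h2

end Displacement

/-! ### Lipschitz bounds along segments for functions with bounded weak derivative -/

section SegmentLipschitz

variable {d : ℕ} {F : Type*} [NormedAddCommGroup F] [NormedSpace ℝ F] [CompleteSpace F]

local notation "𝔼[" d "]" => EuclideanSpace ℝ (Fin d)

variable {Ω : Set 𝔼[d]}

theorem fderiv_mollify_apply (β : ContDiffBump (0 : 𝔼[d])) {g : 𝔼[d] → F}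
    (hg : LocallyIntegrable g volume) (x w : 𝔼[d]) :
    fderiv ℝ (mollify β g) x w =
      ∫ z, fderiv ℝ (β.normed volume) (x - z) w • g z := by
  have h := (β.hasCompactSupport_normed (μ := volume)).hasFDerivAt_convolution_left
    (ContinuousLinearMap.lsmul ℝ ℝ) β.contDiff_normed hg x
  have hex := ((β.hasCompactSupport_normed (μ := volume)).fderiv ℝ).convolutionExists_left
    (ContinuousLinearMap.precompL 𝔼[d] (ContinuousLinearMap.lsmul ℝ ℝ))
    ((β.contDiff_normed (μ := volume) (n := 1)).continuous_fderiv (by simp)) hg x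
  have e : fderiv ℝ (mollify β g) x = _ := h.fderiv
  rw [e, convolution_def, ContinuousLinearMap.integral_apply hex]
  simp only [ContinuousLinearMap.precompL_apply, ContinuousLinearMap.lsmul_apply]
  have := integral_sub_left_eq_self (fun z => fderiv ℝ (β.normed volume) z w • g (x - z)) volume x
  rw [← this]
  simp

/-- A function on an open set with bounded weak derivative is Lipschitz along the segments that
stay in the set, up to a null set of end points. -/
theorem HasWeakFDeriv.exists_lipschitz_on_segments (hΩ : IsOpen Ω) {g : 𝔼[d] → F}
    {Dg : 𝔼[d] → 𝔼[d] →L[ℝ] F} (h : HasWeakFDeriv Ω g Dg)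
    (hg : LocallyIntegrable (Ω.indicator g) volume) {L : ℝ}
    (hL : ∀ᵐ x ∂(volume.restrict Ω), ‖Dg x‖ ≤ L) :
    ∃ G : Set 𝔼[d], (∀ᵐ x ∂(volume.restrict Ω), x ∈ G) ∧
      ∀ x ∈ G, ∀ y ∈ G, segment ℝ x y ⊆ Ω → ‖g y - g x‖ ≤ L * ‖y - x‖ := by
  obtain ⟨β, hβ0, hβ2, -⟩ := exists_contDiffBump_seq (d := d) one_pos
  -- The good set consists of the points where the mollifications recover `g`; it then suffices to
  -- bound the gradient of the mollifications on a segment inside `Ω`.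
  refine ⟨{x | x ∈ Ω ∧ Tendsto (fun n => mollify (β n) (Ω.indicator g) x) atTop (𝓝 (g x))}, ?_, ?_⟩
  · filter_upwards [ae_restrict_of_ae (tendsto_mollify_ae hg hβ0 hβ2),
      ae_restrict_mem hΩ.measurableSet] with x hx hxΩ
    rw [indicator_of_mem hxΩ] at hx
    exact ⟨hxΩ, hx⟩
  rintro x ⟨hxΩ, hx⟩ y ⟨hyΩ, hy⟩ hxy
  have hcomp : IsCompact (segment ℝ x y) := by
    rw [← convexHull_pair]
    exact (Set.toFinite {x, y}).isCompact_convexHull ℝ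
  obtain ⟨δ, hδ, hδΩ⟩ := hcomp.exists_cthickening_subset_open hΩ hxy
  refine le_of_tendsto (hy.sub hx).norm ?_
  filter_upwards [hβ0.eventually_lt_const hδ] with n hn
  refine (convex_segment (𝕜 := ℝ) x y).norm_image_sub_le_of_norm_fderiv_le (𝕜 := ℝ)
    (fun z _ => (contDiff_mollify (β n) hg).differentiable (by simp) z) (fun z hz => ?_)
    (left_mem_segment ℝ x y) (right_mem_segment ℝ x y)
  have hL0 : 0 ≤ L := by
    have hne : (ae (volume.restrict Ω)).NeBot := by
      rw [ae_neBot, Ne, Measure.restrict_eq_zero]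
      exact (hΩ.measure_pos volume ⟨x, hxΩ⟩).ne'
    obtain ⟨z, hz⟩ := hL.exists
    exact (norm_nonneg _).trans hz
  refine ContinuousLinearMap.opNorm_le_bound _ hL0 fun w => ?_
  set ρ := (β n).normed volume
  have hρs : ContDiff ℝ ∞ ρ := (β n).contDiff_normed
  -- The reflected kernel centred at `z` is a test function once its radius is below `δ`, so the
  -- gradient of the mollification at `z` is an average of `Dg`.
  set φ : 𝔼[d] → ℝ := fun y => ρ (z - y)
  have hφs : ContDiff ℝ ∞ φ := hρs.comp (contDiff_const.sub contDiff_id)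
  have hφt : tsupport φ ⊆ Metric.closedBall z (β n).rOut := by
    refine closure_minimal (fun y hy => ?_) Metric.isClosed_closedBall
    have : z - y ∈ Function.support ρ := hy
    rw [(β n).support_normed_eq] at this
    rw [Metric.mem_closedBall, dist_comm, dist_eq_norm]
    simpa using (mem_ball_zero_iff.1 this).le
  have hφ : IsTestFunction Ω φ := by
    refine ⟨hφs, (isCompact_closedBall z _).of_isClosed_subset (isClosed_tsupport _) hφt,
      hφt.trans (fun y hy => hδΩ ?_)⟩
    exact Metric.mem_cthickening_of_dist_le y z _ _ hz ((Metric.mem_closedBall.1 hy).trans hn.le)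
  have hφd : ∀ y, fderiv ℝ φ y w = -fderiv ℝ ρ (z - y) w := fun y => by
    have h1 : HasFDerivAt φ ((fderiv ℝ ρ (z - y)).comp (-ContinuousLinearMap.id ℝ 𝔼[d])) y :=
      (hρs.differentiable (by simp) _).hasFDerivAt.comp y ((hasFDerivAt_id y).const_sub z)
    rw [h1.fderiv]
    simp
  have e : fderiv ℝ (mollify (β n) (Ω.indicator g)) z w = ∫ y in Ω, φ y • Dg y w := by
    rw [fderiv_mollify_apply _ hg, ← neg_neg (∫ y in Ω, φ y • Dg y w), ← h.2.2 φ hφ w,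
      ← integral_indicator hΩ.measurableSet, ← integral_neg]
    refine integral_congr_ae (ae_of_all _ fun y => ?_)
    by_cases hy : y ∈ Ω
    · simp [hy, hφd, ρ]
    · simp [hy]
  rw [e]
  have hi : Integrable φ (volume.restrict Ω) :=
    (hφs.continuous.integrable_of_hasCompactSupport hφ.2.1).restrict
  refine (norm_integral_le_of_norm_le (hi.mul_const (L * ‖w‖)) ?_).trans_eq ?_
  · filter_upwards [hL] with y hy
    rw [norm_smul, Real.norm_of_nonneg ((β n).nonneg_normed _)]
    exact mul_le_mul_of_nonneg_left ((Dg y).le_of_opNorm_le hy w) ((β n).nonneg_normed _)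
  · rw [integral_mul_const, setIntegral_eq_integral_of_tsupport
      ((subset_tsupport φ).trans hφ.2.2), integral_sub_left_eq_self ρ volume z,
      (β n).integral_normed, one_mul]

end SegmentLipschitz

/-! ### Gluing Lipschitz pieces -/

section PiecewiseLipschitz

/-- A function that is Lipschitz on each set of a finite closed cover of a normed space is
Lipschitz. -/
theorem lipschitzWith_of_finite_closed_cover {E F ι : Type*} [NormedAddCommGroup E]
    [NormedSpace ℝ E] [PseudoMetricSpace F] [Finite ι] {f : E → F} {s : ι → Set E} {m : NNReal}
    (hs : ∀ i, IsClosed (s i)) (hcov : ⋃ i, s i = univ) (hf : ∀ i, LipschitzOnWith m f (s i)) :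
    LipschitzWith m f := by
  have hfc : Continuous f := (locallyFinite_of_finite s).continuous hcov hs
    fun i => (hf i).continuousOn
  refine LipschitzWith.of_dist_le_mul fun x y => ?_
  set γ : ℝ → E := fun r => x + r • (y - x)
  have hγ : Continuous γ := by fun_prop
  have hγd : ∀ r r', dist (γ r) (γ r') = |r - r'| * dist x y := by
    intro r r'
    rw [dist_eq_norm, add_sub_add_left_eq_sub, ← sub_smul, norm_smul, dist_comm x y, dist_eq_norm y,
      Real.norm_eq_abs]
  set S : Set ℝ := {r | dist (f (γ 0)) (f (γ r)) ≤ r * (m * dist x y)}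
  have hSc : IsClosed S := isClosed_le (continuous_const.dist (hfc.comp hγ)) (by fun_prop)
  have hsub : Icc (0 : ℝ) 1 ⊆ S := by
    -- Continuous induction along the segment. One of the finitely many pieces is met at parameters
    -- accumulating at `r` from the right; being closed it also contains `γ r`, so its Lipschitz
    -- bound extends the estimate beyond `r`.
    refine IsClosed.Icc_subset_of_forall_exists_gt (hSc.inter isClosed_Icc) (by simp [S]) ?_
    rintro r ⟨hr, hr0, -⟩ z hz
    have hex : ∃ i, ∃ᶠ r' in 𝓝[>] r, γ r' ∈ s i := by
      by_contra! hno
      have hall : ∀ᶠ r' in 𝓝[>] r, ∀ i, γ r' ∉ s i :=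
        eventually_all.2 hno
      obtain ⟨r', hr'⟩ := hall.exists
      have : γ r' ∈ ⋃ i, s i := hcov ▸ mem_univ _
      obtain ⟨i, hi⟩ := mem_iUnion.1 this
      exact hr' i hi
    obtain ⟨i, hi⟩ := hex
    have hri : γ r ∈ s i := by
      have := mem_closure_of_frequently_of_tendsto hi (hγ.continuousWithinAt (s := Ioi r) (x := r))
      rwa [(hs i).closure_eq] at this
    obtain ⟨r', hr'i, hr'⟩ := (hi.and_eventually (Ioc_mem_nhdsGT hz)).exists
    refine ⟨r', ?_, hr'⟩
    have h1 := (hf i).dist_le_mul _ hri _ hr'i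
    rw [hγd, abs_sub_comm, abs_of_pos (sub_pos.2 hr'.1)] at h1
    have h2 : dist (f (γ 0)) (f (γ r)) ≤ r * (m * dist x y) := hr
    show dist (f (γ 0)) (f (γ r')) ≤ r' * (m * dist x y)
    have h3 := dist_triangle (f (γ 0)) (f (γ r)) (f (γ r'))
    linarith
  have h1 : dist (f (γ 0)) (f (γ 1)) ≤ 1 * (m * dist x y) := hsub ⟨zero_le_one, le_rfl⟩
  simpa [γ] using h1

end PiecewiseLipschitz

/-! ### Geometry of a single simplex -/

section Element

variable {d : ℕ}

local notation "𝔼[" d "]" => EuclideanSpace ℝ (Fin d)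

variable {K : Finset 𝔼[d]}

theorem minHeight_le_height {p : 𝔼[d]} (hp : p ∈ K) : minHeight K ≤ height K p :=
  ciInf_le (f := fun p : K => height K p) (Set.finite_range _).bddBelow ⟨p, hp⟩

theorem notMem_affineSpan_of_minHeight_pos (h : 0 < minHeight K) {p : 𝔼[d]} (hp : p ∈ K) :
    p ∉ affineSpan ℝ ((K : Set 𝔼[d]) \ {p}) := by
  intro hmem
  have h1 : height K p = 0 := Metric.infDist_zero_of_mem hmem
  have := minHeight_le_height hp
  linarith

/-- An affine dependence with a nonzero weight at `p` can be solved for `p`, which would put `p` in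
the hyperplane of the opposite facet and make its height zero. -/
theorem affineIndependent_of_minHeight_pos (h : 0 < minHeight K) :
    AffineIndependent ℝ ((↑) : K → 𝔼[d]) := by
  classical
  rw [affineIndependent_iff]
  intro s w hw hsum
  by_contra! hne
  obtain ⟨p, hps, hp⟩ := hne
  refine notMem_affineSpan_of_minHeight_pos h p.2 ?_
  have h1 : ∑ q ∈ s.erase p, (-(w p)⁻¹ * w q) = 1 := by
    rw [← Finset.mul_sum]
    rw [← Finset.add_sum_erase s w hps] at hw
    rw [eq_neg_of_add_eq_zero_right hw]
    field_simp
  have h2 : ∑ q ∈ s.erase p, (-(w p)⁻¹ * w q) • (q : 𝔼[d]) = p := by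
    simp only [mul_smul]
    rw [← Finset.smul_sum]
    rw [← Finset.add_sum_erase s _ hps] at hsum
    rw [eq_neg_of_add_eq_zero_right hsum, smul_neg, neg_smul, neg_neg, smul_smul,
      inv_mul_cancel₀ hp, one_smul]
  have h3 := affineCombination_mem_affineSpan_image (k := ℝ) h1 (s' := {q : K | q ≠ p})
    (fun q hq hq' => absurd (Finset.ne_of_mem_erase hq) hq') ((↑) : K → 𝔼[d])
  rw [Finset.affineCombination_eq_linear_combination _ _ _ h1, h2] at h3
  refine affineSpan_mono ℝ ?_ h3
  rintro _ ⟨q, hq, rfl⟩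
  exact ⟨q.2, fun h => hq (Subtype.ext h)⟩

/-- The vertices of a nondegenerate element, as an affine basis. -/
theorem exists_affineBasis_element (hK : K.card = d + 1) (h : 0 < minHeight K) :
    ∃ B : AffineBasis K ℝ 𝔼[d], ∀ p, B p = p := by
  have hi := affineIndependent_of_minHeight_pos h
  refine ⟨⟨(↑), hi, ?_⟩, fun p => rfl⟩
  rw [hi.affineSpan_eq_top_iff_card_eq_finrank_add_one]
  simp [hK]

theorem coord_linear_apply (B : AffineBasis K ℝ 𝔼[d]) (p : K) (x v : 𝔼[d]) :
    (B.coord p).linear v = B.coord p (x + v) - B.coord p x := by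
  have := (B.coord p).map_vadd x v
  simp only [vadd_eq_add] at this
  rw [add_comm x v, this]
  simp

theorem mem_affineSpan_of_coord_eq_zero {B : AffineBasis K ℝ 𝔼[d]} (hB : ∀ p, B p = p) {p : K}
    {x : 𝔼[d]} (hx : B.coord p x = 0) : x ∈ affineSpan ℝ ((K : Set 𝔼[d]) \ {(p : 𝔼[d])}) := by
  classical
  have h3 := affineCombination_mem_affineSpan_image (k := ℝ) (B.sum_coord_apply_eq_one x)
    (s' := {q : K | q ≠ p}) (fun q _ hq' => by
      have : q = p := by simpa using hq'
      rw [this, hx]) B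
  rw [B.affineCombination_coord_eq_self] at h3
  refine affineSpan_mono ℝ ?_ h3
  rintro _ ⟨q, hq, rfl⟩
  rw [hB]
  exact ⟨q.2, fun h => hq (Subtype.ext h)⟩

/-- If the coordinate of `p` changes by `c` along `v`, the step `-v / c` from `p` reaches the
opposite hyperplane. Its length `‖v‖ / |c|` is therefore at least the height. -/
theorem abs_coord_linear_le (h : 0 < minHeight K) {B : AffineBasis K ℝ 𝔼[d]} (hB : ∀ p, B p = p)
    (p : K) (v : 𝔼[d]) : |(B.coord p).linear v| ≤ ‖v‖ / minHeight K := by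
  set c := (B.coord p).linear v
  rcases eq_or_ne c 0 with hc | hc
  · rw [hc, abs_zero]
    positivity
  have hx : B.coord p ((p : 𝔼[d]) - c⁻¹ • v) = 0 := by
    have h1 := coord_linear_apply B p p (-(c⁻¹ • v))
    rw [map_neg, map_smul, smul_eq_mul, inv_mul_cancel₀ hc, ← sub_eq_add_neg] at h1
    have h2 : B.coord p p = 1 := by
      conv_lhs => rw [← hB p]
      exact B.coord_apply_eq p
    linarith
  have hle : height K p ≤ dist (p : 𝔼[d]) (p - c⁻¹ • v) :=
    Metric.infDist_le_dist_of_mem (mem_affineSpan_of_coord_eq_zero hB hx)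
  rw [dist_eq_norm, sub_sub_cancel, norm_smul, norm_inv, Real.norm_eq_abs] at hle
  have h2 := (minHeight_le_height p.2).trans hle
  rw [le_div_iff₀ h]
  rw [inv_mul_eq_div, le_div_iff₀ (abs_pos.2 hc)] at h2
  linarith

/-- The affine interpolant of a nodal velocity on an element, with bounds for its gradient. -/
theorem exists_affine_interpolant (hK : K.card = d + 1) (h : 0 < minHeight K)
    (V : 𝔼[d] → 𝔼[d]) {δ : ℝ} (hV : ∀ p ∈ K, ∀ q ∈ K, ‖V p - V q‖ ≤ δ) :
    ∃ A : 𝔼[d] →ᵃ[ℝ] 𝔼[d], (∀ p ∈ K, A p = V p) ∧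
      (∀ v, ‖A.linear v‖ ≤ d * (δ / minHeight K) * ‖v‖) ∧
      |LinearMap.trace ℝ 𝔼[d] A.linear| ≤ d * (δ / minHeight K) := by
  classical
  obtain ⟨B, hB⟩ := exists_affineBasis_element hK h
  have hne : K.Nonempty := Finset.card_pos.1 (by omega)
  obtain ⟨p₀, hp₀⟩ := hne
  set P : K := ⟨p₀, hp₀⟩
  -- The linear parts of the coordinates sum to zero, so only differences to the value at `p₀`
  -- enter. This leaves `d` summands instead of `d + 1`, whence the factor `d`.
  set M : 𝔼[d] →ₗ[ℝ] 𝔼[d] := ∑ p ∈ Finset.univ.erase P, (B.coord p).linear.smulRight (V p - V p₀)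
  have hcard : (Finset.univ.erase P).card = d := by
    rw [Finset.card_erase_of_mem (Finset.mem_univ _)]
    simp [hK]
  have hδ : 0 ≤ δ := (norm_nonneg _).trans (hV p₀ hp₀ p₀ hp₀)
  have hMv : ∀ v, M v = ∑ p ∈ Finset.univ.erase P, (B.coord p).linear v • (V p - V p₀) := fun v => by
    simp only [M, LinearMap.sum_apply, LinearMap.smulRight_apply]
  refine ⟨⟨fun x => V p₀ + M (x - p₀), M, fun x v => ?_⟩, fun p hp => ?_, fun v => ?_, ?_⟩
  · simp only [vadd_eq_add]
    rw [add_sub_assoc, map_add]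
    abel
  · show V p₀ + M (p - p₀) = V p
    rw [hMv]
    have hc : ∀ q ∈ Finset.univ.erase P, (B.coord q).linear (p - p₀) • (V q - V p₀) =
        if q = ⟨p, hp⟩ then V p - V p₀ else 0 := by
      intro q hq
      rw [coord_linear_apply B q p₀, add_sub_cancel]
      have e1 : B.coord q p₀ = 0 := by
        have := B.coord_apply_ne (Finset.ne_of_mem_erase hq)
        rwa [hB] at this
      have e2 := B.coord_apply q ⟨p, hp⟩
      rw [hB] at e2
      rw [e1, e2, sub_zero]
      split_ifs with hqp
      · subst hqp
        simp
      · simp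
    rw [Finset.sum_congr rfl hc, Finset.sum_ite_eq']
    split_ifs with hmem
    · abel
    · have : (⟨p, hp⟩ : K) = P := by simpa using hmem
      have : p = p₀ := congrArg Subtype.val this
      simp [this]
  · show ‖M v‖ ≤ _
    rw [hMv]
    refine (norm_sum_le_of_le _ (f := _) (n := fun _ => ‖v‖ / minHeight K * δ) fun q _ => ?_).trans ?_
    · rw [norm_smul]
      exact mul_le_mul (abs_coord_linear_le h hB q v) (hV _ q.2 _ hp₀) (norm_nonneg _)
        (by positivity)
    · rw [Finset.sum_const, hcard, nsmul_eq_mul]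
      apply le_of_eq
      ring
  · show |LinearMap.trace ℝ 𝔼[d] M| ≤ _
    -- Each summand has rank one, with trace the functional evaluated at its vector. The trace thus
    -- obeys the same bound as the norm, with no further factor `d`.
    simp only [M, map_sum, LinearMap.trace_smulRight]
    rw [← Real.norm_eq_abs]
    refine (norm_sum_le_of_le _ (f := _) (n := fun _ => δ / minHeight K) fun q _ => ?_).trans ?_
    · exact (abs_coord_linear_le h hB q _).trans
        (div_le_div_of_nonneg_right (hV _ q.2 _ hp₀) h.le)
    · rw [Finset.sum_const, hcard, nsmul_eq_mul]

theorem isCompact_element (K : Finset 𝔼[d]) : IsCompact (element K) :=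
  K.finite_toSet.isCompact_convexHull ℝ

theorem convex_element (K : Finset 𝔼[d]) : Convex ℝ (element K) := convex_convexHull ℝ _

theorem interior_element_nonempty (hK : K.card = d + 1) (h : 0 < minHeight K) :
    (interior (element K)).Nonempty := by
  obtain ⟨B, hB⟩ := exists_affineBasis_element hK h
  refine interior_convexHull_nonempty_iff_affineSpan_eq_top.2 ?_
  have := B.tot
  have e : range B = (K : Set 𝔼[d]) := by
    ext x
    simp [hB]
  rwa [e] at this

theorem notMem_convexHull_of_mem_interior (hK : K.card = d + 1) (h : 0 < minHeight K)
    {x p : 𝔼[d]} (hp : p ∈ K) (hx : x ∈ interior (element K)) :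
    x ∉ convexHull ℝ ((K : Set 𝔼[d]) \ {p}) := by
  obtain ⟨B, hB⟩ := exists_affineBasis_element hK h
  have e : range B = (K : Set 𝔼[d]) := by
    ext x
    simp [hB]
  rw [element, ← e, B.interior_convexHull] at hx
  intro hx'
  have h0 : ∀ q ∈ (K : Set 𝔼[d]) \ {p}, B.coord ⟨p, hp⟩ q = 0 := by
    rintro q ⟨hq, hqp⟩
    have := B.coord_apply_ne (i := ⟨p, hp⟩) (j := ⟨q, hq⟩)
      fun h => hqp (congrArg Subtype.val h).symm
    rwa [hB] at this
  have hconv : Convex ℝ {y | B.coord ⟨p, hp⟩ y = 0} := by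
    have := (convex_singleton (𝕜 := ℝ) (0 : ℝ)).affine_preimage (B.coord ⟨p, hp⟩)
    exact this
  have := convexHull_min (s := (K : Set 𝔼[d]) \ {p}) h0 hconv hx'
  exact (hx ⟨p, hp⟩).ne' this

theorem eqOn_convexHull_of_affineMap {E F : Type*} [AddCommGroup E] [Module ℝ E] [AddCommGroup F]
    [Module ℝ F] {A B : E →ᵃ[ℝ] F} {s : Set E} (h : ∀ p ∈ s, A p = B p) :
    ∀ x ∈ convexHull ℝ s, A x = B x := by
  have hconv : Convex ℝ {y | A y = B y} := by
    have := (convex_singleton (𝕜 := ℝ) (0 : F)).affine_preimage (A - B)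
    have e : {y | A y = B y} = (A - B) ⁻¹' {0} := by
      ext y
      simp [sub_eq_zero]
    rwa [e]
  exact fun x hx => convexHull_min (s := s) h hconv hx

end Element

/-! ### The piecewise affine mesh velocity -/

section Velocity

variable {d : ℕ}

local notation "𝔼[" d "]" => EuclideanSpace ℝ (Fin d)

variable {Ω : Set 𝔼[d]} {T : Finset (Finset 𝔼[d])}

theorem IsSimplicialMesh.element_subset (hT : IsSimplicialMesh Ω T) {K : Finset 𝔼[d]} (hK : K ∈ T) :
    element K ⊆ closure Ω := by
  rw [← hT.cover]
  exact subset_biUnion_of_mem (u := fun K => element K) hK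

theorem IsSimplicialMesh.exists_mem_element (hT : IsSimplicialMesh Ω T) {x : 𝔼[d]}
    (hx : x ∈ closure Ω) : ∃ K ∈ T, x ∈ element K := by
  rw [← hT.cover] at hx
  simpa using hx

theorem IsSimplicialMesh.isBounded (hT : IsSimplicialMesh Ω T) : Bornology.IsBounded Ω := by
  have : IsCompact (closure Ω) := by
    rw [← hT.cover]
    exact T.isCompact_biUnion fun K _ => isCompact_element K
  exact this.isBounded.subset subset_closure

/-- A boundary point lies on a facet of some element `L`. If `L = K` it is on a facet of `K`;
otherwise conformity puts it in the hull of the common vertices, which misses a vertex of `K`.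
Neither is possible in the interior of `K`. -/
theorem IsSimplicialMesh.interior_element_subset (hT : IsSimplicialMesh Ω T)
    (hheight : ∀ K ∈ T, 0 < minHeight K) (hΩ : IsOpen Ω) {K : Finset 𝔼[d]} (hK : K ∈ T) :
    interior (element K) ⊆ Ω := by
  intro x hx
  by_contra hxΩ
  have hxf : x ∈ frontier Ω := by
    rw [hΩ.frontier_eq]
    exact ⟨hT.element_subset hK (interior_subset hx), hxΩ⟩
  obtain ⟨Bd, hBd, hfr⟩ := hT.boundary
  rw [hfr] at hxf
  simp only [mem_iUnion] at hxf
  obtain ⟨S, hS, hxS⟩ := hxf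
  obtain ⟨L, hL, p, hp, rfl⟩ := hBd S hS
  by_cases hLK : L = K
  · subst hLK
    exact notMem_convexHull_of_mem_interior (hT.card_eq _ hK) (hheight _ hK) hp hx hxS
  · have hxL : x ∈ element L := convexHull_mono sdiff_subset hxS
    have hxKL : x ∈ convexHull ℝ ((K : Set 𝔼[d]) ∩ L) := by
      rw [← hT.conforming K hK L hL]
      exact ⟨interior_subset hx, hxL⟩
    have hex : ∃ q ∈ K, q ∉ L := by
      by_contra! hall
      exact hLK (Finset.eq_of_subset_of_card_le hall
        (by rw [hT.card_eq K hK, hT.card_eq L hL])).symm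
    obtain ⟨q, hqK, hqL⟩ := hex
    refine notMem_convexHull_of_mem_interior (hT.card_eq _ hK) (hheight _ hK) hqK hx
      (convexHull_mono ?_ hxKL)
    rintro y ⟨hyK, hyL⟩
    exact ⟨hyK, fun h => hqL (h ▸ hyL)⟩

/-- The continuous functions `max ‖g‖ L` and `L` agree almost everywhere on an open set, hence
everywhere on it. -/
theorem norm_le_of_ae_of_continuousOn {F : Type*} [NormedAddCommGroup F] (hΩ : IsOpen Ω)
    {g : 𝔼[d] → F} (hg : ContinuousOn g Ω) {L : ℝ}
    (h : ∀ᵐ x ∂(volume.restrict Ω), ‖g x‖ ≤ L) : ∀ x ∈ Ω, ‖g x‖ ≤ L := by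
  have h1 : (fun x => max ‖g x‖ L) =ᵐ[volume.restrict Ω] fun _ => L := by
    filter_upwards [h] with x hx
    exact max_eq_right hx
  intro x hx
  have := Measure.eqOn_open_of_ae_eq h1 hΩ (hg.norm.sup continuousOn_const) continuousOn_const hx
  exact max_eq_right_iff.1 this

variable {X : 𝔼[d] → 𝔼[d]}

theorem norm_le_lpNorm_top_of_mem_closure (hΩ : IsOpen Ω) (hXc : ContinuousOn X (closure Ω))
    (hX : MemLp X ⊤ (volume.restrict Ω)) {x : 𝔼[d]} (hx : x ∈ closure Ω) :
    ‖X x‖ ≤ lpNorm X ⊤ (volume.restrict Ω) := by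
  have h1 := norm_le_of_ae_of_continuousOn hΩ (hXc.mono subset_closure)
    (ae_le_lpNorm_exponent_top hX)
  have := hXc.image_closure.trans (closure_minimal (t := Metric.closedBall 0
    (lpNorm X ⊤ (volume.restrict Ω))) ?_ Metric.isClosed_closedBall) (mem_image_of_mem X hx)
  · simpa using this
  · rintro _ ⟨y, hy, rfl⟩
    simpa using h1 y hy

/-- `Ω` need not be convex, but the interior of an element is convex and contained in `Ω`. The mean
value inequality holds there and extends to the vertices by continuity of `X` up to the boundary. -/
theorem IsSimplicialMesh.norm_sub_le (hT : IsSimplicialMesh Ω T)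
    (hheight : ∀ K ∈ T, 0 < minHeight K) (hΩ : IsOpen Ω)
    (hXc : ContinuousOn X (closure Ω)) (hXd : ContDiffOn ℝ 1 X Ω)
    (hDX : MemLp (fderiv ℝ X) ⊤ (volume.restrict Ω)) {K : Finset 𝔼[d]} (hK : K ∈ T) {p q : 𝔼[d]}
    (hp : p ∈ K) (hq : q ∈ K) :
    ‖X p - X q‖ ≤ lpNorm (fderiv ℝ X) ⊤ (volume.restrict Ω) * diameter K := by
  set L := lpNorm (fderiv ℝ X) ⊤ (volume.restrict Ω)
  have hL0 : 0 ≤ L := lpNorm_nonneg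
  have hb : ∀ x ∈ Ω, ‖fderiv ℝ X x‖ ≤ L := norm_le_of_ae_of_continuousOn hΩ
    (hXd.continuousOn_fderiv_of_isOpen hΩ le_rfl) (ae_le_lpNorm_exponent_top hDX)
  have hint := hT.interior_element_subset hheight hΩ hK
  have hlip : LipschitzOnWith L.toNNReal X (interior (element K)) := by
    refine (convex_element K).interior.lipschitzOnWith_of_nnnorm_fderiv_le (𝕜 := ℝ)
      (fun x hx => ?_) fun x hx => ?_
    · exact (hXd.contDiffAt (hΩ.mem_nhds (hint hx))).differentiableAt (by simp)
    · rw [← NNReal.coe_le_coe, Real.coe_toNNReal _ hL0]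
      exact hb x (hint hx)
  have hcl : closure (interior (element K)) = element K := by
    rw [(convex_element K).closure_interior_eq_closure_of_nonempty_interior
      (interior_element_nonempty (hT.card_eq K hK) (hheight K hK)),
      (isCompact_element K).isClosed.closure_eq]
  have hlip' := LipschitzOnWith.closure
    ((hXc.mono (hT.element_subset hK)).mono hcl.subset) hlip
  rw [hcl] at hlip'
  have h1 := hlip'.dist_le_mul p (subset_convexHull ℝ _ hp) q (subset_convexHull ℝ _ hq)
  rw [Real.coe_toNNReal _ hL0, dist_eq_norm] at h1
  refine h1.trans (mul_le_mul_of_nonneg_left ?_ hL0)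
  exact Metric.dist_le_diam_of_mem K.finite_toSet.isBounded hp hq

theorem aspect_le_maxAspect {K : Finset 𝔼[d]} (hK : K ∈ T) :
    diameter K / minHeight K ≤ maxAspect T :=
  le_ciSup (f := fun K : T => diameter K.1 / minHeight K.1) (Set.finite_range _).bddAbove ⟨K, hK⟩

/-- `Y` is the piecewise affine interpolant of the nodal velocity `X`, extended by zero; it agrees
with the affine map `A K` on the element `K`. Its gradient is controlled by `m` and its size by
`M`. -/
structure IsMeshVelocity (Ω : Set (EuclideanSpace ℝ (Fin d)))
    (T : Finset (Finset (EuclideanSpace ℝ (Fin d))))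
    (X Y : EuclideanSpace ℝ (Fin d) → EuclideanSpace ℝ (Fin d))
    (A : Finset (EuclideanSpace ℝ (Fin d)) →
      EuclideanSpace ℝ (Fin d) →ᵃ[ℝ] EuclideanSpace ℝ (Fin d)) (m M : NNReal) : Prop where
  nodal : ∀ K ∈ T, ∀ p ∈ K, A K p = X p
  eq_on : ∀ K ∈ T, ∀ x ∈ element K, Y x = A K x
  zero : ∀ x ∉ Ω, Y x = 0
  lipschitz : LipschitzWith m Y
  nnnorm_le : ∀ x, ‖Y x‖₊ ≤ M
  norm_linear_le : ∀ K ∈ T, ∀ v, ‖(A K).linear v‖ ≤ m * ‖v‖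
  trace_le : ∀ K ∈ T, |LinearMap.trace ℝ (EuclideanSpace ℝ (Fin d)) (A K).linear| ≤ m
  ae_hasFDerivAt : ∀ᵐ x ∂(volume.restrict Ω), ∃ K ∈ T,
    HasFDerivAt Y (LinearMap.toContinuousLinearMap (A K).linear) x

/-- Conformity makes the elementwise interpolants agree on intersections. On a boundary facet all
nodal values vanish, so extension by zero is consistent, and the closed cover by the elements and
the complement of `Ω` gives a global Lipschitz bound. Frontiers of convex sets are null, so `Y` is
affine near almost every point of `Ω`. -/
theorem IsSimplicialMesh.exists_isMeshVelocity (hT : IsSimplicialMesh Ω T)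
    (hheight : ∀ K ∈ T, 0 < minHeight K) (hΩ : IsOpen Ω)
    (hXc : ContinuousOn X (closure Ω)) (hXd : ContDiffOn ℝ 1 X Ω)
    (hX : MemLp X ⊤ (volume.restrict Ω)) (hDX : MemLp (fderiv ℝ X) ⊤ (volume.restrict Ω))
    (hXb : ∀ K ∈ T, ∀ p ∈ K, p ∈ frontier Ω → X p = 0) :
    ∃ Y A, IsMeshVelocity Ω T X Y A
      (d * (lpNorm (fderiv ℝ X) ⊤ (volume.restrict Ω) * maxAspect T)).toNNReal
      (lpNorm X ⊤ (volume.restrict Ω)).toNNReal := by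
  classical
  set L := lpNorm (fderiv ℝ X) ⊤ (volume.restrict Ω)
  set m := d * (L * maxAspect T)
  have hL0 : 0 ≤ L := lpNorm_nonneg
  have hma : 0 ≤ maxAspect T := Real.iSup_nonneg fun K =>
    div_nonneg Metric.diam_nonneg (hheight K.1 K.2).le
  have hm0 : 0 ≤ m := by positivity
  have hexA : ∀ K : Finset 𝔼[d], ∃ A : 𝔼[d] →ᵃ[ℝ] 𝔼[d], K ∈ T → (∀ p ∈ K, A p = X p) ∧
      (∀ v, ‖A.linear v‖ ≤ m * ‖v‖) ∧ |LinearMap.trace ℝ 𝔼[d] A.linear| ≤ m := by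
    intro K
    by_cases hK : K ∈ T
    · obtain ⟨A, h1, h2, h3⟩ := exists_affine_interpolant (hT.card_eq K hK) (hheight K hK) X
        (fun p hp q hq => hT.norm_sub_le hheight hΩ hXc hXd hDX hK hp hq)
      have hle : d * (L * diameter K / minHeight K) ≤ m := by
        rw [mul_div_assoc]
        exact mul_le_mul_of_nonneg_left (mul_le_mul_of_nonneg_left (aspect_le_maxAspect hK) hL0)
          (Nat.cast_nonneg d)
      exact ⟨A, fun _ => ⟨h1, fun v => (h2 v).trans (by gcongr), h3.trans hle⟩⟩
    · exact ⟨0, fun h => absurd h hK⟩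
  choose A hA using hexA
  set Y : 𝔼[d] → 𝔼[d] := fun x => if h : ∃ K ∈ T, x ∈ element K then A h.choose x else 0 with hYdef
  have hYeq : ∀ K ∈ T, ∀ x ∈ element K, Y x = A K x := by
    intro K hK x hx
    have h : ∃ K ∈ T, x ∈ element K := ⟨K, hK, hx⟩
    obtain ⟨hK', hx'⟩ := h.choose_spec
    rw [hYdef]
    simp only [dif_pos h]
    have hmem : x ∈ convexHull ℝ ((h.choose : Set 𝔼[d]) ∩ K) := by
      rw [← hT.conforming _ hK' K hK]
      exact ⟨hx', hx⟩
    exact eqOn_convexHull_of_affineMap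
      (fun p hp => by rw [(hA _ hK').1 p hp.1, (hA K hK).1 p hp.2]) x hmem
  have hY0 : ∀ x ∉ Ω, Y x = 0 := by
    intro x hx
    by_cases hxc : x ∈ closure Ω
    · have hxf : x ∈ frontier Ω := by
        rw [hΩ.frontier_eq]
        exact ⟨hxc, hx⟩
      obtain ⟨Bd, hBd, hfr⟩ := hT.boundary
      have hxf' := hxf
      rw [hfr] at hxf'
      simp only [mem_iUnion] at hxf'
      obtain ⟨S, hS, hxS⟩ := hxf'
      obtain ⟨K, hK, p, hp, rfl⟩ := hBd S hS
      have hxK : x ∈ element K := convexHull_mono sdiff_subset hxS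
      rw [hYeq K hK x hxK]
      refine eqOn_convexHull_of_affineMap (B := 0) (fun q hq => ?_) x hxS
      rw [(hA K hK).1 q hq.1]
      refine hXb K hK q hq.1 ?_
      rw [hfr]
      exact mem_iUnion₂.2 ⟨_, hS, subset_convexHull ℝ _ hq⟩
    · have h : ¬∃ K ∈ T, x ∈ element K := fun ⟨K, hK, hxK⟩ => hxc (hT.element_subset hK hxK)
      simp only [hYdef, dif_neg h]
  refine ⟨Y, A, ⟨fun K hK => (hA K hK).1, hYeq, hY0, ?_, fun x => ?_, fun K hK v => ?_,
    fun K hK => ?_, ?_⟩⟩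
  · refine lipschitzWith_of_finite_closed_cover (ι := Option T)
      (s := fun o => o.elim Ωᶜ fun K => element K.1) ?_ ?_ ?_
    · rintro (_ | K)
      · exact hΩ.isClosed_compl
      · exact (isCompact_element K.1).isClosed
    · refine eq_univ_of_forall fun x => ?_
      by_cases hx : x ∈ Ω
      · obtain ⟨K, hK, hxK⟩ := hT.exists_mem_element (subset_closure hx)
        exact mem_iUnion.2 ⟨some ⟨K, hK⟩, hxK⟩
      · exact mem_iUnion.2 ⟨none, hx⟩
    · rintro (_ | K)
      · refine LipschitzOnWith.of_dist_le_mul fun x hx y hy => ?_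
        rw [hY0 x hx, hY0 y hy, dist_self]
        positivity
      · refine LipschitzOnWith.of_dist_le_mul fun x hx y hy => ?_
        rw [hYeq K.1 K.2 x hx, hYeq K.1 K.2 y hy, dist_eq_norm, dist_eq_norm,
          Real.coe_toNNReal _ hm0]
        have h1 := (hA K.1 K.2).2.1 (x - y)
        have h2 := (A K.1).linearMap_vsub x y
        simp only [vsub_eq_sub] at h2
        rwa [h2] at h1
  · rw [← NNReal.coe_le_coe, Real.coe_toNNReal _ lpNorm_nonneg, coe_nnnorm]
    by_cases hx : x ∈ Ω
    · obtain ⟨K, hK, hxK⟩ := hT.exists_mem_element (subset_closure hx)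
      rw [hYeq K hK x hxK, ← mem_closedBall_zero_iff]
      have hconv := (convex_closedBall (0 : 𝔼[d]) (lpNorm X ⊤ (volume.restrict Ω))).affine_preimage
        (A K)
      refine convexHull_min (s := (K : Set 𝔼[d])) (fun p hp => ?_) hconv hxK
      rw [mem_preimage, (hA K hK).1 p hp, mem_closedBall_zero_iff]
      exact norm_le_lpNorm_top_of_mem_closure hΩ hXc hX
        (hT.element_subset hK (subset_convexHull ℝ _ hp))
    · rw [hY0 x hx, norm_zero]
      exact lpNorm_nonneg
  · rw [Real.coe_toNNReal _ hm0]
    exact (hA K hK).2.1 v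
  · rw [Real.coe_toNNReal _ hm0]
    exact (hA K hK).2.2
  · have hnull : ∀ᵐ x : 𝔼[d], ∀ K : T, x ∉ frontier (element K.1) := by
      rw [ae_all_iff]
      intro K
      exact measure_eq_zero_iff_ae_notMem.1 ((convex_element K.1).addHaar_frontier volume)
    filter_upwards [ae_restrict_of_ae hnull, ae_restrict_mem hΩ.measurableSet] with x hx hxΩ
    obtain ⟨K, hK, hxK⟩ := hT.exists_mem_element (subset_closure hxΩ)
    refine ⟨K, hK, ?_⟩
    have hxi : x ∈ interior (element K) := by
      by_contra h
      exact hx ⟨K, hK⟩ ⟨subset_closure hxK, h⟩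
    have h1 : HasFDerivAt (A K) (LinearMap.toContinuousLinearMap (A K).linear) x := by
      have e : ⇑(A K) = fun y => (LinearMap.toContinuousLinearMap (A K).linear) y + A K 0 := by
        ext1 y
        have := congrFun (A K).decomp y
        simpa using this
      rw [e]
      exact (ContinuousLinearMap.hasFDerivAt _).add_const _
    refine h1.congr_of_eventuallyEq ?_
    filter_upwards [isOpen_interior.mem_nhds hxi] with y hy
    exact hYeq K hK y (interior_subset hy)

end Velocity

/-! ### Polynomials under affine substitution -/

section Polynomial

variable {d : ℕ}

local notation "𝔼[" d "]" => EuclideanSpace ℝ (Fin d)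

theorem totalDegree_aeval_le {σ τ : Type*} {g : σ → MvPolynomial τ ℝ}
    (hg : ∀ i, (g i).totalDegree ≤ 1) (P : MvPolynomial σ ℝ) :
    (MvPolynomial.aeval g P).totalDegree ≤ P.totalDegree := by
  rw [MvPolynomial.aeval_def, MvPolynomial.eval₂_eq]
  refine MvPolynomial.totalDegree_finsetSum_le fun s hs => ?_
  refine (MvPolynomial.totalDegree_mul _ _).trans ?_
  have h1 : (algebraMap ℝ (MvPolynomial τ ℝ) (P.coeff s)).totalDegree = 0 :=
    MvPolynomial.totalDegree_C _
  rw [h1, zero_add]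
  refine (MvPolynomial.totalDegree_finsetProd _ _).trans ?_
  refine le_trans (Finset.sum_le_sum fun i _ => ?_) (MvPolynomial.le_totalDegree hs)
  refine (MvPolynomial.totalDegree_pow _ _).trans ?_
  exact (Nat.mul_le_mul_left _ (hg i)).trans (by simp)

/-- The pull-back of a polynomial under an affine map is a polynomial of no larger degree. -/
theorem exists_polynomial_comp_affineMap (G : 𝔼[d] →ᵃ[ℝ] 𝔼[d]) (P : MvPolynomial (Fin d) ℝ) :
    ∃ Q : MvPolynomial (Fin d) ℝ, Q.totalDegree ≤ P.totalDegree ∧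
      ∀ x : 𝔼[d], MvPolynomial.eval (⇑x) Q = MvPolynomial.eval (⇑(G x)) P := by
  set g : Fin d → MvPolynomial (Fin d) ℝ := fun i =>
    (∑ j, MvPolynomial.C (G.linear (EuclideanSpace.single j 1) i) * MvPolynomial.X j) +
      MvPolynomial.C (G 0 i)
  have hg : ∀ i, (g i).totalDegree ≤ 1 := by
    intro i
    refine (MvPolynomial.totalDegree_add _ _).trans (max_le ?_ (by simp))
    refine MvPolynomial.totalDegree_finsetSum_le fun j _ => ?_
    refine (MvPolynomial.totalDegree_mul _ _).trans ?_
    simp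
  refine ⟨MvPolynomial.aeval g P, totalDegree_aeval_le hg P, fun x => ?_⟩
  have hx : ∀ i, MvPolynomial.eval (⇑x) (g i) = G x i := by
    intro i
    have h1 := congrFun G.decomp x
    have hbx : x = ∑ j, x j • EuclideanSpace.single j (1 : ℝ) := by
      have := ((EuclideanSpace.basisFun (Fin d) ℝ).sum_repr x).symm
      simpa using this
    have h2 : G.linear x i = ∑ j, x j * G.linear (EuclideanSpace.single j 1) i := by
      conv_lhs => rw [hbx, map_sum]
      simp
    rw [h1]
    simp [g, h2, mul_comm]
  rw [MvPolynomial.aeval_def, MvPolynomial.eval₂_eq, MvPolynomial.eval_eq (G x : Fin d → ℝ),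
    map_sum]
  refine Finset.sum_congr rfl fun s _ => ?_
  simp [hx]

end Polynomial

/-! ### The inverse of the near-identity map -/

section Flow

variable {d : ℕ}

local notation "𝔼[" d "]" => EuclideanSpace ℝ (Fin d)

variable {Ω : Set 𝔼[d]} {Z Ψ : 𝔼[d] → 𝔼[d]} {K : NNReal}

/-- The preimage of `y` is the fixed point of the contraction `x ↦ y - Z x`. -/
theorem exists_inverse_id_add (hK : K < 1) (hZ : LipschitzWith K Z) :
    ∃ Ψ : 𝔼[d] → 𝔼[d], ∀ y, Ψ y + Z (Ψ y) = y := by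
  have hc : ∀ y, ContractingWith K fun x => y - Z x := fun y =>
    ⟨hK, LipschitzWith.of_dist_le_mul fun a b => by
      rw [dist_sub_left]
      exact hZ.dist_le_mul a b⟩
  refine ⟨fun y => (hc y).fixedPoint, fun y => ?_⟩
  have := (hc y).fixedPoint_isFixedPt
  have h : y - Z (hc y).fixedPoint = (hc y).fixedPoint := this
  exact (sub_eq_iff_eq_add.1 h).symm

/-- `Ψ` is the inverse of the near-identity map `x ↦ x + Z x`, which fixes the complement of
`Ω`. -/
structure IsFlowInverse (Ω : Set (EuclideanSpace ℝ (Fin d)))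
    (Z : EuclideanSpace ℝ (Fin d) → EuclideanSpace ℝ (Fin d)) (K : NNReal)
    (Ψ : EuclideanSpace ℝ (Fin d) → EuclideanSpace ℝ (Fin d)) : Prop where
  lt_one : K < 1
  lipschitz_disp : LipschitzWith K Z
  disp_zero : ∀ x ∉ Ω, Z x = 0
  right_inv : ∀ y, Ψ y + Z (Ψ y) = y

namespace IsFlowInverse

theorem left_inv (h : IsFlowInverse Ω Z K Ψ) (x : 𝔼[d]) : Ψ (x + Z x) = x :=
  (antilipschitzWith_id_add h.lt_one h.lipschitz_disp).injective (h.right_inv (x + Z x))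

theorem eq_add (h : IsFlowInverse Ω Z K Ψ) (y : 𝔼[d]) : Ψ y = y + -Z (Ψ y) := by
  conv_rhs => rw [← h.right_inv y]
  rw [h.left_inv]
  abel

theorem lipschitz (h : IsFlowInverse Ω Z K Ψ) : LipschitzWith (1 - K)⁻¹ Ψ :=
  (antilipschitzWith_id_add h.lt_one h.lipschitz_disp).to_rightInverse h.right_inv

theorem antilipschitz (h : IsFlowInverse Ω Z K Ψ) : AntilipschitzWith (1 + K) Ψ :=
  (LipschitzWith.id.add h.lipschitz_disp).to_rightInverse h.right_inv

theorem apply_of_notMem (h : IsFlowInverse Ω Z K Ψ) {y : 𝔼[d]} (hy : y ∉ Ω) : Ψ y = y := by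
  have := h.left_inv y
  rwa [h.disp_zero y hy, add_zero] at this

theorem mem_iff (h : IsFlowInverse Ω Z K Ψ) (y : 𝔼[d]) : Ψ y ∈ Ω ↔ y ∈ Ω := by
  have := preimage_id_add h.lt_one h.lipschitz_disp h.disp_zero
  conv_rhs => rw [← h.right_inv y]
  exact (Set.ext_iff.1 this (Ψ y)).symm

theorem preimage_eq (h : IsFlowInverse Ω Z K Ψ) : Ψ ⁻¹' Ω = Ω := Set.ext h.mem_iff

theorem mem_closure_iff (h : IsFlowInverse Ω Z K Ψ) (y : 𝔼[d]) :
    Ψ y ∈ closure Ω ↔ y ∈ closure Ω := by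
  by_cases hy : y ∈ Ω
  · exact iff_of_true (subset_closure ((h.mem_iff y).2 hy)) (subset_closure hy)
  · rw [h.apply_of_notMem hy]

/-- By `eq_add` the inverse is itself the identity plus this displacement, so the increment bounds
apply to `Ψ` as soon as `K / (1 - K) < 1`. -/
theorem neg_disp (h : IsFlowInverse Ω Z K Ψ) :
    LipschitzWith (K * (1 - K)⁻¹) (fun y => -Z (Ψ y)) := by
  have := h.lipschitz_disp.comp h.lipschitz
  refine LipschitzWith.of_dist_le_mul fun a b => ?_
  rw [dist_neg_neg]
  exact this.dist_le_mul a b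

end IsFlowInverse

end Flow

/-! ### Finite element functions under the mesh motion -/

section Transport

variable {d : ℕ}

local notation "𝔼[" d "]" => EuclideanSpace ℝ (Fin d)

variable {Ω : Set 𝔼[d]} {T : Finset (Finset 𝔼[d])} {X Y Ψ : 𝔼[d] → 𝔼[d]}
  {A : Finset 𝔼[d] → 𝔼[d] →ᵃ[ℝ] 𝔼[d]} {m M : NNReal}

/-- The affine motion `x ↦ x + t A x`. -/
noncomputable def affineMotion (A : EuclideanSpace ℝ (Fin d) →ᵃ[ℝ] EuclideanSpace ℝ (Fin d))
    (t : ℝ) : EuclideanSpace ℝ (Fin d) →ᵃ[ℝ] EuclideanSpace ℝ (Fin d) :=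
  AffineMap.id ℝ _ + t • A

theorem affineMotion_apply (A : 𝔼[d] →ᵃ[ℝ] 𝔼[d]) (t : ℝ) (x : 𝔼[d]) :
    affineMotion A t x = x + t • A x := rfl

theorem IsMeshVelocity.lipschitz_smul (hY : IsMeshVelocity Ω T X Y A m M) (t : NNReal) :
    LipschitzWith (t * m) fun x => (t : ℝ) • Y x := by
  refine LipschitzWith.of_dist_le_mul fun x y => ?_
  rw [dist_smul₀, NNReal.coe_mul, mul_assoc, Real.norm_of_nonneg t.coe_nonneg]
  exact mul_le_mul_of_nonneg_left (hY.lipschitz.dist_le_mul x y) t.coe_nonneg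

theorem IsMeshVelocity.exists_flowInverse (hY : IsMeshVelocity Ω T X Y A m M) {t : NNReal}
    (ht : t * m < 1) : ∃ Ψ, IsFlowInverse Ω (fun x => (t : ℝ) • Y x) (t * m) Ψ := by
  obtain ⟨Ψ, hΨ⟩ := exists_inverse_id_add ht (hY.lipschitz_smul t)
  exact ⟨Ψ, ht, hY.lipschitz_smul t, fun x hx => by rw [hY.zero x hx, smul_zero], hΨ⟩

theorem IsMeshVelocity.affineMotion_eq_moveVertex (hY : IsMeshVelocity Ω T X Y A m M)
    {K : Finset 𝔼[d]} (hK : K ∈ T) (t : ℝ) : ∀ p ∈ K, affineMotion (A K) t p = moveVertex X t p := by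
  intro p hp
  rw [affineMotion_apply, hY.nodal K hK p hp, moveVertex]

/-- On each element the affine map of the mesh motion is `x ↦ x + t Y x`, so the elementwise
transport relation is composition with the single global map `Ψ`; both functions vanish off the
closure of `Ω`. -/
theorem IsMeshVelocity.eq_comp_of_isTransported (hY : IsMeshVelocity Ω T X Y A m M)
    (hT : IsSimplicialMesh Ω T) {t : NNReal}
    (hΨ : IsFlowInverse Ω (fun x => (t : ℝ) • Y x) (t * m) Ψ) {v w : 𝔼[d] → ℝ}
    (hvw : IsTransported T X t v w) (hv : ∀ x ∉ closure Ω, v x = 0)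
    (hw : ∀ x ∉ closure Ω, w x = 0) : w = fun y => v (Ψ y) := by
  ext1 y
  by_cases hy : y ∈ closure Ω
  · obtain ⟨K, hK, hyK⟩ := hT.exists_mem_element ((hΨ.mem_closure_iff y).2 hy)
    have := hvw K hK _ (hY.affineMotion_eq_moveVertex hK t) _ hyK
    rwa [affineMotion_apply, ← hY.eq_on K hK _ hyK, hΨ.right_inv y] at this
  · rw [hw y hy, hv _ (mt (hΨ.mem_closure_iff y).1 hy)]

/-- A linear perturbation of the identity of norm below one is injective, hence bijective in finite
dimension. That the inverse is affine is what preserves polynomial degrees. -/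
theorem exists_affineMotion_leftInverse {A : 𝔼[d] →ᵃ[ℝ] 𝔼[d]} {t : NNReal}
    (hA : ∀ v, ‖A.linear v‖ ≤ m * ‖v‖) (ht : t * m < 1) :
    ∃ G : 𝔼[d] →ᵃ[ℝ] 𝔼[d], ∀ x, G (affineMotion A t x) = x := by
  have hinj : Function.Injective (LinearMap.id + (t : ℝ) • A.linear : 𝔼[d] →ₗ[ℝ] 𝔼[d]) := by
    refine (injective_iff_map_eq_zero _).2 fun v hv => ?_
    have h1 : v = -((t : ℝ) • A.linear v) := eq_neg_of_add_eq_zero_left hv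
    have h2 : ‖v‖ ≤ t * m * ‖v‖ := by
      conv_lhs => rw [h1, norm_neg, norm_smul, Real.norm_of_nonneg t.coe_nonneg]
      rw [mul_assoc]
      exact mul_le_mul_of_nonneg_left (hA v) t.coe_nonneg
    have h3 : (t * m : ℝ) < 1 := by exact_mod_cast ht
    have h4 : ‖v‖ = 0 := by
      by_contra hne
      have : 0 < ‖v‖ := lt_of_le_of_ne (norm_nonneg v) (Ne.symm hne)
      nlinarith
    exact norm_eq_zero.1 h4
  set N := LinearEquiv.ofInjectiveEndo _ hinj
  refine ⟨⟨fun z => N.symm (z - affineMotion A t 0), N.symm, fun p v => ?_⟩, fun x => ?_⟩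
  · simp only [vadd_eq_add]
    rw [add_sub_assoc, map_add]
    rfl
  · show N.symm (affineMotion A t x - affineMotion A t 0) = x
    rw [LinearEquiv.symm_apply_eq]
    have h1 := A.linearMap_vsub x 0
    simp only [vsub_eq_sub, sub_zero] at h1
    show _ = x + (t : ℝ) • A.linear x
    rw [h1, affineMotion_apply, affineMotion_apply, smul_sub]
    abel

/-- Finite element functions are carried over to finite element functions by the mesh motion. -/
theorem IsMeshVelocity.comp_mem_feSpace (hY : IsMeshVelocity Ω T X Y A m M)
    (hT : IsSimplicialMesh Ω T) (hΩ : IsOpen Ω) {t : NNReal} (ht : t * m < 1)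
    (hΨ : IsFlowInverse Ω (fun x => (t : ℝ) • Y x) (t * m) Ψ) {r : ℕ} {v : 𝔼[d] → ℝ}
    (hv : v ∈ feSpace Ω T r) : (fun y => v (Ψ y)) ∈ feSpace Ω (deformedMesh T X t) r := by
  obtain ⟨hv1, hv2, hv3, hv4⟩ := hv
  refine ⟨?_, ?_, fun x hx => hv3 _ (mt (hΨ.mem_closure_iff x).1 hx), fun K' hK' => ?_⟩
  · exact ((hv1.hasH10Deriv hΩ).comp hΩ hT.isBounded hΨ.antilipschitz hΨ.lipschitz
      hΨ.preimage_eq).memH10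
  · exact hv2.comp hΨ.lipschitz.continuous.continuousOn fun x hx => (hΨ.mem_closure_iff x).2 hx
  · rw [deformedMesh, Finset.mem_image] at hK'
    obtain ⟨K, hK, rfl⟩ := hK'
    obtain ⟨P, hP, hPv⟩ := hv4 K hK
    obtain ⟨G, hG⟩ := exists_affineMotion_leftInverse (hY.norm_linear_le K hK) ht
    obtain ⟨Q, hQ, hQP⟩ := exists_polynomial_comp_affineMap G P
    refine ⟨Q, hQ.trans hP, fun z hz => ?_⟩
    have himg : element (K.image (moveVertex X t)) = affineMotion (A K) t '' element K := by
      rw [element, element, AffineMap.image_convexHull, Finset.coe_image]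
      congr 1
      exact (image_congr fun p hp => hY.affineMotion_eq_moveVertex hK t p hp).symm
    have hz' : z ∈ affineMotion (A K) t '' element K := by
      rw [← himg]
      convert hz
    obtain ⟨x, hx, rfl⟩ := hz'
    rw [hQP, hG, ← hPv x hx, affineMotion_apply, ← hY.eq_on K hK x hx]
    exact congrArg v (hΨ.left_inv x)

end Transport

/-! ### The bilinear form and its coercivity -/

section Forms

variable {d : ℕ}

local notation "𝔼[" d "]" => EuclideanSpace ℝ (Fin d)

variable {Ω : Set 𝔼[d]} {a c f u v : 𝔼[d] → ℝ} {b : 𝔼[d] → 𝔼[d]} {Du Dv : 𝔼[d] → 𝔼[d] →L[ℝ] ℝ}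

/-- The vector that represents a linear functional. -/
noncomputable def sharp (p : EuclideanSpace ℝ (Fin d) →L[ℝ] ℝ) : EuclideanSpace ℝ (Fin d) :=
  (InnerProductSpace.toDual ℝ (EuclideanSpace ℝ (Fin d))).symm p

theorem norm_sharp (p : 𝔼[d] →L[ℝ] ℝ) : ‖sharp p‖ = ‖p‖ := LinearIsometryEquiv.norm_map _ _

theorem sharp_sub (p q : 𝔼[d] →L[ℝ] ℝ) : sharp (p - q) = sharp p - sharp q := map_sub _ p q

theorem sharp_smul (r : ℝ) (p : 𝔼[d] →L[ℝ] ℝ) : sharp (r • p) = r • sharp p :=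
  ((InnerProductSpace.toDual ℝ 𝔼[d]).symm).toLinearEquiv.map_smul r p

theorem continuous_sharp : Continuous (sharp : (𝔼[d] →L[ℝ] ℝ) → 𝔼[d]) :=
  (InnerProductSpace.toDual ℝ 𝔼[d]).symm.continuous

theorem abs_inner_sharp_le (p q : 𝔼[d] →L[ℝ] ℝ) : |inner ℝ (sharp p) (sharp q)| ≤ ‖p‖ * ‖q‖ := by
  have := abs_real_inner_le_norm (sharp p) (sharp q)
  rwa [norm_sharp, norm_sharp] at this

/-- The diffusion term `∫ a ∇u·∇v`. -/
noncomputable def diffusionForm (Ω : Set (EuclideanSpace ℝ (Fin d)))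
    (a : EuclideanSpace ℝ (Fin d) → ℝ)
    (Du Dv : EuclideanSpace ℝ (Fin d) → EuclideanSpace ℝ (Fin d) →L[ℝ] ℝ) : ℝ :=
  ∫ x in Ω, a x * inner ℝ (sharp (Du x)) (sharp (Dv x))

/-- The transport term `∫ (b·∇u) v`. -/
noncomputable def transportForm (Ω : Set (EuclideanSpace ℝ (Fin d)))
    (b : EuclideanSpace ℝ (Fin d) → EuclideanSpace ℝ (Fin d))
    (Du : EuclideanSpace ℝ (Fin d) → EuclideanSpace ℝ (Fin d) →L[ℝ] ℝ)
    (v : EuclideanSpace ℝ (Fin d) → ℝ) : ℝ :=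
  ∫ x in Ω, Du x (b x) * v x

/-- The reaction term `∫ c u v`. -/
noncomputable def reactionForm (Ω : Set (EuclideanSpace ℝ (Fin d)))
    (c u v : EuclideanSpace ℝ (Fin d) → ℝ) : ℝ :=
  ∫ x in Ω, c x * u x * v x

theorem integrable_diffusion (ha : MemLp a ⊤ (volume.restrict Ω))
    (hu : MemLp Du 2 (volume.restrict Ω)) (hv : MemLp Dv 2 (volume.restrict Ω)) :
    Integrable (fun x => a x * inner ℝ (sharp (Du x)) (sharp (Dv x))) (volume.restrict Ω) := by
  refine ((integral_norm_mul_norm_le_lpNorm hu hv).1.const_mul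
    (lpNorm a ⊤ (volume.restrict Ω))).mono' ?_ ?_
  · exact ha.1.mul ((continuous_sharp.comp_aestronglyMeasurable hu.1).inner
      (continuous_sharp.comp_aestronglyMeasurable hv.1))
  · filter_upwards [ae_le_lpNorm_exponent_top ha] with x hx
    rw [norm_mul]
    exact mul_le_mul hx (abs_inner_sharp_le _ _) (norm_nonneg _) lpNorm_nonneg

theorem integrable_transport (hb : MemLp b ⊤ (volume.restrict Ω))
    (hu : MemLp Du 2 (volume.restrict Ω)) (hv : MemLp v 2 (volume.restrict Ω)) :
    Integrable (fun x => Du x (b x) * v x) (volume.restrict Ω) := by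
  refine ((integral_norm_mul_norm_le_lpNorm hu hv).1.const_mul
    (lpNorm b ⊤ (volume.restrict Ω))).mono' ?_ ?_
  · exact (aestronglyMeasurable_clm_apply hu.1 hb.1).mul hv.1
  · filter_upwards [ae_le_lpNorm_exponent_top hb] with x hx
    rw [norm_mul, ← mul_assoc, mul_comm (lpNorm _ _ _)]
    exact mul_le_mul_of_nonneg_right ((Du x).le_opNorm_of_le hx) (norm_nonneg _)

theorem integrable_reaction (hc : MemLp c ⊤ (volume.restrict Ω))
    (hu : MemLp u 2 (volume.restrict Ω)) (hv : MemLp v 2 (volume.restrict Ω)) :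
    Integrable (fun x => c x * u x * v x) (volume.restrict Ω) := by
  refine ((integral_norm_mul_norm_le_lpNorm hu hv).1.const_mul
    (lpNorm c ⊤ (volume.restrict Ω))).mono' ((hc.1.mul hu.1).mul hv.1) ?_
  filter_upwards [ae_le_lpNorm_exponent_top hc] with x hx
  rw [norm_mul, norm_mul, mul_assoc]
  exact mul_le_mul_of_nonneg_right hx (by positivity)

theorem abs_reactionForm_le (hc : MemLp c ⊤ (volume.restrict Ω))
    (hu : MemLp u 2 (volume.restrict Ω)) (hv : MemLp v 2 (volume.restrict Ω)) :
    |reactionForm Ω c u v| ≤ lpNorm c ⊤ (volume.restrict Ω) *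
      (lpNorm u 2 (volume.restrict Ω) * lpNorm v 2 (volume.restrict Ω)) := by
  have h := integral_norm_mul_norm_le_lpNorm hu hv
  refine le_trans ?_ (mul_le_mul_of_nonneg_left h.2 lpNorm_nonneg)
  rw [← integral_const_mul, ← Real.norm_eq_abs]
  refine norm_integral_le_of_norm_le (h.1.const_mul _) ?_
  filter_upwards [ae_le_lpNorm_exponent_top hc] with x hx
  rw [norm_mul, norm_mul, mul_assoc]
  exact mul_le_mul_of_nonneg_right hx (by positivity)

theorem abs_integral_mul_le (hf : MemLp f 2 (volume.restrict Ω))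
    (hv : MemLp v 2 (volume.restrict Ω)) :
    |∫ x in Ω, f x * v x| ≤ lpNorm f 2 (volume.restrict Ω) * lpNorm v 2 (volume.restrict Ω) := by
  have h := integral_norm_mul_norm_le_lpNorm hf hv
  refine le_trans ?_ h.2
  rw [← Real.norm_eq_abs]
  exact norm_integral_le_of_norm_le h.1 (ae_of_all _ fun x => (norm_mul _ _).le)

/-- The bilinear form of the boundary value problem. -/
noncomputable def energyForm (Ω : Set (EuclideanSpace ℝ (Fin d)))
    (a : EuclideanSpace ℝ (Fin d) → ℝ) (b : EuclideanSpace ℝ (Fin d) → EuclideanSpace ℝ (Fin d))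
    (c u : EuclideanSpace ℝ (Fin d) → ℝ)
    (Du : EuclideanSpace ℝ (Fin d) → EuclideanSpace ℝ (Fin d) →L[ℝ] ℝ)
    (v : EuclideanSpace ℝ (Fin d) → ℝ)
    (Dv : EuclideanSpace ℝ (Fin d) → EuclideanSpace ℝ (Fin d) →L[ℝ] ℝ) : ℝ :=
  diffusionForm Ω a Du Dv + transportForm Ω b Du v + reactionForm Ω c u v

/-- With the test function fixed, the form is linear in the coefficients; its time derivative
thereby reduces to derivatives of finitely many real functions. -/
theorem energyForm_sum {ι : Type*} (s : Finset ι) (ha : MemLp a ⊤ (volume.restrict Ω))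
    (hb : MemLp b ⊤ (volume.restrict Ω)) (hc : MemLp c ⊤ (volume.restrict Ω))
    {w : ι → 𝔼[d] → ℝ} {Dw : ι → 𝔼[d] → 𝔼[d] →L[ℝ] ℝ} (hw : ∀ i, HasH10Deriv Ω (w i) (Dw i))
    (hv : HasH10Deriv Ω v Dv) (r : ι → ℝ) :
    energyForm Ω a b c (∑ i ∈ s, r i • w i) (∑ i ∈ s, r i • Dw i) v Dv =
      ∑ i ∈ s, r i * energyForm Ω a b c (w i) (Dw i) v Dv := by
  have h1 : diffusionForm Ω a (∑ i ∈ s, r i • Dw i) Dv =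
      ∑ i ∈ s, r i * diffusionForm Ω a (Dw i) Dv := by
    simp only [diffusionForm, ← integral_const_mul]
    rw [← integral_finsetSum _ fun i _ =>
      (integrable_diffusion ha (hw i).memLp_deriv hv.memLp_deriv).const_mul (r i)]
    refine integral_congr_ae (ae_of_all _ fun x => ?_)
    have e : sharp (∑ i ∈ s, r i • Dw i x) = ∑ i ∈ s, r i • sharp (Dw i x) := by
      have := map_sum (InnerProductSpace.toDual ℝ 𝔼[d]).symm (fun i => r i • Dw i x) s
      exact this.trans (Finset.sum_congr rfl fun i _ => sharp_smul _ _)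
    simp only [Finset.sum_apply, Pi.smul_apply]
    rw [e, sum_inner, Finset.mul_sum]
    refine Finset.sum_congr rfl fun i _ => ?_
    rw [real_inner_smul_left]
    ring
  have h2 : transportForm Ω b (∑ i ∈ s, r i • Dw i) v =
      ∑ i ∈ s, r i * transportForm Ω b (Dw i) v := by
    simp only [transportForm, ← integral_const_mul]
    rw [← integral_finsetSum _ fun i _ =>
      (integrable_transport hb (hw i).memLp_deriv hv.memLp).const_mul (r i)]
    refine integral_congr_ae (ae_of_all _ fun x => ?_)
    simp only [Finset.sum_apply, Pi.smul_apply, _root_.sum_apply,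
      _root_.smul_apply, smul_eq_mul, Finset.sum_mul, mul_assoc]
  have h3 : reactionForm Ω c (∑ i ∈ s, r i • w i) v = ∑ i ∈ s, r i * reactionForm Ω c (w i) v := by
    simp only [reactionForm, ← integral_const_mul]
    rw [← integral_finsetSum _ fun i _ =>
      (integrable_reaction hc (hw i).memLp hv.memLp).const_mul (r i)]
    refine integral_congr_ae (ae_of_all _ fun x => ?_)
    simp only [Finset.sum_apply, Pi.smul_apply, smul_eq_mul, Finset.mul_sum, Finset.sum_mul]
    refine Finset.sum_congr rfl fun i _ => ?_
    ring
  simp only [energyForm, h1, h2, h3, ← Finset.sum_add_distrib, mul_add]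

/-- The finite element equation, for any choice of the weak derivatives. -/
theorem IsFESolution.energyForm_eq {T : Finset (Finset 𝔼[d])} {r : ℕ} (hΩ : IsOpen Ω)
    (ha : MemLp a ⊤ (volume.restrict Ω)) (hb : MemLp b ⊤ (volume.restrict Ω))
    (hc : MemLp c ⊤ (volume.restrict Ω)) (h : IsFESolution Ω T r a b c f u)
    (hv : v ∈ feSpace Ω T r) (hDu : HasH10Deriv Ω u Du) (hDv : HasH10Deriv Ω v Dv) :
    energyForm Ω a b c u Du v Dv = ∫ x in Ω, f x * v x := by
  have h1 := h.2 v hv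
  rw [← h1, energyForm, diffusionForm, transportForm, reactionForm, ← integral_add, ← integral_add]
  · refine integral_congr_ae ?_
    filter_upwards [hDu.hasWeakFDeriv.weakFDeriv_ae_eq hΩ, hDv.hasWeakFDeriv.weakFDeriv_ae_eq hΩ]
      with x hx hy
    have e1 : weakGrad Ω u x = sharp (Du x) := by rw [weakGrad, hx, sharp]
    have e2 : weakGrad Ω v x = sharp (Dv x) := by rw [weakGrad, hy, sharp]
    rw [e1, e2, real_inner_comm (sharp (Du x)) (b x)]
    congr 3
    exact (InnerProductSpace.toDual_symm_apply (x := b x) (y := Du x)).symm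
  · exact (integrable_diffusion ha hDu.memLp_deriv hDv.memLp_deriv).add
      (integrable_transport hb hDu.memLp_deriv hDv.memLp)
  · exact integrable_reaction hc hDu.memLp hDv.memLp
  · exact integrable_diffusion ha hDu.memLp_deriv hDv.memLp_deriv
  · exact integrable_transport hb hDu.memLp_deriv hDv.memLp

/-- Coercivity of the bilinear form. -/
theorem energyForm_self_ge {a₀ : ℝ} {Db : 𝔼[d] → 𝔼[d] →L[ℝ] 𝔼[d]}
    (ha : MemLp a ⊤ (volume.restrict Ω)) (hb : MemLp b ⊤ (volume.restrict Ω))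
    (hc : MemLp c ⊤ (volume.restrict Ω)) (hbD : HasWeakFDeriv Ω b Db)
    (hDb : MemLp Db ⊤ (volume.restrict Ω)) (haa₀ : ∀ᵐ x ∂(volume.restrict Ω), a₀ ≤ a x)
    (hcb : ∀ᵐ x ∂(volume.restrict Ω),
      0 ≤ c x - 1 / 2 * LinearMap.trace ℝ 𝔼[d] (Db x : 𝔼[d] →ₗ[ℝ] 𝔼[d]))
    (hv : HasH10Deriv Ω v Dv) :
    a₀ * lpNorm Dv 2 (volume.restrict Ω) ^ 2 ≤ energyForm Ω a b c v Dv v Dv := by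
  have h1 : a₀ * lpNorm Dv 2 (volume.restrict Ω) ^ 2 ≤ diffusionForm Ω a Dv Dv := by
    rw [lpNorm_two_sq hv.memLp_deriv, ← integral_const_mul, diffusionForm]
    refine integral_mono_ae ?_ (integrable_diffusion ha hv.memLp_deriv hv.memLp_deriv) ?_
    · have := (integral_norm_mul_norm_le_lpNorm hv.memLp_deriv hv.memLp_deriv).1.const_mul a₀
      simpa only [sq] using this
    · filter_upwards [haa₀] with x hx
      rw [real_inner_self_eq_norm_sq, norm_sharp]
      exact mul_le_mul_of_nonneg_right hx (by positivity)
  -- After integration by parts the sum is `∫ (c - ½ div b) v²`.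
  have h2 : 0 ≤ transportForm Ω b Dv v + reactionForm Ω c v v := by
    rw [transportForm, hv.integral_apply_mul_self hbD hb hDb, reactionForm, ← integral_const_mul,
      ← integral_add]
    · refine integral_nonneg_of_ae ?_
      filter_upwards [hcb] with x hx
      have := mul_nonneg hx (mul_self_nonneg (v x))
      simp only [Pi.zero_apply]
      linarith
    · exact (integrable_reaction (memLp_top_trace hDb) hv.memLp hv.memLp).const_mul _
    · exact integrable_reaction hc hv.memLp hv.memLp
  rw [energyForm]
  linarith

end Forms

/-! ### Change of variables and pointwise bounds along the flow -/

section PullBack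

variable {d : ℕ}

local notation "𝔼[" d "]" => EuclideanSpace ℝ (Fin d)

variable {Ω : Set 𝔼[d]} {Z Ψ : 𝔼[d] → 𝔼[d]} {K : NNReal}

namespace IsFlowInverse

theorem ae_comp (h : IsFlowInverse Ω Z K Ψ) {p : 𝔼[d] → Prop}
    (hp : ∀ᵐ x ∂(volume.restrict Ω), p x) : ∀ᵐ y ∂(volume.restrict Ω), p (y + Z y) := by
  have hZ := h.lipschitz_disp.continuous
  exact (quasiMeasurePreserving_restrict_of_antilipschitz
    (antilipschitzWith_id_add h.lt_one h.lipschitz_disp) (by fun_prop)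
    (preimage_id_add h.lt_one h.lipschitz_disp h.disp_zero)).ae hp

/-- Change of variables along the flow. -/
theorem integral_eq (h : IsFlowInverse Ω Z K Ψ) (hΩ : IsOpen Ω) (g : 𝔼[d] → ℝ) :
    ∫ x in Ω, g x = ∫ y in Ω, |(fderiv ℝ (fun y => y + Z y) y).det| • g (y + Z y) ∧
    (Integrable g (volume.restrict Ω) → Integrable (fun y =>
      |(fderiv ℝ (fun y => y + Z y) y).det| • g (y + Z y)) (volume.restrict Ω)) := by
  set Φ : 𝔼[d] → 𝔼[d] := fun y => y + Z y
  have hΦ : LipschitzWith (1 + K) Φ := LipschitzWith.id.add h.lipschitz_disp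
  -- `Φ` is differentiable only almost everywhere. The change of variables is made on this
  -- full-measure set, and its image also has full measure in `Ω` because preimages of null sets
  -- under `Ψ` are null.
  set s := {y ∈ Ω | DifferentiableAt ℝ Φ y}
  have hsm : MeasurableSet s := hΩ.measurableSet.inter (measurableSet_of_differentiableAt ℝ Φ)
  have hs : s =ᵐ[volume] Ω := by
    filter_upwards [hΦ.ae_differentiableAt (μ := volume)] with y hy
    exact propext ⟨fun h => h.1, fun h => ⟨h, hy⟩⟩
  have himg : Φ '' s = {x ∈ Ω | DifferentiableAt ℝ Φ (Ψ x)} := by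
    ext x
    constructor
    · rintro ⟨y, ⟨hy, hyd⟩, rfl⟩
      refine ⟨(h.mem_iff _).1 ?_, ?_⟩
      · rwa [h.left_inv y]
      · rwa [h.left_inv y]
    · rintro ⟨hx, hxd⟩
      exact ⟨Ψ x, ⟨(h.mem_iff x).2 hx, hxd⟩, h.right_inv x⟩
  have himgae : (Φ '' s : Set 𝔼[d]) =ᵐ[volume] Ω := by
    have hΨ : ∀ᵐ x, DifferentiableAt ℝ Φ (Ψ x) := by
      have hq : Measure.QuasiMeasurePreserving Ψ (volume.restrict univ) (volume.restrict univ) :=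
        quasiMeasurePreserving_restrict_of_antilipschitz h.antilipschitz
          h.lipschitz.continuous.measurable preimage_univ
      rw [Measure.restrict_univ] at hq
      exact hq.ae hΦ.ae_differentiableAt
    rw [himg]
    filter_upwards [hΨ] with y hy
    exact propext ⟨fun h => h.1, fun h => ⟨h, hy⟩⟩
  have hd : ∀ y ∈ s, HasFDerivWithinAt Φ (fderiv ℝ Φ y) s y := fun y hy =>
    hy.2.hasFDerivAt.hasFDerivWithinAt
  have hinj : InjOn Φ s := fun x _ y _ hxy => by
    rw [← h.left_inv x, ← h.left_inv y]
    exact congrArg Ψ hxy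
  constructor
  · rw [← setIntegral_congr_set himgae, ← setIntegral_congr_set hs,
      integral_image_eq_integral_abs_det_fderiv_smul volume hsm hd hinj]
  · intro hg
    have h1 : IntegrableOn g (Φ '' s) := by
      rw [IntegrableOn, Measure.restrict_congr_set himgae]
      exact hg
    have h2 := (integrableOn_image_iff_integrableOn_abs_det_fderiv_smul volume hsm hd hinj g).1 h1
    rwa [IntegrableOn, Measure.restrict_congr_set hs] at h2

/-- The derivative of the inverse flow along the flow. -/
theorem ae_fderiv_comp (h : IsFlowInverse Ω Z K Ψ) :
    ∀ᵐ y ∂(volume.restrict Ω), ‖fderiv ℝ Ψ (y + Z y)‖ ≤ (1 - K : ℝ)⁻¹ ∧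
      ∀ L, HasFDerivAt Z L y → fderiv ℝ (fun y => y + Z y) y = ContinuousLinearMap.id ℝ 𝔼[d] + L ∧
        ‖fderiv ℝ Ψ (y + Z y) - ContinuousLinearMap.id ℝ 𝔼[d]‖ ≤ (1 - K : ℝ)⁻¹ * ‖L‖ := by
  have hb : ∀ x, ‖fderiv ℝ Ψ x‖ ≤ (1 - K : ℝ)⁻¹ := fun x => by
    have := norm_fderiv_le_of_lipschitz ℝ h.lipschitz (x₀ := x)
    rwa [NNReal.coe_inv, NNReal.coe_sub h.lt_one.le, NNReal.coe_one] at this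
  have hΨd : ∀ᵐ x ∂(volume.restrict Ω), DifferentiableAt ℝ Ψ x :=
    ae_restrict_of_ae h.lipschitz.ae_differentiableAt
  filter_upwards [h.ae_comp hΨd] with y hy
  refine ⟨hb _, fun L hL => ?_⟩
  have hΦ : HasFDerivAt (fun y => y + Z y) (ContinuousLinearMap.id ℝ 𝔼[d] + L) y :=
    (hasFDerivAt_id y).add hL
  refine ⟨hΦ.fderiv, ?_⟩
  have hcomp : HasFDerivAt (fun y => Ψ (y + Z y)) ((fderiv ℝ Ψ (y + Z y)).comp
      (ContinuousLinearMap.id ℝ 𝔼[d] + L)) y := hy.hasFDerivAt.comp y hΦ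
  have hid : HasFDerivAt (fun y => Ψ (y + Z y)) (ContinuousLinearMap.id ℝ 𝔼[d]) y := by
    simp only [h.left_inv]
    exact hasFDerivAt_id y
  -- Differentiating `Ψ (y + Z y) = y` gives `R (1 + L) = 1` for the derivative `R` of `Ψ`, so `R -
  -- 1 = -R L`.
  have e := hcomp.unique hid
  rw [ContinuousLinearMap.comp_add, ContinuousLinearMap.comp_id] at e
  rw [sub_eq_of_eq_add (eq_sub_of_add_eq e |>.trans (sub_eq_add_neg _ _) |>.trans (add_comm _ _)),
    norm_neg]
  exact (ContinuousLinearMap.opNorm_comp_le _ _).trans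
    (mul_le_mul_of_nonneg_right (hb _) (norm_nonneg _))

/-- The increments along the flow of a function with bounded weak derivative. -/
theorem ae_norm_sub_le {F : Type*} [NormedAddCommGroup F] [NormedSpace ℝ F] [CompleteSpace F]
    (h : IsFlowInverse Ω Z K Ψ) (hΩ : IsOpen Ω) (hΩb : Bornology.IsBounded Ω) {g : 𝔼[d] → F}
    {Dg : 𝔼[d] → 𝔼[d] →L[ℝ] F} (hg : HasWeakFDeriv Ω g Dg) (hg1 : MemLp g ⊤ (volume.restrict Ω))
    (hDg : MemLp Dg ⊤ (volume.restrict Ω)) :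
    ∀ᵐ y ∂(volume.restrict Ω),
      ‖g (y + Z y) - g y‖ ≤ lpNorm Dg ⊤ (volume.restrict Ω) * ‖Z y‖ := by
  have : IsFiniteMeasure (volume.restrict Ω) := ⟨by simpa using hΩb.measure_lt_top⟩
  have hli : LocallyIntegrable (Ω.indicator g) volume := by
    have : Integrable g (volume.restrict Ω) := hg1.integrable le_top
    exact ((integrable_indicator_iff hΩ.measurableSet).2 this).locallyIntegrable
  obtain ⟨G, hG, hGs⟩ := hg.exists_lipschitz_on_segments hΩ hli (ae_le_lpNorm_exponent_top hDg)
  filter_upwards [hG, h.ae_comp hG, ae_restrict_mem hΩ.measurableSet] with y hy hy' hyΩ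
  -- Each intermediate map `x ↦ x + s Z x` with `s ∈ [0, 1]` also preserves `Ω`, so the whole path
  -- stays inside although `Ω` need not be convex.
  have hseg : segment ℝ y (y + Z y) ⊆ Ω := by
    rw [segment_eq_image']
    rintro _ ⟨s, hs, rfl⟩
    have hl : LipschitzWith K fun x => s • Z x := by
      refine LipschitzWith.of_dist_le_mul fun x y => ?_
      rw [dist_smul₀, Real.norm_of_nonneg hs.1]
      exact (mul_le_of_le_one_left dist_nonneg hs.2).trans (h.lipschitz_disp.dist_le_mul x y)
    have hpre := preimage_id_add h.lt_one hl
      (fun x hx => by rw [h.disp_zero x hx, smul_zero] : ∀ x ∉ Ω, s • Z x = 0)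
    have hmem : y ∈ (fun x => x + s • Z x) ⁻¹' Ω := by rwa [hpre]
    simpa using hmem
  have := hGs y hy _ hy' hseg
  rwa [add_sub_cancel_left] at this

end IsFlowInverse

end PullBack

/-! ### First-order expansion of the Jacobian -/

section Determinant

variable {d : ℕ}

local notation "𝔼[" d "]" => EuclideanSpace ℝ (Fin d)

/-- The determinant of `1 + t A` to first order. -/
theorem exists_det_one_add_smul_bound (A : 𝔼[d] →ₗ[ℝ] 𝔼[d]) :
    ∃ q : ℝ → ℝ, Continuous q ∧ ∀ t : ℝ, 0 ≤ t →
      |(LinearMap.det (LinearMap.id + t • A)) - 1| ≤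
        t * (|LinearMap.trace ℝ 𝔼[d] A| + t * |q t|) := by
  set β := (EuclideanSpace.basisFun (Fin d) ℝ).toBasis
  set Mx := LinearMap.toMatrix β β A
  -- `det (1 + t A)` is a polynomial in `t`; dividing out `X` twice leaves the factor of `t²` in the
  -- remainder after `1 + t tr A`.
  set P := (1 + (Polynomial.X : Polynomial ℝ) • Mx.map ⇑Polynomial.C).det.divX.divX
  refine ⟨fun t => P.eval t, P.continuous, fun t ht => ?_⟩
  have h1 : LinearMap.det (LinearMap.id + t • A) = (1 + t • Mx).det := by
    rw [← LinearMap.det_toMatrix β]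
    simp [Mx]
  have h2 : LinearMap.trace ℝ 𝔼[d] A = Mx.trace := LinearMap.trace_eq_matrix_trace ℝ β A
  rw [h1, Matrix.det_one_add_smul, h2]
  change |1 + Mx.trace * t + P.eval t * t ^ 2 - 1| ≤ t * (|Mx.trace| + t * |P.eval t|)
  set q := P.eval t
  have e : 1 + Mx.trace * t + q * t ^ 2 - 1 = t * (Mx.trace + t * q) := by ring
  rw [e, abs_mul, abs_of_nonneg ht]
  refine mul_le_mul_of_nonneg_left ((abs_add_le _ _).trans ?_) ht
  rw [abs_mul, abs_of_nonneg ht]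

/-- Finitely many elements allow one common rate `j`, obtained by summing the remainders. It tends
to the trace bound `m`, and `m ≤ j t` later provides its nonnegativity. -/
theorem exists_jacobian_bound {ι : Type*} (s : Finset ι) (A : ι → 𝔼[d] →ₗ[ℝ] 𝔼[d]) {m : ℝ}
    (hA : ∀ i ∈ s, |LinearMap.trace ℝ 𝔼[d] (A i)| ≤ m) :
    ∃ j : ℝ → ℝ, Tendsto j (𝓝[>] 0) (𝓝 m) ∧ ∀ t : ℝ, 0 ≤ t → m ≤ j t ∧ ∀ i ∈ s,
      |(|LinearMap.det (LinearMap.id + t • A i)| - 1)| ≤ t * j t := by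
  choose q hq hqb using fun i => exists_det_one_add_smul_bound (A i)
  refine ⟨fun t => m + t * ∑ i ∈ s, |q i t|, ?_, fun t ht => ⟨?_, fun i hi => ?_⟩⟩
  · have hc : Continuous fun t => m + t * ∑ i ∈ s, |q i t| :=
      continuous_const.add (continuous_id.mul (continuous_finsetSum _ fun i _ => (hq i).abs))
    have := hc.tendsto 0
    rw [zero_mul, add_zero] at this
    exact this.mono_left nhdsWithin_le_nhds
  · have : 0 ≤ t * ∑ i ∈ s, |q i t| := mul_nonneg ht (Finset.sum_nonneg fun i _ => abs_nonneg _)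
    linarith
  · have h1 := abs_abs_sub_abs_le (LinearMap.det (LinearMap.id + t • A i)) 1
    rw [abs_one] at h1
    refine (h1.trans (hqb i t ht)).trans (mul_le_mul_of_nonneg_left ?_ ht)
    refine add_le_add (hA i hi) (mul_le_mul_of_nonneg_left ?_ ht)
    exact Finset.single_le_sum (f := fun i => |q i t|) (fun i _ => abs_nonneg _) hi

end Determinant

/-! ### Change of each term of the equation under the mesh motion -/

section Perturbation

variable {d : ℕ}

local notation "𝔼[" d "]" => EuclideanSpace ℝ (Fin d)

variable {Ω : Set 𝔼[d]} {T : Finset (Finset 𝔼[d])} {X Y Ψ : 𝔼[d] → 𝔼[d]}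
  {A : Finset 𝔼[d] → 𝔼[d] →ᵃ[ℝ] 𝔼[d]} {m M t : NNReal}
  {a c f u v : 𝔼[d] → ℝ} {b : 𝔼[d] → 𝔼[d]} {Du Dv : 𝔼[d] → 𝔼[d] →L[ℝ] ℝ}

/-- The derivative of a function that is transported by the flow with inverse `Ψ`. -/
noncomputable def transportDeriv (Ψ : EuclideanSpace ℝ (Fin d) → EuclideanSpace ℝ (Fin d))
    (D : EuclideanSpace ℝ (Fin d) → EuclideanSpace ℝ (Fin d) →L[ℝ] ℝ) :
    EuclideanSpace ℝ (Fin d) → EuclideanSpace ℝ (Fin d) →L[ℝ] ℝ :=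
  fun x => (D (Ψ x)).comp (fderiv ℝ Ψ x)

theorem IsFlowInverse.hasH10Deriv_comp {Z : 𝔼[d] → 𝔼[d]} {K : NNReal}
    (h : IsFlowInverse Ω Z K Ψ) (hΩ : IsOpen Ω) (hΩb : Bornology.IsBounded Ω)
    (hu : HasH10Deriv Ω u Du) :
    HasH10Deriv Ω (fun y => u (Ψ y)) (transportDeriv Ψ Du) :=
  hu.comp hΩ hΩb h.antilipschitz h.lipschitz h.preimage_eq

/-- The pointwise data of the mesh motion at time `t`: `J` is the Jacobian of the motion and `R`
the derivative of its inverse. -/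
theorem IsMeshVelocity.ae_flow_bounds (hY : IsMeshVelocity Ω T X Y A m M)
    (hΨ : IsFlowInverse Ω (fun x => (t : ℝ) • Y x) (t * m) Ψ) {j : ℝ}
    (hj : ∀ K ∈ T, |(|LinearMap.det (LinearMap.id + (t : ℝ) • (A K).linear)| - 1)| ≤ t * j) :
    ∀ᵐ y ∂(volume.restrict Ω),
      |(|(fderiv ℝ (fun y => y + (t : ℝ) • Y y) y).det| - 1)| ≤ t * j ∧
      ‖fderiv ℝ Ψ (y + (t : ℝ) • Y y)‖ ≤ (1 - t * m : ℝ)⁻¹ ∧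
      ‖fderiv ℝ Ψ (y + (t : ℝ) • Y y) - ContinuousLinearMap.id ℝ 𝔼[d]‖ ≤
        t * (m * (1 - t * m : ℝ)⁻¹) := by
  filter_upwards [hΨ.ae_fderiv_comp, hY.ae_hasFDerivAt] with y hy hy'
  obtain ⟨K, hK, hKy⟩ := hy'
  have hL := hKy.const_smul (t : ℝ)
  obtain ⟨h1, h2⟩ := hy
  obtain ⟨h3, h4⟩ := h2 _ hL
  rw [NNReal.coe_mul] at h1 h4
  refine ⟨?_, h1, h4.trans ?_⟩
  · rw [h3]
    exact hj K hK
  · have hn : ‖(t : ℝ) • LinearMap.toContinuousLinearMap (A K).linear‖ ≤ t * m := by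
      rw [norm_smul, Real.norm_of_nonneg t.coe_nonneg]
      refine mul_le_mul_of_nonneg_left ?_ t.coe_nonneg
      exact ContinuousLinearMap.opNorm_le_bound _ m.coe_nonneg (hY.norm_linear_le K hK)
    have h0 : (0 : ℝ) ≤ (1 - t * m : ℝ)⁻¹ := (norm_nonneg _).trans h1
    calc (1 - t * m : ℝ)⁻¹ * ‖(t : ℝ) • LinearMap.toContinuousLinearMap (A K).linear‖
        ≤ (1 - t * m : ℝ)⁻¹ * (t * m) := mul_le_mul_of_nonneg_left hn h0
      _ = t * (m * (1 - t * m : ℝ)⁻¹) := by ring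

/-- Comparison of two integrals along the flow. -/
theorem IsFlowInverse.abs_integral_sub_le {Z : 𝔼[d] → 𝔼[d]} {K : NNReal}
    (h : IsFlowInverse Ω Z K Ψ) (hΩ : IsOpen Ω) {E F : Type*} [NormedAddCommGroup E]
    [NormedAddCommGroup F] {g g' : 𝔼[d] → ℝ} {p : 𝔼[d] → E} {q : 𝔼[d] → F}
    (hg : Integrable g (volume.restrict Ω)) (hg' : Integrable g' (volume.restrict Ω))
    (hp : MemLp p 2 (volume.restrict Ω)) (hq : MemLp q 2 (volume.restrict Ω)) {C : ℝ} (hC : 0 ≤ C)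
    (hb : ∀ᵐ y ∂(volume.restrict Ω),
      |(|(fderiv ℝ (fun y => y + Z y) y).det| * g (y + Z y) - g' y)| ≤ C * (‖p y‖ * ‖q y‖)) :
    |(∫ x in Ω, g x) - ∫ x in Ω, g' x| ≤
      C * (lpNorm p 2 (volume.restrict Ω) * lpNorm q 2 (volume.restrict Ω)) := by
  obtain ⟨h1, h2⟩ := h.integral_eq hΩ g
  have h3 := integral_norm_mul_norm_le_lpNorm hp hq
  rw [h1, ← integral_sub (h2 hg) hg', ← Real.norm_eq_abs]
  refine le_trans ?_ (mul_le_mul_of_nonneg_left h3.2 hC)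
  rw [← integral_const_mul]
  exact norm_integral_le_of_norm_le (h3.1.const_mul C) hb

theorem abs_inner_sharp_comp_sub_le (p q : 𝔼[d] →L[ℝ] ℝ) (R : 𝔼[d] →L[ℝ] 𝔼[d]) {ρ ε : ℝ}
    (hR : ‖R‖ ≤ ρ) (hR1 : ‖R - ContinuousLinearMap.id ℝ 𝔼[d]‖ ≤ ε) :
    |inner ℝ (sharp (p.comp R)) (sharp (q.comp R))| ≤ ρ ^ 2 * (‖p‖ * ‖q‖) ∧
    |inner ℝ (sharp (p.comp R)) (sharp (q.comp R)) - inner ℝ (sharp p) (sharp q)| ≤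
      (ε * ρ + ε) * (‖p‖ * ‖q‖) := by
  have hρ : 0 ≤ ρ := (norm_nonneg _).trans hR
  have hε : 0 ≤ ε := (norm_nonneg _).trans hR1
  have hc : ∀ p : 𝔼[d] →L[ℝ] ℝ, ‖p.comp R‖ ≤ ρ * ‖p‖ := fun p => by
    refine (p.opNorm_comp_le R).trans ?_
    rw [mul_comm]
    gcongr
  have hd : ∀ p : 𝔼[d] →L[ℝ] ℝ, ‖p.comp R - p‖ ≤ ε * ‖p‖ := fun p => by
    have e : p.comp R - p = p.comp (R - ContinuousLinearMap.id ℝ 𝔼[d]) := by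
      rw [ContinuousLinearMap.comp_sub, ContinuousLinearMap.comp_id]
    rw [e]
    refine (p.opNorm_comp_le _).trans ?_
    rw [mul_comm]
    gcongr
  constructor
  · refine (abs_inner_sharp_le _ _).trans ((mul_le_mul (hc p) (hc q) (norm_nonneg _)
      (by positivity)).trans_eq ?_)
    ring
  · have e : inner ℝ (sharp (p.comp R)) (sharp (q.comp R)) - inner ℝ (sharp p) (sharp q) =
        inner ℝ (sharp (p.comp R - p)) (sharp (q.comp R)) +
          inner ℝ (sharp p) (sharp (q.comp R - q)) := by
      rw [sharp_sub, sharp_sub, inner_sub_left, inner_sub_right]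
      ring
    rw [e]
    refine (abs_add_le _ _).trans ((add_le_add
      ((abs_inner_sharp_le _ _).trans (mul_le_mul (hd p) (hc q) (norm_nonneg _) (by positivity)))
      ((abs_inner_sharp_le _ _).trans (mul_le_mul_of_nonneg_left (hd q) (norm_nonneg _)))).trans_eq ?_)
    ring

/-- The change of the diffusion term under the mesh motion. -/
theorem IsMeshVelocity.abs_diffusionForm_sub_le (hY : IsMeshVelocity Ω T X Y A m M)
    (hΨ : IsFlowInverse Ω (fun x => (t : ℝ) • Y x) (t * m) Ψ) (hΩ : IsOpen Ω)
    (hΩb : Bornology.IsBounded Ω) {j : ℝ} (hj0 : 0 ≤ j)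
    (hj : ∀ K ∈ T, |(|LinearMap.det (LinearMap.id + (t : ℝ) • (A K).linear)| - 1)| ≤ t * j)
    {Da : 𝔼[d] → 𝔼[d] →L[ℝ] ℝ} (hDa : HasWeakFDeriv Ω a Da) (ha : MemLp a ⊤ (volume.restrict Ω))
    (hDa1 : MemLp Da ⊤ (volume.restrict Ω)) (hu : HasH10Deriv Ω u Du) (hv : HasH10Deriv Ω v Dv) :
    |diffusionForm Ω a (transportDeriv Ψ Du) (transportDeriv Ψ Dv) - diffusionForm Ω a Du Dv| ≤
      t * (lpNorm Da ⊤ (volume.restrict Ω) * M * (1 + t * j) * (1 - t * m : ℝ)⁻¹ ^ 2 +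
        lpNorm a ⊤ (volume.restrict Ω) * (j * (1 - t * m : ℝ)⁻¹ ^ 2 +
          m * (1 - t * m : ℝ)⁻¹ ^ 2 + m * (1 - t * m : ℝ)⁻¹)) *
        (lpNorm Du 2 (volume.restrict Ω) * lpNorm Dv 2 (volume.restrict Ω)) := by
  set ρ := (1 - t * m : ℝ)⁻¹ with hρdef
  have hρ : 0 ≤ ρ := by
    have : (t * m : ℝ) < 1 := by exact_mod_cast hΨ.lt_one
    exact inv_nonneg.2 (by linarith)
  set La := lpNorm Da ⊤ (volume.restrict Ω)
  set Na := lpNorm a ⊤ (volume.restrict Ω)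
  have hLa : 0 ≤ La := lpNorm_nonneg
  have hNa : 0 ≤ Na := lpNorm_nonneg
  have ht := t.coe_nonneg
  refine hΨ.abs_integral_sub_le hΩ (integrable_diffusion ha
    (hΨ.hasH10Deriv_comp hΩ hΩb hu).memLp_deriv (hΨ.hasH10Deriv_comp hΩ hΩb hv).memLp_deriv)
    (integrable_diffusion ha hu.memLp_deriv hv.memLp_deriv) hu.memLp_deriv hv.memLp_deriv
    (by positivity) ?_
  filter_upwards [hY.ae_flow_bounds hΨ hj, hΨ.ae_norm_sub_le hΩ hΩb hDa ha hDa1,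
    ae_le_lpNorm_exponent_top ha] with y ⟨hJ, hR, hR1⟩ hay hay1
  simp only [transportDeriv]
  rw [hΨ.left_inv y]
  set J := |(fderiv ℝ (fun y => y + (t : ℝ) • Y y) y).det|
  have hJ0 : 0 ≤ J := abs_nonneg _
  set R := fderiv ℝ Ψ (y + (t : ℝ) • Y y)
  obtain ⟨hi1, hi2⟩ := abs_inner_sharp_comp_sub_le (Du y) (Dv y) R hR hR1
  set I := inner ℝ (sharp ((Du y).comp R)) (sharp ((Dv y).comp R))
  set I₀ := inner ℝ (sharp (Du y)) (sharp (Dv y))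
  set N := ‖Du y‖ * ‖Dv y‖
  have hN : 0 ≤ N := by positivity
  have hJ1 : J ≤ 1 + t * j := by linarith [(abs_le.1 hJ).2]
  have hay2 : |a (y + (t : ℝ) • Y y) - a y| ≤ La * (t * M) := by
    refine hay.trans (mul_le_mul_of_nonneg_left ?_ hLa)
    rw [norm_smul, Real.norm_of_nonneg ht]
    exact mul_le_mul_of_nonneg_left (hY.nnnorm_le y) ht
  -- The changes in the coefficient, the Jacobian and the two gradients are separated. As `t → 0`,
  -- the Jacobian gives one `m` and the gradients give two.
  have e : J * (a (y + (t : ℝ) • Y y) * I) - a y * I₀ =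
      (a (y + (t : ℝ) • Y y) - a y) * J * I + a y * ((J - 1) * I + (I - I₀)) := by ring
  rw [e]
  have hay3 : |a y| ≤ Na := hay1
  calc |(a (y + (t : ℝ) • Y y) - a y) * J * I + a y * ((J - 1) * I + (I - I₀))|
      ≤ |a (y + (t : ℝ) • Y y) - a y| * J * |I| + |a y| * (|J - 1| * |I| + |I - I₀|) := by
        refine (abs_add_le _ _).trans ?_
        rw [abs_mul, abs_mul, abs_mul, abs_of_nonneg hJ0, ← abs_mul (J - 1)]
        gcongr
        exact abs_add_le _ _
    _ ≤ La * (t * M) * (1 + t * j) * (ρ ^ 2 * N) +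
          Na * (t * j * (ρ ^ 2 * N) + (t * (m * ρ) * ρ + t * (m * ρ)) * N) := by
        gcongr
    _ = _ := by ring

/-- The change of the transport term under the mesh motion. -/
theorem IsMeshVelocity.abs_transportForm_sub_le (hY : IsMeshVelocity Ω T X Y A m M)
    (hΨ : IsFlowInverse Ω (fun x => (t : ℝ) • Y x) (t * m) Ψ) (hΩ : IsOpen Ω)
    (hΩb : Bornology.IsBounded Ω) {j : ℝ} (hj0 : 0 ≤ j)
    (hj : ∀ K ∈ T, |(|LinearMap.det (LinearMap.id + (t : ℝ) • (A K).linear)| - 1)| ≤ t * j)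
    {Db : 𝔼[d] → 𝔼[d] →L[ℝ] 𝔼[d]} (hDb : HasWeakFDeriv Ω b Db)
    (hb : MemLp b ⊤ (volume.restrict Ω)) (hDb1 : MemLp Db ⊤ (volume.restrict Ω))
    (hu : HasH10Deriv Ω u Du) (hv : HasH10Deriv Ω v Dv) :
    |transportForm Ω b (transportDeriv Ψ Du) (fun y => v (Ψ y)) - transportForm Ω b Du v| ≤
      t * (lpNorm Db ⊤ (volume.restrict Ω) * M * (1 + t * j) * (1 - t * m : ℝ)⁻¹ +
        lpNorm b ⊤ (volume.restrict Ω) * (j * (1 - t * m : ℝ)⁻¹ + m * (1 - t * m : ℝ)⁻¹)) *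
        (lpNorm Du 2 (volume.restrict Ω) * lpNorm v 2 (volume.restrict Ω)) := by
  set ρ := (1 - t * m : ℝ)⁻¹ with hρdef
  have hρ : 0 ≤ ρ := by
    have : (t * m : ℝ) < 1 := by exact_mod_cast hΨ.lt_one
    exact inv_nonneg.2 (by linarith)
  set Lb := lpNorm Db ⊤ (volume.restrict Ω)
  set Nb := lpNorm b ⊤ (volume.restrict Ω)
  have hLb : 0 ≤ Lb := lpNorm_nonneg
  have hNb : 0 ≤ Nb := lpNorm_nonneg
  have ht := t.coe_nonneg
  refine hΨ.abs_integral_sub_le hΩ (integrable_transport hb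
    (hΨ.hasH10Deriv_comp hΩ hΩb hu).memLp_deriv (hΨ.hasH10Deriv_comp hΩ hΩb hv).memLp)
    (integrable_transport hb hu.memLp_deriv hv.memLp) hu.memLp_deriv hv.memLp
    (by positivity) ?_
  filter_upwards [hY.ae_flow_bounds hΨ hj, hΨ.ae_norm_sub_le hΩ hΩb hDb hb hDb1,
    ae_le_lpNorm_exponent_top hb] with y ⟨hJ, hR, hR1⟩ hby hby1
  simp only [transportDeriv]
  rw [hΨ.left_inv y, ContinuousLinearMap.comp_apply]
  set J := |(fderiv ℝ (fun y => y + (t : ℝ) • Y y) y).det|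
  have hJ0 : 0 ≤ J := abs_nonneg _
  set R := fderiv ℝ Ψ (y + (t : ℝ) • Y y)
  set b' := b (y + (t : ℝ) • Y y)
  have hJ1 : J ≤ 1 + t * j := by linarith [(abs_le.1 hJ).2]
  have hby2 : ‖b' - b y‖ ≤ Lb * (t * M) := by
    refine hby.trans (mul_le_mul_of_nonneg_left ?_ hLb)
    rw [norm_smul, Real.norm_of_nonneg ht]
    exact mul_le_mul_of_nonneg_left (hY.nnnorm_le y) ht
  have hD : ∀ (S : 𝔼[d] →L[ℝ] 𝔼[d]) (z : 𝔼[d]) (σ β : ℝ), ‖S‖ ≤ σ → ‖z‖ ≤ β →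
      |Du y (S z)| ≤ ‖Du y‖ * (σ * β) := fun S z σ β hS hz =>
    (Du y).le_opNorm_of_le ((S.le_opNorm z).trans
      (mul_le_mul hS hz (norm_nonneg _) ((norm_nonneg _).trans hS)))
  -- Only one gradient is transported here, because `v ∘ Ψ` pulls back to `v`; the limiting factor
  -- is `2 m`.
  have e : J * (Du y (R b') * v y) - Du y (b y) * v y =
      (J * Du y (R (b' - b y)) + (J - 1) * Du y (R (b y)) +
        Du y ((R - ContinuousLinearMap.id ℝ 𝔼[d]) (b y))) * v y := by
    simp only [map_sub, _root_.sub_apply, ContinuousLinearMap.id_apply]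
    ring
  rw [e, abs_mul]
  calc |J * Du y (R (b' - b y)) + (J - 1) * Du y (R (b y)) +
        Du y ((R - ContinuousLinearMap.id ℝ 𝔼[d]) (b y))| * |v y|
      ≤ (J * |Du y (R (b' - b y))| + |J - 1| * |Du y (R (b y))| +
        |Du y ((R - ContinuousLinearMap.id ℝ 𝔼[d]) (b y))|) * |v y| := by
        gcongr
        refine (abs_add_three _ _ _).trans ?_
        rw [abs_mul, abs_mul, abs_of_nonneg hJ0]
    _ ≤ ((1 + t * j) * (‖Du y‖ * (ρ * (Lb * (t * M)))) + t * j * (‖Du y‖ * (ρ * Nb)) +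
        ‖Du y‖ * (t * (m * ρ) * Nb)) * |v y| := by
        gcongr
        · exact hD _ _ _ _ hR hby2
        · exact hD _ _ _ _ hR hby1
        · exact hD _ _ _ _ hR1 hby1
    _ = _ := by
        rw [Real.norm_eq_abs]
        ring

/-- The `L²` norm of the factor by which increments along the flow exceed their linearization. -/
noncomputable def flowFactor (d : ℕ) (K : ℝ) : ℝ := ((1 - K * (1 - K)⁻¹)⁻¹ ^ d) ^ (1 / 2 : ℝ)

theorem tendsto_flowFactor : Tendsto (flowFactor d) (𝓝 0) (𝓝 1) := by
  have : ContinuousAt (flowFactor d) 0 := by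
    unfold flowFactor
    refine ContinuousAt.rpow_const ?_ (Or.inr (by norm_num))
    refine ContinuousAt.pow (ContinuousAt.inv₀ ?_ (by norm_num)) d
    refine continuousAt_const.sub (continuousAt_id.mul (ContinuousAt.inv₀ ?_ (by norm_num)))
    exact continuousAt_const.sub continuousAt_id
  have h := this.tendsto
  have e : flowFactor d 0 = 1 := by simp [flowFactor]
  rwa [e] at h

theorem IsMeshVelocity.lpNorm_comp_sub_le (hY : IsMeshVelocity Ω T X Y A m M)
    (hΨ : IsFlowInverse Ω (fun x => (t : ℝ) • Y x) (t * m) Ψ) (ht : t * m < 1 / 2)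
    (hu : HasH10Deriv Ω u Du) :
    lpNorm ((fun y => u (Ψ y)) - u) 2 (volume.restrict Ω) ≤
      t * M * (flowFactor d (t * m) * lpNorm Du 2 (volume.restrict Ω)) := by
  -- The displacement of the inverse has Lipschitz constant `K / (1 - K)` with `K = t m`, which is
  -- below one exactly for `K < 1 / 2`.
  have hK : (t * m) * (1 - t * m)⁻¹ < 1 := by
    rw [← NNReal.coe_lt_coe, NNReal.coe_mul, NNReal.coe_inv, NNReal.coe_sub hΨ.lt_one.le]
    have h2 : ((t * m : NNReal) : ℝ) < 1 / 2 := by exact_mod_cast ht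
    rw [NNReal.coe_one, ← div_eq_mul_inv, div_lt_one (by linarith)]
    linarith
  have h := hu.lpNorm_displacement_le hK hΨ.neg_disp (M := t * M) (fun y hy => ?_) (fun y => ?_)
  · have e : (fun y => u (y + -((t : ℝ) • Y (Ψ y))) - u y) = (fun y => u (Ψ y)) - u := by
      ext y
      rw [← hΨ.eq_add y]
      rfl
    rw [e] at h
    refine h.trans_eq ?_
    rw [flowFactor, NNReal.coe_mul, NNReal.coe_mul, NNReal.coe_inv, NNReal.coe_sub hΨ.lt_one.le,
      NNReal.coe_one, NNReal.coe_mul]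
  · rw [hΨ.apply_of_notMem hy, hY.zero y hy, smul_zero, neg_zero]
  · rw [nnnorm_neg, nnnorm_smul]
    have : ‖(t : ℝ)‖₊ = t := by simp
    rw [this]
    exact mul_le_mul_right (hY.nnnorm_le _) t

/-- The change of the reaction term under the mesh motion. -/
theorem IsMeshVelocity.abs_reactionForm_sub_le (hY : IsMeshVelocity Ω T X Y A m M)
    (hΨ : IsFlowInverse Ω (fun x => (t : ℝ) • Y x) (t * m) Ψ) (hΩ : IsOpen Ω)
    (hΩb : Bornology.IsBounded Ω) (ht : t * m < 1 / 2)
    (hc : MemLp c ⊤ (volume.restrict Ω)) (hu : HasH10Deriv Ω u Du) (hv : HasH10Deriv Ω v Dv) :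
    |reactionForm Ω c (fun y => u (Ψ y)) (fun y => v (Ψ y)) - reactionForm Ω c u v| ≤
      t * (lpNorm c ⊤ (volume.restrict Ω) * (M * flowFactor d (t * m) *
        (lpNorm Du 2 (volume.restrict Ω) * (lpNorm v 2 (volume.restrict Ω) +
          t * M * (flowFactor d (t * m) * lpNorm Dv 2 (volume.restrict Ω))) +
        lpNorm u 2 (volume.restrict Ω) * lpNorm Dv 2 (volume.restrict Ω)))) := by
  have hu' := (hΨ.hasH10Deriv_comp hΩ hΩb hu).memLp
  have hv' := (hΨ.hasH10Deriv_comp hΩ hΩb hv).memLp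
  have du := hY.lpNorm_comp_sub_le hΨ ht hu
  have dv := hY.lpNorm_comp_sub_le hΨ ht hv
  have nv : lpNorm (fun y => v (Ψ y)) 2 (volume.restrict Ω) ≤ lpNorm v 2 (volume.restrict Ω) +
      t * M * (flowFactor d (t * m) * lpNorm Dv 2 (volume.restrict Ω)) := by
    have := lpNorm_le_lpNorm_add_lpNorm_sub' (f := fun y => v (Ψ y)) hv.memLp (by norm_num : (1 : ℝ≥0∞) ≤ 2)
    linarith
  have hN : 0 ≤ lpNorm c ⊤ (volume.restrict Ω) := lpNorm_nonneg
  -- The integrals are compared at the same point of `Ω` without a change of variables, so `c` is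
  -- never differentiated. The price is one increment for each factor, whence the `2` in front of
  -- `‖c‖` in the final estimate.
  have e : reactionForm Ω c (fun y => u (Ψ y)) (fun y => v (Ψ y)) - reactionForm Ω c u v =
      reactionForm Ω c ((fun y => u (Ψ y)) - u) (fun y => v (Ψ y)) +
        reactionForm Ω c u ((fun y => v (Ψ y)) - v) := by
    rw [reactionForm, reactionForm, reactionForm, reactionForm,
      ← integral_sub (integrable_reaction hc hu' hv') (integrable_reaction hc hu.memLp hv.memLp),
      ← integral_add (integrable_reaction hc (hu'.sub hu.memLp) hv')
        (integrable_reaction hc hu.memLp (hv'.sub hv.memLp))]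
    refine integral_congr_ae (ae_of_all _ fun x => ?_)
    simp only [Pi.sub_apply]
    ring
  rw [e]
  refine (abs_add_le _ _).trans ((add_le_add (abs_reactionForm_le hc (hu'.sub hu.memLp) hv')
    (abs_reactionForm_le hc hu.memLp (hv'.sub hv.memLp))).trans ?_)
  have hff : 0 ≤ t * M * (flowFactor d (t * m) * lpNorm Du 2 (volume.restrict Ω)) :=
    lpNorm_nonneg.trans du
  calc _ ≤ lpNorm c ⊤ (volume.restrict Ω) *
        (t * M * (flowFactor d (t * m) * lpNorm Du 2 (volume.restrict Ω)) *
          (lpNorm v 2 (volume.restrict Ω) +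
          t * M * (flowFactor d (t * m) * lpNorm Dv 2 (volume.restrict Ω)))) +
        lpNorm c ⊤ (volume.restrict Ω) * (lpNorm u 2 (volume.restrict Ω) *
          (t * M * (flowFactor d (t * m) * lpNorm Dv 2 (volume.restrict Ω)))) := by
        refine add_le_add (mul_le_mul_of_nonneg_left ?_ hN)
          (mul_le_mul_of_nonneg_left (mul_le_mul_of_nonneg_left dv lpNorm_nonneg) hN)
        exact mul_le_mul du nv lpNorm_nonneg hff
    _ = _ := by ring

/-- The change of the load term under the mesh motion. -/
theorem IsMeshVelocity.abs_load_sub_le (hY : IsMeshVelocity Ω T X Y A m M)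
    (hΨ : IsFlowInverse Ω (fun x => (t : ℝ) • Y x) (t * m) Ψ) (hΩ : IsOpen Ω)
    (hΩb : Bornology.IsBounded Ω) (ht : t * m < 1 / 2)
    (hf : MemLp f 2 (volume.restrict Ω)) (hv : HasH10Deriv Ω v Dv) :
    |(∫ x in Ω, f x * v (Ψ x)) - ∫ x in Ω, f x * v x| ≤
      t * (lpNorm f 2 (volume.restrict Ω) * (M * flowFactor d (t * m) *
        lpNorm Dv 2 (volume.restrict Ω))) := by
  have hv' := (hΨ.hasH10Deriv_comp hΩ hΩb hv).memLp
  -- As for the reaction term, the increment is placed on `v` and `f` needs only to be in `L²`.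
  have e : (∫ x in Ω, f x * v (Ψ x)) - ∫ x in Ω, f x * v x =
      ∫ x in Ω, f x * ((fun y => v (Ψ y)) - v) x := by
    have h1 : Integrable (fun x => f x * v (Ψ x)) (volume.restrict Ω) := hf.integrable_mul hv'
    have h2 : Integrable (fun x => f x * v x) (volume.restrict Ω) := hf.integrable_mul hv.memLp
    rw [← integral_sub h1 h2]
    refine integral_congr_ae (ae_of_all _ fun x => ?_)
    simp only [Pi.sub_apply]
    ring
  rw [e]
  refine (abs_integral_mul_le hf (hv'.sub hv.memLp)).trans
    ((mul_le_mul_of_nonneg_left (hY.lpNorm_comp_sub_le hΨ ht hv) lpNorm_nonneg).trans_eq ?_)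
  ring

end Perturbation

/-! ### Differentiating the finite element equation in time -/

section Sensitivity

variable {d : ℕ}

local notation "𝔼[" d "]" => EuclideanSpace ℝ (Fin d)

/-- In the normed space `Lp` the combination is a continuous function of its coefficients. This lets
the norms of the solutions at time `t` converge to those at time `0`. -/
theorem continuous_lpNorm_sum_smul {α E ι : Type*} [MeasurableSpace α] {μ : Measure α}
    [NormedAddCommGroup E] [NormedSpace ℝ E] [Fintype ι] {D : ι → α → E}
    (hD : ∀ i, MemLp (D i) 2 μ) :
    Continuous fun r : ι → ℝ => lpNorm (∑ i, r i • D i) 2 μ := by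
  have hs : ∀ r : ι → ℝ, MemLp (∑ i, r i • D i) 2 μ := fun r =>
    memLp_finsetSum' _ fun i _ => (hD i).const_smul (r i)
  have key : ∀ (r : ι → ℝ) (s : Finset ι), ∃ h : MemLp (∑ i ∈ s, r i • D i) 2 μ,
      h.toLp = ∑ i ∈ s, r i • (hD i).toLp := fun r s => by
    classical
    induction s using Finset.induction_on with
    | empty => exact ⟨by simp, by simp⟩
    | insert i s hi ih =>
      obtain ⟨h, e⟩ := ih
      simp only [Finset.sum_insert hi]
      exact ⟨((hD i).const_smul (r i)).add h, by
        rw [MemLp.toLp_add ((hD i).const_smul (r i)) h, e, MemLp.toLp_const_smul]⟩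
  have e : (fun r : ι → ℝ => lpNorm (∑ i, r i • D i) 2 μ) =
      fun r => ‖∑ i, r i • (hD i).toLp‖ := by
    ext r
    obtain ⟨h, e⟩ := key r Finset.univ
    rw [← e, Lp.norm_toLp, toReal_eLpNorm h.1]
  rw [e]
  fun_prop

variable {Ω : Set 𝔼[d]} {T : Finset (Finset 𝔼[d])} {X Y Ψ : 𝔼[d] → 𝔼[d]}
  {A : Finset 𝔼[d] → 𝔼[d] →ᵃ[ℝ] 𝔼[d]} {m M t : NNReal}
  {a c f u v : 𝔼[d] → ℝ} {b : 𝔼[d] → 𝔼[d]} {Du Dv : 𝔼[d] → 𝔼[d] →L[ℝ] ℝ}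

/-- The residual of the pulled back finite element solution in the equation on the initial mesh. -/
theorem IsMeshVelocity.energyForm_sub_le (hY : IsMeshVelocity Ω T X Y A m M)
    (hΨ : IsFlowInverse Ω (fun x => (t : ℝ) • Y x) (t * m) Ψ) (hT : IsSimplicialMesh Ω T)
    (hΩ : IsOpen Ω) (ht : t * m < 1 / 2) {j : ℝ} (hj0 : 0 ≤ j)
    (hj : ∀ K ∈ T, |(|LinearMap.det (LinearMap.id + (t : ℝ) • (A K).linear)| - 1)| ≤ t * j)
    {Da : 𝔼[d] → 𝔼[d] →L[ℝ] ℝ} {Db : 𝔼[d] → 𝔼[d] →L[ℝ] 𝔼[d]} (hDa : HasWeakFDeriv Ω a Da)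
    (ha : MemLp a ⊤ (volume.restrict Ω)) (hDa1 : MemLp Da ⊤ (volume.restrict Ω))
    (hDb : HasWeakFDeriv Ω b Db) (hb : MemLp b ⊤ (volume.restrict Ω))
    (hDb1 : MemLp Db ⊤ (volume.restrict Ω)) (hc : MemLp c ⊤ (volume.restrict Ω))
    (hf : MemLp f 2 (volume.restrict Ω)) (hu : HasH10Deriv Ω u Du) (hv : HasH10Deriv Ω v Dv)
    {r : ℕ} (hvT : v ∈ feSpace Ω T r)
    (hs : IsFESolution Ω (deformedMesh T X t) r a b c f (fun y => u (Ψ y))) :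
    energyForm Ω a b c u Du v Dv - ∫ x in Ω, f x * v x ≤
      t * ((lpNorm Da ⊤ (volume.restrict Ω) * M * (1 + t * j) * (1 - t * m : ℝ)⁻¹ ^ 2 +
          lpNorm a ⊤ (volume.restrict Ω) * (j * (1 - t * m : ℝ)⁻¹ ^ 2 +
            m * (1 - t * m : ℝ)⁻¹ ^ 2 + m * (1 - t * m : ℝ)⁻¹)) *
          (lpNorm Du 2 (volume.restrict Ω) * lpNorm Dv 2 (volume.restrict Ω)) +
        (lpNorm Db ⊤ (volume.restrict Ω) * M * (1 + t * j) * (1 - t * m : ℝ)⁻¹ +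
          lpNorm b ⊤ (volume.restrict Ω) * (j * (1 - t * m : ℝ)⁻¹ + m * (1 - t * m : ℝ)⁻¹)) *
          (lpNorm Du 2 (volume.restrict Ω) * lpNorm v 2 (volume.restrict Ω)) +
        lpNorm c ⊤ (volume.restrict Ω) * (M * flowFactor d (t * m) *
          (lpNorm Du 2 (volume.restrict Ω) * (lpNorm v 2 (volume.restrict Ω) +
            t * M * (flowFactor d (t * m) * lpNorm Dv 2 (volume.restrict Ω))) +
          lpNorm u 2 (volume.restrict Ω) * lpNorm Dv 2 (volume.restrict Ω))) +
        lpNorm f 2 (volume.restrict Ω) * (M * flowFactor d (t * m) *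
          lpNorm Dv 2 (volume.restrict Ω))) := by
  have hΩb := hT.isBounded
  -- The equation on the deformed mesh, tested with `v ∘ Ψ`. The four perturbation bounds move it to
  -- the initial mesh.
  have e := hs.energyForm_eq hΩ ha hb hc (hY.comp_mem_feSpace hT hΩ hΨ.lt_one hΨ hvT)
    (hΨ.hasH10Deriv_comp hΩ hΩb hu) (hΨ.hasH10Deriv_comp hΩ hΩb hv)
  have h1 := neg_le_of_abs_le (hY.abs_diffusionForm_sub_le hΨ hΩ hΩb hj0 hj hDa ha hDa1 hu hv)
  have h2 := neg_le_of_abs_le (hY.abs_transportForm_sub_le hΨ hΩ hΩb hj0 hj hDb hb hDb1 hu hv)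
  have h3 := neg_le_of_abs_le (hY.abs_reactionForm_sub_le hΨ hΩ hΩb ht hc hu hv)
  have h4 := le_of_abs_le (hY.abs_load_sub_le hΨ hΩ hΩb ht hf hv)
  rw [energyForm] at e ⊢
  rw [← e] at h4
  linarith

/-- The energy of the material derivative of the finite element solutions. -/
theorem IsMeshVelocity.energyForm_material_le (hY : IsMeshVelocity Ω T X Y A m M)
    (hT : IsSimplicialMesh Ω T) (hΩ : IsOpen Ω)
    {Da : 𝔼[d] → 𝔼[d] →L[ℝ] ℝ} {Db : 𝔼[d] → 𝔼[d] →L[ℝ] 𝔼[d]} (hDa : HasWeakFDeriv Ω a Da)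
    (ha : MemLp a ⊤ (volume.restrict Ω)) (hDa1 : MemLp Da ⊤ (volume.restrict Ω))
    (hDb : HasWeakFDeriv Ω b Db) (hb : MemLp b ⊤ (volume.restrict Ω))
    (hDb1 : MemLp Db ⊤ (volume.restrict Ω)) (hc : MemLp c ⊤ (volume.restrict Ω))
    (hf : MemLp f 2 (volume.restrict Ω)) {r : ℕ} {ι : Type*} [Fintype ι] {w : ι → 𝔼[d] → ℝ}
    {Dw : ι → 𝔼[d] → 𝔼[d] →L[ℝ] ℝ} (hw : ∀ i, HasH10Deriv Ω (w i) (Dw i))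
    (hwT : ∀ i, w i ∈ feSpace Ω T r) {δ : ℝ} (hδ : 0 < δ) {q : ℝ → ι → ℝ}
    {uh : ℝ → 𝔼[d] → ℝ}
    (huh : ∀ t ∈ Ico 0 δ, IsFESolution Ω (deformedMesh T X t) r a b c f (uh t))
    (hq : ∀ t ∈ Ico 0 δ, IsTransported T X t (∑ i, q t i • w i) (uh t)) {q' : ι → ℝ}
    (hq' : ∀ i, HasDerivWithinAt (fun t => q t i) (q' i) (Ici 0) 0) :
    (∀ v Dv, v ∈ feSpace Ω T r → HasH10Deriv Ω v Dv →
      energyForm Ω a b c (∑ i, q 0 i • w i) (∑ i, q 0 i • Dw i) v Dv = ∫ x in Ω, f x * v x) ∧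
    energyForm Ω a b c (∑ i, q' i • w i) (∑ i, q' i • Dw i)
        (∑ i, q' i • w i) (∑ i, q' i • Dw i) ≤
      (lpNorm Da ⊤ (volume.restrict Ω) * M + 3 * m * lpNorm a ⊤ (volume.restrict Ω)) *
          (lpNorm (∑ i, q 0 i • Dw i) 2 (volume.restrict Ω) *
            lpNorm (∑ i, q' i • Dw i) 2 (volume.restrict Ω)) +
        (lpNorm Db ⊤ (volume.restrict Ω) * M + 2 * m * lpNorm b ⊤ (volume.restrict Ω)) *
          (lpNorm (∑ i, q 0 i • Dw i) 2 (volume.restrict Ω) *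
            lpNorm (∑ i, q' i • w i) 2 (volume.restrict Ω)) +
        lpNorm c ⊤ (volume.restrict Ω) * M *
          (lpNorm (∑ i, q 0 i • Dw i) 2 (volume.restrict Ω) *
            lpNorm (∑ i, q' i • w i) 2 (volume.restrict Ω) +
          lpNorm (∑ i, q 0 i • w i) 2 (volume.restrict Ω) *
            lpNorm (∑ i, q' i • Dw i) 2 (volume.restrict Ω)) +
        lpNorm f 2 (volume.restrict Ω) * M *
          lpNorm (∑ i, q' i • Dw i) 2 (volume.restrict Ω) := by
  have hsum : ∀ s : ι → ℝ, HasH10Deriv Ω (∑ i, s i • w i) (∑ i, s i • Dw i) := fun s =>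
    HasH10Deriv.sum _ fun i _ => (hw i).smul (s i)
  have hsumT : ∀ s : ι → ℝ, (∑ i, s i • w i) ∈ feSpace Ω T r := fun s =>
    Submodule.sum_mem _ fun i _ => Submodule.smul_mem _ _ (hwT i)
  have huhΨ : ∀ (t : NNReal) (Ψ : 𝔼[d] → 𝔼[d]), (t : ℝ) < δ →
      IsFlowInverse Ω (fun x => (t : ℝ) • Y x) (t * m) Ψ →
      IsFESolution Ω (deformedMesh T X t) r a b c f (fun y => (∑ i, q t i • w i) (Ψ y)) := by
    intro t Ψ ht hΨ
    have htm : (t : ℝ) ∈ Ico 0 δ := ⟨t.coe_nonneg, ht⟩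
    have e := hY.eq_comp_of_isTransported hT hΨ (hq t htm) (hsumT (q t)).2.2.1
      (huh t htm).1.2.2.1
    have := huh t htm
    rwa [e] at this
  have h0 : ∀ v Dv, v ∈ feSpace Ω T r → HasH10Deriv Ω v Dv →
      energyForm Ω a b c (∑ i, q 0 i • w i) (∑ i, q 0 i • Dw i) v Dv = ∫ x in Ω, f x * v x := by
    intro v Dv hvT hv
    -- The equation at time `0` is posed on `deformedMesh T X 0`. The flow at `t = 0`, whose inverse
    -- is the identity, identifies its solution and test functions with those on `T`.
    obtain ⟨Ψ, hΨ⟩ := hY.exists_flowInverse (t := 0) (by simp)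
    have hid : ∀ y, Ψ y = y := fun y => by
      have := hΨ.right_inv y
      simpa using this
    have hs := huhΨ 0 Ψ (by simpa using hδ) hΨ
    have hv' := hY.comp_mem_feSpace hT hΩ (by simp) hΨ hvT
    simp only [hid, NNReal.coe_zero] at hs hv'
    exact hs.energyForm_eq hΩ ha hb hc hv' (hsum (q 0)) hv
  refine ⟨h0, ?_⟩
  obtain ⟨j, hjl, hj⟩ := exists_jacobian_bound T (fun K => (A K).linear) hY.trace_le
  set v := ∑ i, q' i • w i
  set Dv := ∑ i, q' i • Dw i
  have hv : HasH10Deriv Ω v Dv := hsum q'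
  have hvT : v ∈ feSpace Ω T r := hsumT q'
  set e : ι → ℝ := fun i => energyForm Ω a b c (w i) (Dw i) v Dv
  have he : ∀ s : ι → ℝ, energyForm Ω a b c (∑ i, s i • w i) (∑ i, s i • Dw i) v Dv =
      ∑ i, s i * e i := energyForm_sum _ ha hb hc hw hv
  -- With the test function fixed as the material derivative, the one-sided derivative of the form
  -- at `0` is the energy of the material derivative itself.
  have hderiv : HasDerivWithinAt (fun t => ∑ i, q t i * e i) (∑ i, q' i * e i) (Ici 0) 0 :=
    HasDerivWithinAt.fun_sum fun i _ => (hq' i).mul_const (e i)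
  rw [← hasDerivWithinAt_Ioi_iff_Ici, hasDerivWithinAt_iff_tendsto_slope' (by simp)] at hderiv
  rw [he]
  have hq0 : Tendsto q (𝓝[>] 0) (𝓝 (q 0)) := by
    refine tendsto_pi_nhds.2 fun i => ?_
    exact (hq' i).continuousWithinAt.tendsto.mono_left (nhdsWithin_mono _ Ioi_subset_Ici_self)
  have hn := ((continuous_lpNorm_sum_smul fun i => (hw i).memLp_deriv).tendsto (q 0)).comp hq0
  have hU := ((continuous_lpNorm_sum_smul fun i => (hw i).memLp).tendsto (q 0)).comp hq0
  have hid : Tendsto (fun t : ℝ => t) (𝓝[>] 0) (𝓝 0) := nhdsWithin_le_nhds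
  have htm : Tendsto (fun t : ℝ => t * m) (𝓝[>] 0) (𝓝 0) := by
    simpa using hid.mul_const (m : ℝ)
  have hρ : Tendsto (fun t : ℝ => (1 - t * m : ℝ)⁻¹) (𝓝[>] 0) (𝓝 1) := by
    simpa using (htm.const_sub 1).inv₀ (by norm_num)
  have hφ : Tendsto (fun t : ℝ => flowFactor d (t * m)) (𝓝[>] 0) (𝓝 1) :=
    (tendsto_flowFactor (d := d)).comp htm
  set La := lpNorm Da ⊤ (volume.restrict Ω)
  set Na := lpNorm a ⊤ (volume.restrict Ω)
  set Lb := lpNorm Db ⊤ (volume.restrict Ω)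
  set Nb := lpNorm b ⊤ (volume.restrict Ω)
  set Nc := lpNorm c ⊤ (volume.restrict Ω)
  set Nf := lpNorm f 2 (volume.restrict Ω)
  set Nv := lpNorm v 2 (volume.restrict Ω)
  set NDv := lpNorm Dv 2 (volume.restrict Ω)
  -- The bound on the difference quotient, as a continuous function of all `t`-dependent quantities.
  -- In the limit `t = 0`, `j = m`, `ρ = φ = 1`, and `n`, `U` are the norms at time `0`.
  let G : ℝ × ℝ × ℝ × ℝ × ℝ × ℝ → ℝ := fun ⟨t, j, ρ, φ, n, U⟩ =>
    (La * M * (1 + t * j) * ρ ^ 2 + Na * (j * ρ ^ 2 + m * ρ ^ 2 + m * ρ)) * (n * NDv) +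
      (Lb * M * (1 + t * j) * ρ + Nb * (j * ρ + m * ρ)) * (n * Nv) +
      Nc * (M * φ * (n * (Nv + t * M * (φ * NDv)) + U * NDv)) + Nf * (M * φ * NDv)
  have hG : Continuous G := by
    unfold G
    fun_prop
  have hlim := (hG.tendsto _).comp (hid.prodMk_nhds (hjl.prodMk_nhds (hρ.prodMk_nhds
    (hφ.prodMk_nhds (hn.prodMk_nhds hU)))))
  refine (le_of_tendsto_of_tendsto hderiv hlim ?_).trans_eq ?_
  · filter_upwards [self_mem_nhdsWithin, hid.eventually (gt_mem_nhds hδ),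
      htm.eventually (gt_mem_nhds (by norm_num : (0 : ℝ) < 1 / 2))] with t ht0 htδ ht2
    obtain ⟨t, rfl⟩ : ∃ s : NNReal, (s : ℝ) = t := ⟨⟨t, ht0.le⟩, rfl⟩
    have ht3 : t * m < 1 / 2 := by exact_mod_cast ht2
    obtain ⟨Ψ, hΨ⟩ := hY.exists_flowInverse (t := t) (ht3.trans (by norm_num))
    have hjt := hj t t.coe_nonneg
    have key := hY.energyForm_sub_le hΨ hT hΩ ht3 (m.coe_nonneg.trans hjt.1) hjt.2 hDa ha hDa1
      hDb hb hDb1 hc hf (hsum (q t)) hv hvT (huhΨ t Ψ htδ hΨ)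
    -- The load is replaced by the form at time `0`, so the residual bound becomes a bound on the
    -- slope.
    rw [← h0 v Dv hvT hv, he, he] at key
    rw [slope_def_field, sub_zero, div_le_iff₀' ht0]
    exact key
  · simp only [G]
    ring

end Sensitivity

/-- Here `n`, `U` are the norms of `∇u_0`, `u_0` and `D`, `V` those of `∇u̇`, `u̇`. The stability
estimate `n ≤ C F / a₀` and Poincaré make the right-hand side of `h` a multiple of `D`, which
cancels. -/
theorem material_bound_of_energy_le {a₀ n D C La Na Lb Nb Nc F M N R k V U : ℝ} (ha₀ : 0 < a₀)
    (hn : 0 ≤ n) (hD : 0 ≤ D) (hC : 0 ≤ C) (hLa : 0 ≤ La) (hNa : 0 ≤ Na) (hLb : 0 ≤ Lb)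
    (hNb : 0 ≤ Nb) (hNc : 0 ≤ Nc) (hF : 0 ≤ F) (hM : 0 ≤ M) (hN : 0 ≤ N) (hR : 0 ≤ R) (hk : 0 ≤ k)
    (hV : V ≤ C * D) (hU : U ≤ C * n) (h0 : a₀ * n ^ 2 ≤ F * U)
    (h : a₀ * D ^ 2 ≤ (La * M + 3 * (k * (N * R)) * Na) * (n * D) +
      (Lb * M + 2 * (k * (N * R)) * Nb) * (n * V) + Nc * M * (n * V + U * D) + F * M * D) :
    a₀ * D ≤ F * (1 + C / a₀ * La + C ^ 2 / a₀ * Lb + 2 * C ^ 2 / a₀ * Nc) * M +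
      F * (3 * k * C / a₀ * Na + 2 * k * C ^ 2 / a₀ * Nb) * N * R := by
  rcases hD.eq_or_lt with rfl | hD
  · rw [mul_zero]
    positivity
  have hn1 : n ≤ C * F / a₀ := by
    rcases hn.eq_or_lt with rfl | hn
    · positivity
    rw [le_div_iff₀ ha₀]
    refine le_of_mul_le_mul_right ?_ hn
    calc n * a₀ * n = a₀ * n ^ 2 := by ring
      _ ≤ F * (C * n) := h0.trans (mul_le_mul_of_nonneg_left hU hF)
      _ = C * F * n := by ring
  refine le_of_mul_le_mul_right ?_ hD
  calc a₀ * D * D = a₀ * D ^ 2 := by ring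
    _ ≤ (La * M + 3 * (k * (N * R)) * Na) * (n * D) +
      (Lb * M + 2 * (k * (N * R)) * Nb) * (n * V) + Nc * M * (n * V + U * D) + F * M * D := h
    _ ≤ (La * M + 3 * (k * (N * R)) * Na) * (n * D) +
      (Lb * M + 2 * (k * (N * R)) * Nb) * (n * (C * D)) + Nc * M * (n * (C * D) + C * n * D) +
        F * M * D := by gcongr
    _ ≤ (La * M + 3 * (k * (N * R)) * Na) * (C * F / a₀ * D) +
      (Lb * M + 2 * (k * (N * R)) * Nb) * (C * F / a₀ * (C * D)) +
        Nc * M * (C * F / a₀ * (C * D) + C * (C * F / a₀) * D) + F * M * D := by gcongr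
    _ = _ := by ring

end MeshSensitivity

theorem theorem3p2 {d : ℕ} (hd : 1 ≤ d)
    -- the polyhedral domain and its mesh
    (Ω : Set (EuclideanSpace ℝ (Fin d))) (hΩo : IsOpen Ω) (hΩc : IsConnected Ω)
    (T : Finset (Finset (EuclideanSpace ℝ (Fin d))))
    (hT : MeshSensitivity.IsSimplicialMesh Ω T)
    (hheight : ∀ K ∈ T, 0 < MeshSensitivity.minHeight K)
    -- the data of the boundary value problem
    (a : EuclideanSpace ℝ (Fin d) → ℝ)
    (b : EuclideanSpace ℝ (Fin d) → EuclideanSpace ℝ (Fin d))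
    (c f : EuclideanSpace ℝ (Fin d) → ℝ) (a₀ : ℝ) (ha₀ : 0 < a₀)
    (ha : MeshSensitivity.MemW1 Ω ⊤ a) (hb : MeshSensitivity.MemW1 Ω ⊤ b)
    (hc : MeshSensitivity.MemW1 Ω ⊤ c) (hf : MeshSensitivity.MemW1 Ω 2 f)
    (haa₀ : ∀ᵐ x ∂(volume.restrict Ω), a₀ ≤ a x)
    (hcb : ∀ᵐ x ∂(volume.restrict Ω), 0 ≤ c x - 1 / 2 * MeshSensitivity.weakDiv Ω b x)
    -- the velocity field; it vanishes at the boundary vertices, which are kept fixed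
    (X : EuclideanSpace ℝ (Fin d) → EuclideanSpace ℝ (Fin d))
    (hXc : ContinuousOn X (closure Ω)) (hXd : ContDiffOn ℝ 1 X Ω)
    (hX : MemLp X ⊤ (volume.restrict Ω)) (hDX : MemLp (fderiv ℝ X) ⊤ (volume.restrict Ω))
    (hXb : ∀ K ∈ T, ∀ p ∈ K, p ∈ frontier Ω → X p = 0)
    -- a basis of the finite element space of degree `r`
    (r : ℕ) {ι : Type*} [Fintype ι]
    (ψ : Module.Basis ι ℝ (MeshSensitivity.feSpace Ω T r))
    -- the finite element solutions `uh t` on the deformed meshes, with coefficients `u t i`,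
    -- which are differentiable at `t = 0` with derivatives `u' i`
    (δ : ℝ) (hδ : 0 < δ) (u : ℝ → ι → ℝ) (uh : ℝ → EuclideanSpace ℝ (Fin d) → ℝ)
    (huh : ∀ t ∈ Ico 0 δ, MeshSensitivity.IsFESolution Ω (MeshSensitivity.deformedMesh T X t) r
      a b c f (uh t))
    (hu : ∀ t ∈ Ico 0 δ, MeshSensitivity.IsTransported T X t
      (∑ i, u t i • (ψ i : EuclideanSpace ℝ (Fin d) → ℝ)) (uh t))
    (u' : ι → ℝ) (hu' : ∀ i, HasDerivWithinAt (fun t => u t i) (u' i) (Ici 0) 0) :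
    a₀ * lpNorm (MeshSensitivity.weakGrad Ω
          (∑ i, u' i • (ψ i : EuclideanSpace ℝ (Fin d) → ℝ))) 2 (volume.restrict Ω)
      ≤ lpNorm f 2 (volume.restrict Ω)
          * (1 + MeshSensitivity.poincareConst Ω / a₀
                * lpNorm (MeshSensitivity.weakFDeriv Ω a) ⊤ (volume.restrict Ω)
              + MeshSensitivity.poincareConst Ω ^ 2 / a₀
                * lpNorm (MeshSensitivity.weakFDeriv Ω b) ⊤ (volume.restrict Ω)
              + 2 * MeshSensitivity.poincareConst Ω ^ 2 / a₀
                * lpNorm c ⊤ (volume.restrict Ω))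
          * lpNorm X ⊤ (volume.restrict Ω)
        + lpNorm f 2 (volume.restrict Ω)
          * (3 * d * MeshSensitivity.poincareConst Ω / a₀ * lpNorm a ⊤ (volume.restrict Ω)
              + 2 * d * MeshSensitivity.poincareConst Ω ^ 2 / a₀
                * lpNorm b ⊤ (volume.restrict Ω))
          * lpNorm (fderiv ℝ X) ⊤ (volume.restrict Ω)
          * MeshSensitivity.maxAspect T := by
  have hΩb := hT.isBounded
  obtain ⟨ha1, Da, hDa, hDa1⟩ := ha
  obtain ⟨hb1, Db, hDb, hDb1⟩ := hb
  have hDa' := (memLp_congr_ae (hDa.weakFDeriv_ae_eq hΩo)).2 hDa1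
  have hDb' := (memLp_congr_ae (hDb.weakFDeriv_ae_eq hΩo)).2 hDb1
  obtain ⟨Y, A, hY⟩ := hT.exists_isMeshVelocity hheight hΩo hXc hXd hX hDX hXb
  have hw : ∀ i, MeshSensitivity.HasH10Deriv Ω (ψ i : EuclideanSpace ℝ (Fin d) → ℝ)
      (MeshSensitivity.weakFDeriv Ω (ψ i : EuclideanSpace ℝ (Fin d) → ℝ)) := fun i =>
    (ψ i).2.1.hasH10Deriv hΩo
  have hsum : ∀ s : ι → ℝ, MeshSensitivity.HasH10Deriv Ω
      (∑ i, s i • (ψ i : EuclideanSpace ℝ (Fin d) → ℝ))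
      (∑ i, s i • MeshSensitivity.weakFDeriv Ω (ψ i : EuclideanSpace ℝ (Fin d) → ℝ)) := fun s =>
    MeshSensitivity.HasH10Deriv.sum _ fun i _ => (hw i).smul (s i)
  obtain ⟨h0, hmat⟩ := hY.energyForm_material_le hT hΩo hDa.weakFDeriv ha1 hDa' hDb.weakFDeriv hb1
    hDb' hc.1 hf.1 hw (fun i => (ψ i).2) hδ huh hu hu'
  have hcoer := fun s : ι → ℝ =>
    MeshSensitivity.energyForm_self_ge ha1 hb1 hc.1 hDb.weakFDeriv hDb' haa₀ hcb (hsum s)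
  -- Testing the initial equation with the initial solution gives the energy bound `a₀ ‖∇u_0‖² ≤ ‖f‖
  -- ‖u_0‖`.
  have hload := MeshSensitivity.abs_integral_mul_le hf.1 (hsum (u 0)).memLp
  rw [← h0 _ _ (Submodule.sum_mem _ fun i _ => Submodule.smul_mem _ _ (ψ i).2) (hsum (u 0))]
    at hload
  rw [(hsum u').lpNorm_weakGrad hΩo]
  have hMA : 0 ≤ MeshSensitivity.maxAspect T := Real.iSup_nonneg fun K =>
    div_nonneg Metric.diam_nonneg (Real.iInf_nonneg fun p => Metric.infDist_nonneg)
  rw [Real.coe_toNNReal _ (mul_nonneg d.cast_nonneg (mul_nonneg lpNorm_nonneg hMA)),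
    Real.coe_toNNReal _ lpNorm_nonneg] at hmat
  exact MeshSensitivity.material_bound_of_energy_le ha₀ lpNorm_nonneg lpNorm_nonneg
    MeshSensitivity.poincareConst_nonneg lpNorm_nonneg lpNorm_nonneg lpNorm_nonneg lpNorm_nonneg
    lpNorm_nonneg lpNorm_nonneg lpNorm_nonneg lpNorm_nonneg hMA (Nat.cast_nonneg d)
    ((hsum u').lpNorm_le_poincareConst hd hΩo hΩb) ((hsum (u 0)).lpNorm_le_poincareConst hd hΩo hΩb)
    ((hcoer (u 0)).trans ((le_abs_self _).trans hload)) ((hcoer u').trans hmat)
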